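/- Let $d\ge 3$ and let $\Omega=\{(x',t)\in\mathbb R^{d-1}\times\mathbb R : t>\Psi(x')\}$, where $\Psi:\mathbb R^{d-1}\to\mathbb R$ is Lipschitz with $\|\nabla\Psi\|_{L^\infty}\le M$. For $x\in\mathbb R^d$ and $r>0$ write $D(x,r)=B(x,r)\cap\Omega$ and $\Delta(x,r)=B(x,r)\cap\partial\Omega$. Let $A=(a_{ij})$ be a real, measurable, symmetric coefficient matrix with $\mu|\xi|^2\le \sum_{i,j}a_{ij}(x)\xi_i\xi_j$ for all $\xi\in\mathbb R^d$ and $|a_{ij}(x)|\le\mu^{-1}$ for a.e. $x$, where $\mu>0$. Let $V\in L^\infty_{loc}(\mathbb R^d)$ satisfy $V>0$ a.e. and, for some constant $K$, $$\|V\|_{L^\infty(B)}\le K\,\frac1{|B|}\int_B V\quad\text{for every ball }B\subset\mathbb R^d .$$ Define $$m(x,V)=\inf_{r>0}\Big\{\frac1r : \frac1{r^{d-2}}\int_{B(x,r)}V(y)\,dy\le 1\Big\}.$$ Then for every integer $k>0$ there is a constant $C_k>0$, depending only on $d$, $\mu$, $M$, $K$ and $k$, such that the following holds. Let $x_0\in\overline\Omega$,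 $r>0$, and let $u\in W^{1,2}(D(x_0,r))$ be a weak solution of $$-\operatorname{div}(A\nabla u)+Vu=0\ \text{ in } D(x_0,r),\qquad n\cdot A\nabla u=0\ \text{ on }\Delta(x_0,r)$$ ($n$ being the outward unit normal to $\partial\Omega$), that is, $$\int_{D(x_0,r)}\big(A\nabla u\cdot\nabla\varphi+Vu\varphi\big)\,dx=0\qquad\text{for all }\varphi\in C_c^\infty(B(x_0,r)).$$ Then $$\sup_{x\in D(x_0,r/2)}|u(x)|\le\frac{C_k}{(1+r\,m(x_0,V))^k}\left(\frac1{|D(x_0,r)|}\int_{D(x_0,r)}|u|^2\,dx\right)^{1/2},$$ where the supremum is the essential supremum. -/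

import Mathlib

open MeasureTheory Set Metric
open scoped NNReal ENNReal ContDiff

noncomputable section

namespace GraphSchrodinger

/-- Euclidean space of dimension `d = n + 1`; a point is `(x', t)` with `x'` the first `n`
coordinates and `t` the last one. -/
abbrev E (n : ℕ) : Type := EuclideanSpace ℝ (Fin (n + 1))

/-- The first `n` coordinates `x'` of `x = (x', t)`. -/
def horiz {n : ℕ} (x : E n) : EuclideanSpace ℝ (Fin n) :=
  WithLp.toLp 2 (fun i : Fin n => x i.castSucc)

/-- The region `{(x', t) : t > Ψ x'}` above the graph of `Ψ`. -/
def graphDomain {n : ℕ} (Ψ : EuclideanSpace ℝ (Fin n) → ℝ) : Set (E n) :=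
  {x | Ψ (horiz x) < x (Fin.last n)}

/-- `D(x₀, r) = B(x₀, r) ∩ Ω`. -/
def bdryBall {n : ℕ} (Ω : Set (E n)) (x₀ : E n) (r : ℝ) : Set (E n) := ball x₀ r ∩ Ω

/-- The (measurable, real) coefficient matrix is bounded and uniformly elliptic in `Ω` with
constant `μ`, and symmetric. -/
structure IsEllipticSymm {n : ℕ} (Ω : Set (E n)) (μ : ℝ)
    (A : E n → Matrix (Fin (n + 1)) (Fin (n + 1)) ℝ) : Prop where
  aemeasurable : ∀ i j, AEMeasurable (fun x => A x i j) (volume.restrict Ω)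
  elliptic : ∀ᵐ x ∂volume.restrict Ω, ∀ ξ : E n,
    μ * ‖ξ‖ ^ 2 ≤ ∑ i, ∑ j, A x i j * ξ i * ξ j
  bounded : ∀ᵐ x ∂volume.restrict Ω, ∀ i j, |A x i j| ≤ μ⁻¹
  symm : ∀ᵐ x ∂volume.restrict Ω, (A x).IsSymm

/-- `0 < V ∈ B_∞` with constant `K`: `V > 0` a.e., `V ∈ L^∞_loc`, and
`‖V‖_{L^∞(B)} ≤ K ⨍_B V` for every ball `B`. -/
structure IsBInfty {n : ℕ} (K : ℝ) (V : E n → ℝ) : Prop where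
  pos : ∀ᵐ x, 0 < V x
  locBounded : ∀ (x : E n) (r : ℝ), MemLp V ∞ (volume.restrict (ball x r))
  reverse : ∀ (x : E n) (r : ℝ), 0 < r →
    ∀ᵐ y ∂volume.restrict (ball x r), |V y| ≤ K * ⨍ z in ball x r, V z

/-- `ψ(x, r) = r^{-(d-2)} ∫_{B(x,r)} V`, where `d - 2 = n - 1`. -/
def psi {n : ℕ} (V : E n → ℝ) (x : E n) (r : ℝ) : ℝ :=
  1 / r ^ (n - 1) * ∫ y in ball x r, V y

/-- The Fefferman-Phong-Shen function `m(x, V) = inf_{r > 0} {1 / r : ψ(x, r) ≤ 1}`. -/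
def fpsMax {n : ℕ} (x : E n) (V : E n → ℝ) : ℝ :=
  sInf {s : ℝ | ∃ r : ℝ, 0 < r ∧ psi V x r ≤ 1 ∧ s = 1 / r}

/-- The classical partial derivative `∂φ/∂x_i` at `x`. -/
def pderiv {n : ℕ} (φ : E n → ℝ) (i : Fin (n + 1)) (x : E n) : ℝ :=
  fderiv ℝ φ x (EuclideanSpace.single i 1)

/-- `φ ∈ C_c^∞(U)`. -/
def IsTest {n : ℕ} (U : Set (E n)) (φ : E n → ℝ) : Prop :=
  ContDiff ℝ ∞ φ ∧ HasCompactSupport φ ∧ tsupport φ ⊆ U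

/-- `u ∈ W^{1,2}(U)` with weak gradient `G`, for an open set `U`. -/
structure IsSobolev {n : ℕ} (U : Set (E n)) (u : E n → ℝ) (G : E n → E n) : Prop where
  memLp : MemLp u 2 (volume.restrict U)
  grad_memLp : MemLp G 2 (volume.restrict U)
  weak_grad : ∀ φ, IsTest U φ → ∀ i,
    ∫ x in U, u x * pderiv φ i x = -∫ x in U, G x i * φ x

/-- `u ∈ W^{1,2}(D(x₀, r))` is a weak solution of `-div (A ∇u) + V u = 0` in `D(x₀, r)` with
`n · A ∇u = 0` on `B(x₀, r) ∩ ∂Ω`. The test functions vanish near the sphere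
`∂B(x₀, r)` but not on `∂Ω`, which is what encodes the vanishing conormal derivative. -/
def IsWeakNeumannSolution {n : ℕ} (Ω : Set (E n))
    (A : E n → Matrix (Fin (n + 1)) (Fin (n + 1)) ℝ) (V : E n → ℝ)
    (x₀ : E n) (r : ℝ) (u : E n → ℝ) : Prop :=
  ∃ G : E n → E n, IsSobolev (bdryBall Ω x₀ r) u G ∧
    ∀ φ, IsTest (ball x₀ r) φ →
      ∫ x in bdryBall Ω x₀ r,
        ((∑ i, ∑ j, A x i j * G x j * pderiv φ i x) + V x * u x * φ x) = 0

end GraphSchrodinger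

end

open GraphSchrodinger

noncomputable section

namespace GraphSchrodinger

open Filter Topology

variable {n : ℕ}

/-! ### Geometry of the region above a Lipschitz graph -/

/-! The decay comes from a Fefferman-Phong inequality whose constant is small when `ψ(x₀, r)` is
large. For `w` vanishing near the sphere, but not necessarily on the graph, `feffermanPhong` gives
`∫ w² ≤ C r² q^m ∫ (V w² + |∇w|²)` over `D(x₀, r)`, where `q < 1` and `y^m ≤ ψ(x₀, r) < y^(m+1)`.
Taking `w = η u` with a cutoff `η` and bounding the right side by Caccioppoli's inequality yields
`∫_{D(s')} u² ≤ C (r/(s-s'))² q^m ∫_{D(s)} u²` (`decay_step`). Performing `J` such steps between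
radii comparable to `r` costs a constant depending on `J` and gains `q^(mJ)`. Once `q^J y^k < 1`
this beats `ψ(x₀, r)^(-k)` (`decay`). Finally `sq_mul_fpsMax_le` bounds `(r m(x₀, V))²` by a
constant times `1 + ψ(x₀, r)`, and `local_bound` (De Giorgi iteration) turns the `L²` decay into a
pointwise bound.

The Fefferman-Phong constant is a balance of two terms. For `V` in `B_∞` there is `θ < 1` such that
shrinking the radius of a ball by `θ` loses at most half of the mass of `V` (`half_integral_le`).
Averaging at scale `ℓ = θ^m r` gives the gradient term a factor of order `ℓ² = r² q^m` with `q =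
θ²`, and the potential term a factor of order at most `r² 2^m / ψ(x₀, r)`. With `y = 2/q`, the
choice of `m` makes the second at most of order `r² q^m` too.

Uniformity up to the graph, without extension or flattening, rests on one fact: the region is
invariant under translation by the upward cone of slope `M` (`add_mem_graphDomain`). Mollifiers that
sample only upward never leave the region, so `η² F(u)` is a limit of test functions that need not
vanish on the graph (`IsSobolev.isTestLimit`). The Gagliardo-Nirenberg argument works along oblique
axes inside the cone (`sobolev_one_graphDomain`), and the Fefferman-Phong averages are taken over
balls shifted into the cone (`feffermanPhong_test`). -/

/-- The vertical unit vector. -/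
def vert (n : ℕ) : E n := EuclideanSpace.single (Fin.last n) 1

@[simp] lemma norm_vert : ‖vert n‖ = 1 := by simp [vert]

@[simp] lemma vert_last : vert n (Fin.last n) = 1 := by simp [vert]

@[simp] lemma horiz_vert : horiz (vert n) = 0 := by
  ext i; simp [horiz, vert]

lemma horiz_add (x y : E n) : horiz (x + y) = horiz x + horiz y := by
  ext i; simp [horiz]

lemma horiz_smul (c : ℝ) (x : E n) : horiz (c • x) = c • horiz x := by
  ext i; simp [horiz]

lemma norm_horiz_le (x : E n) : ‖horiz x‖ ≤ ‖x‖ := by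
  rw [EuclideanSpace.norm_eq, EuclideanSpace.norm_eq]
  apply Real.sqrt_le_sqrt
  rw [Fin.sum_univ_castSucc (n := n)]
  simp only [horiz]
  exact le_add_of_nonneg_right (by positivity)

lemma continuous_horiz : Continuous (horiz : E n → EuclideanSpace ℝ (Fin n)) := by
  unfold horiz; fun_prop

lemma isOpen_graphDomain {M : ℝ≥0} {Ψ : EuclideanSpace ℝ (Fin n) → ℝ} (hΨ : LipschitzWith M Ψ) :
    IsOpen (graphDomain Ψ) :=
  isOpen_lt (hΨ.continuous.comp continuous_horiz) (by fun_prop)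

lemma isOpen_bdryBall {M : ℝ≥0} {Ψ : EuclideanSpace ℝ (Fin n) → ℝ} (hΨ : LipschitzWith M Ψ)
    (x₀ : E n) (r : ℝ) : IsOpen (bdryBall (graphDomain Ψ) x₀ r) :=
  isOpen_ball.inter (isOpen_graphDomain hΨ)

/-- The region above an `M`-Lipschitz graph is invariant under translation by vectors of the
upward cone of slope `M`. -/
lemma add_mem_graphDomain {M : ℝ≥0} {Ψ : EuclideanSpace ℝ (Fin n) → ℝ} (hΨ : LipschitzWith M Ψ)
    {x h : E n} (hx : x ∈ graphDomain Ψ) (hh : M * ‖horiz h‖ ≤ h (Fin.last n)) :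
    x + h ∈ graphDomain Ψ := by
  have h1 : Ψ (horiz x + horiz h) - Ψ (horiz x) ≤ M * ‖horiz h‖ := by
    have := hΨ.dist_le_mul (horiz x + horiz h) (horiz x)
    rw [Real.dist_eq, dist_eq_norm, add_sub_cancel_left] at this
    exact (le_abs_self _).trans this
  simp only [graphDomain, mem_ofPred_eq, horiz_add, PiLp.add_apply] at hx ⊢
  linarith

/-- Points of the ball of radius `ℓ` around `(M + 1) ℓ e_d` lie in the upward cone. -/
lemma cone_of_mem_closedBall {M : ℝ≥0} {ℓ : ℝ} {h : E n}
    (hh : h ∈ closedBall (((M + 1 : ℝ) * ℓ) • vert n) ℓ) : M * ‖horiz h‖ ≤ h (Fin.last n) := by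
  set k := h - ((M + 1 : ℝ) * ℓ) • vert n with hk
  have hkn : ‖k‖ ≤ ℓ := by simpa [dist_eq_norm] using hh
  have hd : h = ((M + 1 : ℝ) * ℓ) • vert n + k := by simp [hk]
  have h1 : ‖horiz h‖ ≤ ℓ := by
    rw [hd, horiz_add, horiz_smul, horiz_vert, smul_zero, zero_add]
    exact (norm_horiz_le k).trans hkn
  have h2 : |k (Fin.last n)| ≤ ℓ := by
    have := PiLp.norm_apply_le k (Fin.last n)
    exact this.trans hkn
  have h3 : h (Fin.last n) = (M + 1) * ℓ + k (Fin.last n) := by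
    conv_lhs => rw [hd]
    simp
  have := neg_le_of_abs_le h2
  have h4 : (M : ℝ) * ‖horiz h‖ ≤ M * ℓ := by gcongr
  rw [h3]; linarith

lemma norm_le_of_mem_closedBall {M : ℝ≥0} {ℓ : ℝ} {h : E n} (hℓ : 0 ≤ ℓ)
    (hh : h ∈ closedBall (((M + 1 : ℝ) * ℓ) • vert n) ℓ) : ‖h‖ ≤ (M + 2) * ℓ := by
  have h1 : ‖h - ((M + 1 : ℝ) * ℓ) • vert n‖ ≤ ℓ := by simpa [dist_eq_norm] using hh
  have h2 : ‖((M + 1 : ℝ) * ℓ) • vert n‖ = (M + 1) * ℓ := by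
    rw [norm_smul, norm_vert, mul_one, Real.norm_of_nonneg (by positivity)]
  have := norm_sub_norm_le h (((M + 1 : ℝ) * ℓ) • vert n)
  linarith

/-! ### A Sobolev inequality on the region above a Lipschitz graph -/

/-- Coordinates along which every downward step of a coordinate is a step into the upward cone
of slope `M`. -/
def coneCoord (n : ℕ) (M : ℝ) : (Fin (n + 1) → ℝ) →ₗ[ℝ] E n where
  toFun a := -(WithLp.toLp 2 a + (M * ∑ i : Fin n, a i.castSucc) • vert n)
  map_add' a b := by
    ext j; simp [Finset.sum_add_distrib]; ring
  map_smul' c a := by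
    ext j; simp [← Finset.mul_sum]; ring

/-- The map is, up to sign, a vertical shear: the first `n` coordinates can be read off directly,
and once they vanish so does the shear term. -/
lemma coneCoord_injective (M : ℝ) : Function.Injective (coneCoord n M) := by
  rw [injective_iff_map_eq_zero]
  intro a ha
  have h0 : ∀ j, a j + (M * ∑ i : Fin n, a i.castSucc) * vert n j = 0 := by
    intro j
    have := congrArg (fun x : E n => x j) ha
    simp only [coneCoord, LinearMap.coe_mk, AddHom.coe_mk, PiLp.neg_apply, PiLp.add_apply,
      PiLp.smul_apply, PiLp.zero_apply, smul_eq_mul, neg_eq_zero] at this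
    exact this
  have h1 : ∀ i : Fin n, a i.castSucc = 0 := by
    intro i
    have := h0 i.castSucc
    simpa [vert, (Fin.castSucc_lt_last i).ne] using this
  funext j
  refine Fin.lastCases ?_ h1 j
  have := h0 (Fin.last n)
  simpa [h1] using this

lemma coneCoord_single (M : ℝ) (i : Fin (n + 1)) (s : ℝ) :
    coneCoord n M (Pi.single i s) = s • coneCoord n M (Pi.single i 1) := by
  rw [← map_smul]; congr 1; ext j; simp [Pi.single_apply]

/-- For a horizontal index the vector is `e_i + M e_d`, exactly on the boundary of the cone; for the
last index it is `e_d`. -/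
lemma cone_neg_coneCoord (M : ℝ≥0) (i : Fin (n + 1)) :
    M * ‖horiz (-coneCoord n M (Pi.single i 1))‖ ≤ (-coneCoord n M (Pi.single i 1)) (Fin.last n) := by
  have hh : horiz (WithLp.toLp 2 (Pi.single i 1) : E n) =
      WithLp.toLp 2 (fun j : Fin n => (Pi.single i 1 : Fin (n + 1) → ℝ) j.castSucc) := rfl
  simp only [coneCoord, LinearMap.coe_mk, AddHom.coe_mk, neg_neg, horiz_add, horiz_smul, horiz_vert,
    smul_zero, add_zero, PiLp.add_apply, PiLp.smul_apply, vert_last, smul_eq_mul, mul_one, hh]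
  refine Fin.lastCases ?_ (fun j => ?_) i
  · have : (fun j : Fin n => (Pi.single (Fin.last n) 1 : Fin (n + 1) → ℝ) j.castSucc) = 0 := by
      ext j; simp [(Fin.castSucc_lt_last j).ne]
    rw [this]; simp
  · have : (fun l : Fin n => (Pi.single j.castSucc 1 : Fin (n + 1) → ℝ) l.castSucc)
        = Pi.single j 1 := by
      ext l; simp [Pi.single_apply]
    rw [this]
    have h2 : ‖(WithLp.toLp 2 (Pi.single j 1) : EuclideanSpace ℝ (Fin n))‖ = 1 := by
      simp
    rw [h2]
    simp [Pi.single_apply, (Fin.castSucc_lt_last j).ne']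

/-- Sobolev's inequality for the exponent `1` on the region above a Lipschitz graph, without
boundary condition on the graph. -/
theorem sobolev_one_graphDomain (hn : 1 ≤ n) (M : ℝ≥0) :
    ∃ C : ℝ≥0, ∀ Ψ : EuclideanSpace ℝ (Fin n) → ℝ, LipschitzWith M Ψ →
      ∀ w : E n → ℝ, ContDiff ℝ 1 w → HasCompactSupport w →
        ∫⁻ x in graphDomain Ψ, ‖w x‖ₑ ^ ((n + 1 : ℝ) / n) ≤
          C * (∫⁻ x in graphDomain Ψ, ‖fderiv ℝ w x‖ₑ) ^ ((n + 1 : ℝ) / n) := by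
  have hn0 : (0 : ℝ) < n := by exact_mod_cast hn
  set p : ℝ := (n + 1 : ℝ) / n with hp
  have hp0 : 0 ≤ p := by positivity
  have hconj : Real.HolderConjugate (Fintype.card (Fin (n + 1))) p := by
    rw [Real.holderConjugate_iff]
    simp only [Fintype.card_fin, hp]
    push_cast
    refine ⟨by linarith, ?_⟩
    field_simp
    ring
  let T := coneCoord n M
  let eT : (Fin (n + 1) → ℝ) ≃ₗ[ℝ] E n :=
    LinearEquiv.ofInjectiveOfFinrankEq T (coneCoord_injective _) (by simp)
  let e : (Fin (n + 1) → ℝ) ≃L[ℝ] E n := eT.toContinuousLinearEquiv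
  have he : ∀ a, e a = T a := fun a => rfl
  -- Uniqueness of Haar measure supplies the Jacobian of the oblique coordinates; its value is
  -- irrelevant, since it depends only on `n` and `M`.
  obtain ⟨c, hc0, hctop, hc⟩ : ∃ c : ℝ≥0∞, c ≠ 0 ∧ c ≠ ⊤ ∧
      (volume : Measure (E n)) = c • (volume : Measure (Fin (n + 1) → ℝ)).map e := by
    have := Measure.isAddLeftInvariant_eq_smul (volume : Measure (E n))
      ((volume : Measure (Fin (n + 1) → ℝ)).map e)
    refine ⟨_, ?_, ENNReal.coe_ne_top, this⟩
    simpa using (Measure.addHaarScalarFactor_pos_of_isAddHaarMeasure _ _).ne'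
  set S : ℝ≥0 := ∑ i : Fin (n + 1), ‖T (Pi.single i 1)‖₊ with hS
  refine ⟨(c * c⁻¹ ^ p * S ^ p).toNNReal, fun Ψ hΨ w hw hws => ?_⟩
  rw [ENNReal.coe_toNNReal (by finiteness)]
  set Ω := graphDomain Ψ
  have hΩ : MeasurableSet Ω := (isOpen_graphDomain hΨ).measurableSet
  have hfd : Continuous (fderiv ℝ w) := hw.continuous_fderiv one_ne_zero
  let f : (Fin (n + 1) → ℝ) → ℝ≥0∞ := fun a => Ω.indicator (fun x => ‖fderiv ℝ w x‖ₑ) (e a)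
  have hfm : Measurable f :=
    (hfd.enorm.measurable.indicator hΩ).comp e.continuous.measurable
  -- the change of variables
  have hcv : ∀ g : E n → ℝ≥0∞, Measurable g →
      ∫⁻ x in Ω, g x = c * ∫⁻ a, Ω.indicator g (e a) := by
    intro g hg
    rw [← lintegral_indicator hΩ, hc, lintegral_smul_measure, smul_eq_mul,
      lintegral_map (hg.indicator hΩ) e.continuous.measurable]
  -- Along the half-line `s ≤ a i` the point moves inside the upward cone and stays in the region.
  -- Integrating the derivative from infinity, where `w` vanishes, therefore uses `∇w` only inside
  -- the region, and no boundary condition on the graph is needed.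
  have hline : ∀ a, e a ∈ Ω → ∀ i,
      ‖w (e a)‖ₑ ≤ S * ∫⁻ s, f (Function.update a i s) := by
    intro a ha i
    have hupd : ∀ s, e (Function.update a i s) = e a + (s - a i) • T (Pi.single i 1) := by
      intro s
      rw [← coneCoord_single, he, he, ← map_add]
      congr 1
      ext j
      by_cases hj : j = i
      · subst hj; simp
      · simp [hj]
    have hcd : ContDiff ℝ 1 (fun s => w (e (Function.update a i s))) := by
      have : (fun s => w (e (Function.update a i s))) =
        fun s => w (e a + (s - a i) • T (Pi.single i 1)) := by ext s; rw [hupd]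
      rw [this]; fun_prop
    have hcs : HasCompactSupport (fun s => w (e (Function.update a i s))) :=
      hws.comp_isClosedEmbedding (g := fun s => e (Function.update a i s))
        (e.toHomeomorph.isClosedEmbedding.comp (isClosedEmbedding_update a i))
    calc ‖w (e a)‖ₑ = ‖w (e (Function.update a i (a i)))‖ₑ := by simp
      _ ≤ ∫⁻ s in Iic (a i), ‖deriv (fun s => w (e (Function.update a i s))) s‖ₑ :=
          HasCompactSupport.enorm_le_lintegral_Ici_deriv hcd hcs (a i)
      _ ≤ ∫⁻ s in Iic (a i), S * f (Function.update a i s) := by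
          refine setLIntegral_mono_ae (by fun_prop) (ae_of_all _ fun s hs => ?_)
          have hmem : e (Function.update a i s) ∈ Ω := by
            rw [hupd]
            refine add_mem_graphDomain hΨ ha ?_
            have h1 : (s - a i) • T (Pi.single i 1) = (a i - s) • (-T (Pi.single i 1)) := by
              rw [smul_neg, ← neg_smul]; congr 1; ring
            rw [h1, horiz_smul, norm_smul, PiLp.smul_apply, smul_eq_mul,
              Real.norm_of_nonneg (sub_nonneg.2 hs), ← mul_assoc, mul_comm (M : ℝ), mul_assoc]
            exact mul_le_mul_of_nonneg_left (cone_neg_coneCoord M i) (sub_nonneg.2 hs)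
          have hder : HasDerivAt (fun s => w (e (Function.update a i s)))
              (fderiv ℝ w (e (Function.update a i s)) (T (Pi.single i 1))) s := by
            have h1 : HasDerivAt (fun s => e (Function.update a i s)) (T (Pi.single i 1)) s := by
              have : (fun s => e (Function.update a i s)) =
                fun s => e a + (s - a i) • T (Pi.single i 1) := by ext s; rw [hupd]
              rw [this]
              simpa using (((hasDerivAt_id s).sub_const (a i)).smul_const
                (T (Pi.single i 1))).const_add (e a)
            exact ((hw.differentiable one_ne_zero _).hasFDerivAt).comp_hasDerivAt s h1
          rw [hder.deriv]
          simp only [f, indicator_of_mem hmem]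
          refine (ContinuousLinearMap.le_opENorm _ _).trans ?_
          rw [mul_comm]
          gcongr
          rw [enorm_eq_nnnorm, hS, ENNReal.coe_le_coe]
          exact Finset.single_le_sum (f := fun i => ‖T (Pi.single i 1)‖₊)
            (fun _ _ => zero_le) (Finset.mem_univ i)
      _ ≤ ∫⁻ s, S * f (Function.update a i s) := setLIntegral_le_lintegral _ _
      _ = S * ∫⁻ s, f (Function.update a i s) := by
          rw [lintegral_const_mul]
          exact hfm.comp (measurable_update a)
  have hS0 : 0 ≤ 1 / (n : ℝ) := by positivity
  -- The grid-lines inequality behind Gagliardo-Nirenberg-Sobolev, applied to the gradient extended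
  -- by zero outside the region.
  have hgrid := lintegral_prod_lintegral_pow_le (fun _ : Fin (n + 1) => (volume : Measure ℝ))
    hconj hfm
  simp only [Fintype.card_fin, Nat.cast_add, Nat.cast_one, add_sub_cancel_right] at hgrid
  have hpw : ∀ a, Ω.indicator (fun x => ‖w x‖ₑ ^ p) (e a) ≤
      S ^ p * ∏ i, (∫⁻ s, f (Function.update a i s)) ^ (1 / (n : ℝ)) := by
    intro a
    by_cases ha : e a ∈ Ω
    · rw [indicator_of_mem ha]
      calc ‖w (e a)‖ₑ ^ p = ∏ _i : Fin (n + 1), ‖w (e a)‖ₑ ^ (1 / (n : ℝ)) := by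
            rw [Finset.prod_const, Finset.card_univ, Fintype.card_fin, ← ENNReal.rpow_natCast,
              ← ENNReal.rpow_mul]
            congr 1; rw [hp]; push_cast; field_simp
        _ ≤ ∏ i : Fin (n + 1), ((S : ℝ≥0∞) ^ (1 / (n : ℝ)) *
              (∫⁻ s, f (Function.update a i s)) ^ (1 / (n : ℝ))) := by
            gcongr with i
            rw [← ENNReal.mul_rpow_of_nonneg _ _ hS0]
            gcongr
            exact hline a ha i
        _ = _ := by
            rw [Finset.prod_mul_distrib, Finset.prod_const, Finset.card_univ, Fintype.card_fin,
              ← ENNReal.rpow_natCast, ← ENNReal.rpow_mul]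
            congr 2; rw [hp]; push_cast; field_simp
    · rw [indicator_of_notMem ha]; exact zero_le
  calc ∫⁻ x in Ω, ‖w x‖ₑ ^ p = c * ∫⁻ a, Ω.indicator (fun x => ‖w x‖ₑ ^ p) (e a) :=
        hcv _ (hw.continuous.enorm.measurable.pow_const _)
    _ ≤ c * ∫⁻ a, S ^ p * ∏ i, (∫⁻ s, f (Function.update a i s)) ^ (1 / (n : ℝ)) := by
        gcongr with a; exact hpw a
    _ ≤ c * (S ^ p * (∫⁻ a, f a) ^ p) := by
        rw [lintegral_const_mul' _ _ (by finiteness)]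
        gcongr
        exact hgrid
    _ = c * c⁻¹ ^ p * S ^ p * (∫⁻ x in Ω, ‖fderiv ℝ w x‖ₑ) ^ p := by
        rw [hcv _ hfd.enorm.measurable, ENNReal.mul_rpow_of_nonneg _ _ hp0]
        have h1 : c⁻¹ ^ p * c ^ p = 1 := by
          rw [← ENNReal.mul_rpow_of_nonneg _ _ hp0, ENNReal.inv_mul_cancel hc0 hctop,
            ENNReal.one_rpow]
        calc c * (S ^ p * (∫⁻ a, f a) ^ p) = c * S ^ p * (∫⁻ a, f a) ^ p * 1 := by ring
          _ = _ := by rw [← h1]; simp only [f]; ring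

section

variable {F : Type*} [NormedAddCommGroup F] [NormedSpace ℝ F]

/-! ### Mollification in `L²` -/

lemma eLpNorm_two_sq {α : Type*} [MeasurableSpace α] {μ : Measure α} {G : Type*}
    [NormedAddCommGroup G] (f : α → G) : eLpNorm f 2 μ ^ 2 = ∫⁻ x, ‖f x‖ₑ ^ 2 ∂μ := by
  have := eLpNorm_nnreal_pow_eq_lintegral (f := f) (μ := μ) (p := 2) two_ne_zero
  simpa using this

lemma sq_lintegral_mul_le {α : Type*} [MeasurableSpace α] {μ : Measure α} {a b : α → ℝ≥0∞}
    (ha : AEMeasurable a μ) (hb : AEMeasurable b μ) :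
    (∫⁻ x, a x * b x ∂μ) ^ 2 ≤ (∫⁻ x, a x ^ 2 ∂μ) * ∫⁻ x, b x ^ 2 ∂μ := by
  have h := ENNReal.lintegral_mul_le_Lp_mul_Lq μ Real.HolderConjugate.two_two ha hb
  simp only [Pi.mul_apply, ENNReal.rpow_two] at h
  have h2 : ∀ c : ℝ≥0∞, (c ^ (1 / 2 : ℝ)) ^ 2 = c := by
    intro c
    rw [← ENNReal.rpow_natCast, ← ENNReal.rpow_mul]; norm_num
  calc (∫⁻ x, a x * b x ∂μ) ^ 2 ≤ _ := pow_le_pow_left' h 2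
    _ = _ := by
      rw [mul_pow, h2, h2]

/-- Jensen's inequality for a sub-probability weight, obtained from Cauchy-Schwarz by splitting `a
b` as `√a · (√a b)`. -/
lemma sq_lintegral_le_of_weight {α : Type*} [MeasurableSpace α] {μ : Measure α} {a b : α → ℝ≥0∞}
    (ha : AEMeasurable a μ) (hb : AEMeasurable b μ) (h1 : ∫⁻ x, a x ∂μ ≤ 1) :
    (∫⁻ x, a x * b x ∂μ) ^ 2 ≤ ∫⁻ x, a x * b x ^ 2 ∂μ := by
  have hs : ∀ c : ℝ≥0∞, (c ^ (1 / 2 : ℝ)) ^ 2 = c := by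
    intro c
    rw [← ENNReal.rpow_natCast, ← ENNReal.rpow_mul]; norm_num
  have hs' : ∀ c : ℝ≥0∞, c ^ (1 / 2 : ℝ) * c ^ (1 / 2 : ℝ) = c := by
    intro c; rw [← sq, hs]
  have := sq_lintegral_mul_le (ha.pow_const (1 / 2 : ℝ)) ((ha.pow_const (1 / 2 : ℝ)).mul hb)
  simp only [Pi.mul_apply, ← mul_assoc, hs', mul_pow, hs] at this
  refine this.trans ?_
  calc _ ≤ 1 * ∫⁻ x, a x * b x ^ 2 ∂μ := by gcongr
    _ = _ := one_mul _

omit [NormedSpace ℝ F] in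
/-- Translations are continuous in `L²`. -/
lemma tendsto_eLpNorm_translate_sub {f : E n → F} (hf : MemLp f 2 volume) :
    Tendsto (fun z : E n => eLpNorm (fun x => f (x - z) - f x) 2 volume) (𝓝 0) (𝓝 0) := by
  let g : E n → C(E n, E n) := fun z => ⟨fun x => x - z, by fun_prop⟩
  have hg : Continuous g :=
    (ContinuousMap.mk (fun p : E n × E n => p.2 - p.1) (by fun_prop)).curry.continuous
  have hgm : ∀ z, MeasurePreserving (g z) (volume : Measure (E n)) volume :=
    fun z => measurePreserving_sub_right volume z
  have h := ((continuous_const (y := hf.toLp f)).compMeasurePreservingLp hg hgm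
    (by norm_num : (2 : ℝ≥0∞) ≠ ⊤)).tendsto 0
  rw [tendsto_iff_edist_tendsto_0] at h
  refine h.congr fun z => ?_
  rw [Lp.edist_def]
  have h1 : ∀ z, (Lp.compMeasurePreserving (g z) (hgm z) (hf.toLp f) : E n → F) =ᵐ[volume]
      fun x => f (x - z) := fun z =>
    (Lp.coeFn_compMeasurePreserving _ (hgm z)).trans
      ((hgm z).quasiMeasurePreserving.ae_eq_comp hf.coeFn_toLp)
  refine eLpNorm_congr_ae (((h1 z).sub (h1 0)).trans (ae_of_all _ fun x => ?_))
  simp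

/-- The mollification of `f` with kernel `ρ`. -/
def mollify (ρ : E n → ℝ) (f : E n → F) (x : E n) : F := ∫ y, ρ (x - y) • f y

lemma mollify_eq_convolution (ρ : E n → ℝ) (f : E n → F) :
    mollify ρ f = convolution f ρ (ContinuousLinearMap.lsmul ℝ ℝ).flip volume := rfl

lemma mollify_eq (ρ : E n → ℝ) (f : E n → F) (x : E n) :
    mollify ρ f x = ∫ t, ρ t • f (x - t) := by
  rw [mollify, ← integral_sub_left_eq_self (fun t => ρ t • f (x - t)) volume x]
  simp

lemma contDiff_mollify {ρ : E n → ℝ} (hρ : ContDiff ℝ ∞ ρ) (hρc : HasCompactSupport ρ)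
    {f : E n → F} (hf : LocallyIntegrable f volume) : ContDiff ℝ ∞ (mollify ρ f) := by
  rw [mollify_eq_convolution]
  exact hρc.contDiff_convolution_right _ hf hρ

lemma integrable_mollify {ρ : E n → ℝ} (hρ : Continuous ρ) (hρc : HasCompactSupport ρ)
    {f : E n → F} (hf : LocallyIntegrable f volume) (x : E n) :
    Integrable (fun y => ρ (x - y) • f y) :=
  hρc.convolutionExists_right (ContinuousLinearMap.lsmul ℝ ℝ).flip hf hρ x

lemma fderiv_mollify {ρ : E n → ℝ} (hρ : ContDiff ℝ ∞ ρ) (hρc : HasCompactSupport ρ)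
    {f : E n → F} (hf : LocallyIntegrable f volume) (x v : E n) :
    fderiv ℝ (mollify ρ f) x v = ∫ y, fderiv ℝ ρ (x - y) v • f y := by
  have h1 := hρc.hasFDerivAt_convolution_right (ContinuousLinearMap.lsmul ℝ ℝ).flip hf
    (hρ.of_le (by exact_mod_cast le_top)) x
  rw [← mollify_eq_convolution] at h1
  rw [h1.fderiv, convolution_precompR_apply _ hf (hρc.fderiv ℝ)
    (hρ.continuous_fderiv (by simp))]
  rfl

/-- If translating `f` by vectors of the support of a probability kernel moves `f` by at most `ε`
in `L²`, so does the mollification. -/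
lemma eLpNorm_mollify_sub_le [CompleteSpace F] {ρ : E n → ℝ} (hρ : Continuous ρ) (hρc : HasCompactSupport ρ)
    (hρ0 : ∀ x, 0 ≤ ρ x) (hρ1 : ∫ x, ρ x = 1) {f : E n → F} (hf : MemLp f 2 volume)
    {ε : ℝ≥0∞} (hε : ∀ t, ρ t ≠ 0 → eLpNorm (fun x => f (x - t) - f x) 2 volume ≤ ε) :
    eLpNorm (fun x => mollify ρ f x - f x) 2 volume ≤ ε := by
  have hfl : LocallyIntegrable f volume := hf.locallyIntegrable (by norm_num)
  have hρi : Integrable ρ := hρ.integrable_of_hasCompactSupport hρc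
  have hρl : ∫⁻ t, ‖ρ t‖ₑ = 1 := by
    simp_rw [fun t => Real.enorm_of_nonneg (hρ0 t)]
    rw [← ofReal_integral_eq_lintegral_ofReal hρi (ae_of_all _ hρ0), hρ1, ENNReal.ofReal_one]
  have hmeas : AEStronglyMeasurable (fun p : E n × E n => f (p.1 - p.2))
      (volume.prod volume) :=
    hf.1.comp_quasiMeasurePreserving
      (quasiMeasurePreserving_sub_of_right_invariant volume volume)
  have hmeas1 : AEStronglyMeasurable (fun p : E n × E n => f p.1) (volume.prod volume) :=
    hf.1.comp_fst
  have hmeas2 : AEMeasurable (fun p : E n × E n => ‖ρ p.2‖ₑ * ‖f (p.1 - p.2) - f p.1‖ₑ ^ 2)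
      (volume.prod volume) :=
    ((hρ.comp continuous_snd).enorm.measurable.aemeasurable).mul
      ((hmeas.sub hmeas1).enorm.pow_const 2)
  have hpt : ∀ x, ‖mollify ρ f x - f x‖ₑ ^ 2 ≤ ∫⁻ t, ‖ρ t‖ₑ * ‖f (x - t) - f x‖ₑ ^ 2 := by
    intro x
    have hi : Integrable (fun t => ρ t • f (x - t)) := by
      have := (integrable_mollify hρ hρc hfl x).comp_sub_left x
      simpa using this
    have h1 : mollify ρ f x - f x = ∫ t, ρ t • (f (x - t) - f x) := by
      simp_rw [smul_sub]
      rw [integral_sub hi (hρi.smul_const _), integral_smul_const, hρ1, one_smul, mollify_eq]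
    rw [h1]
    have hx : AEStronglyMeasurable (fun t => f (x - t) - f x) volume :=
      (hf.1.comp_quasiMeasurePreserving (quasiMeasurePreserving_sub_left volume x)).sub
        aestronglyMeasurable_const
    calc _ ≤ (∫⁻ t, ‖ρ t‖ₑ * ‖f (x - t) - f x‖ₑ) ^ 2 := by
          gcongr
          refine (enorm_integral_le_lintegral_enorm _).trans_eq ?_
          simp_rw [enorm_smul]
      _ ≤ _ := sq_lintegral_le_of_weight hρ.enorm.measurable.aemeasurable hx.enorm hρl.le
  have h2 : eLpNorm (fun x => mollify ρ f x - f x) 2 volume ^ 2 ≤ ε ^ 2 := by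
    rw [eLpNorm_two_sq]
    calc ∫⁻ x, ‖mollify ρ f x - f x‖ₑ ^ 2
        ≤ ∫⁻ x, ∫⁻ t, ‖ρ t‖ₑ * ‖f (x - t) - f x‖ₑ ^ 2 := lintegral_mono hpt
      _ = ∫⁻ t, ∫⁻ x, ‖ρ t‖ₑ * ‖f (x - t) - f x‖ₑ ^ 2 := lintegral_lintegral_swap hmeas2
      _ ≤ ∫⁻ t, ‖ρ t‖ₑ * ε ^ 2 := by
          refine lintegral_mono fun t => ?_
          dsimp only
          rw [lintegral_const_mul' _ _ enorm_ne_top, ← eLpNorm_two_sq]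
          by_cases ht : ρ t = 0
          · simp [ht]
          · gcongr; exact hε t ht
      _ = ε ^ 2 := by rw [lintegral_mul_const _ hρ.enorm.measurable, hρl, one_mul]
  exact (ENNReal.pow_le_pow_left_iff two_ne_zero).1 h2

/-- The kernel supported in the ball of radius `ε` around `-(M + 1) ε e_d`. -/
def downKernel (n : ℕ) (M ε : ℝ) (hε : 0 < ε) : E n → ℝ :=
  (⟨ε / 2, ε, by positivity, by linarith⟩ :
    ContDiffBump (-(((M + 1) * ε) • vert n) : E n)).normed volume

lemma neg_mem_of_mem_tsupport_downKernel {M : ℝ} {ε : ℝ} {hε : 0 < ε} {t : E n}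
    (ht : t ∈ tsupport (downKernel n M ε hε)) :
    -t ∈ closedBall (((M + 1) * ε) • vert n) ε := by
  rw [downKernel, ContDiffBump.tsupport_normed_eq] at ht
  rw [mem_closedBall, ← dist_neg_neg, neg_neg]
  exact ht

/-- Mollifications with downward kernels converge in `L²`. -/
lemma tendsto_mollify_downKernel [CompleteSpace F] (M : ℝ≥0) {ε : ℕ → ℝ} (hε : ∀ j, 0 < ε j)
    (hε0 : Tendsto ε atTop (𝓝 0)) {f : E n → F} (hf : MemLp f 2 volume) :
    Tendsto (fun j => eLpNorm (fun x => mollify (downKernel n M (ε j) (hε j)) f x - f x) 2 volume)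
      atTop (𝓝 0) := by
  have h := tendsto_eLpNorm_translate_sub hf
  rw [ENNReal.tendsto_nhds_zero] at h ⊢
  intro δ hδ
  obtain ⟨η, hη, hη'⟩ := Metric.eventually_nhds_iff.1 (h δ hδ)
  have hlim : Tendsto (fun j => (M + 2 : ℝ) * ε j) atTop (𝓝 0) := by
    simpa using hε0.const_mul (M + 2 : ℝ)
  filter_upwards [hlim.eventually (gt_mem_nhds hη)] with j hj
  refine eLpNorm_mollify_sub_le (ContDiffBump.continuous_normed _)
    (ContDiffBump.hasCompactSupport_normed _) (ContDiffBump.nonneg_normed _)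
    (ContDiffBump.integral_normed _) hf fun t ht => hη' ?_
  rw [dist_zero_right, ← norm_neg]
  have hts : t ∈ tsupport (downKernel n M (ε j) (hε j)) := subset_tsupport _ ht
  exact (norm_le_of_mem_closedBall (hε j).le
    (neg_mem_of_mem_tsupport_downKernel hts)).trans_lt hj


end

/-! ### Approximation of Sobolev functions by test functions -/

lemma gradient_apply (φ : E n → ℝ) (x : E n) (i : Fin (n + 1)) :
    gradient φ x i = pderiv φ i x := by
  have h := InnerProductSpace.toDual_symm_apply (𝕜 := ℝ) (x := EuclideanSpace.single i (1 : ℝ))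
    (y := fderiv ℝ φ x)
  rw [pderiv, ← h, gradient, EuclideanSpace.inner_single_right]
  simp

lemma norm_gradient (φ : E n → ℝ) (x : E n) : ‖gradient φ x‖ = ‖fderiv ℝ φ x‖ := by
  rw [gradient, LinearIsometryEquiv.norm_map]

lemma continuous_gradient {φ : E n → ℝ} (hφ : ContDiff ℝ 1 φ) : Continuous (gradient φ) :=
  (InnerProductSpace.toDual ℝ (E n)).symm.continuous.comp (hφ.continuous_fderiv one_ne_zero)

lemma gradient_eq_zero_of_notMem_tsupport {φ : E n → ℝ} {x : E n} (hx : x ∉ tsupport φ) :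
    gradient φ x = 0 := by
  rw [← norm_eq_zero, norm_gradient, fderiv_of_notMem_tsupport (𝕜 := ℝ) hx, norm_zero]

lemma gradient_mul_comp {ζ v : E n → ℝ} {F : ℝ → ℝ} {x : E n} (hζ : DifferentiableAt ℝ ζ x)
    (hv : DifferentiableAt ℝ v x) (hF : DifferentiableAt ℝ F (v x)) :
    gradient (fun y => ζ y * F (v y)) x =
      (ζ x * deriv F (v x)) • gradient v x + F (v x) • gradient ζ x := by
  have h1 : HasFDerivAt (fun y => F (v y)) (deriv F (v x) • fderiv ℝ v x) x :=
    hF.hasDerivAt.comp_hasFDerivAt x hv.hasFDerivAt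
  have h2 := hζ.hasFDerivAt.mul h1
  have h3 : fderiv ℝ (fun y => ζ y * F (v y)) x =
    ζ x • deriv F (v x) • fderiv ℝ v x + F (v x) • fderiv ℝ ζ x := h2.fderiv
  simp only [gradient, h3, map_add, map_smul, smul_smul]

/-- Mollifying a Sobolev function with a downward kernel commutes with the weak gradient. -/
lemma IsSobolev.gradient_mollify {U : Set (E n)} (hU : IsOpen U) {u : E n → ℝ} {G : E n → E n}
    (hu : IsSobolev U u G) {M ε : ℝ} (hε : 0 < ε) {x : E n}
    (hx : ∀ y, y - x ∈ closedBall (((M + 1) * ε) • vert n) ε → y ∈ U) :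
    gradient (mollify (downKernel n M ε hε) (U.indicator u)) x =
      mollify (downKernel n M ε hε) (U.indicator G) x := by
  set ρ := downKernel n M ε hε with hρdef
  have hρ : ContDiff ℝ ∞ ρ := ContDiffBump.contDiff_normed _
  have hρc : HasCompactSupport ρ := ContDiffBump.hasCompactSupport_normed _
  have hul : LocallyIntegrable (U.indicator u) volume :=
    ((memLp_indicator_iff_restrict hU.measurableSet).2 hu.memLp).locallyIntegrable (by norm_num)
  have hGl : LocallyIntegrable (U.indicator G) volume :=
    ((memLp_indicator_iff_restrict hU.measurableSet).2 hu.grad_memLp).locallyIntegrable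
      (by norm_num)
  -- The reflected kernel has compact support in `U` by `hx`, so it is admissible in the definition
  -- of the weak gradient, even when `x` is close to the graph.
  let φ : E n → ℝ := fun y => ρ (x - y)
  have hφ : IsTest U φ := by
    refine ⟨hρ.comp (contDiff_const.sub contDiff_id), ?_, ?_⟩
    · exact hρc.comp_homeomorph (Homeomorph.subLeft x)
    · have h1 : tsupport φ ⊆ {y | x - y ∈ tsupport ρ} :=
        closure_minimal (fun y hy => subset_tsupport ρ hy)
          ((isClosed_tsupport ρ).preimage (by fun_prop))
      intro y hy
      refine hx y ?_
      have := neg_mem_of_mem_tsupport_downKernel (h1 hy)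
      rwa [neg_sub] at this
  have hφd : ∀ i y, pderiv φ i y = -fderiv ℝ ρ (x - y) (EuclideanSpace.single i 1) := by
    intro i y
    have h1 : HasFDerivAt (fun y => x - y) (-ContinuousLinearMap.id ℝ (E n)) y :=
      (hasFDerivAt_id y).const_sub x
    have h2 := ((hρ.differentiable (by simp) (x - y)).hasFDerivAt).comp y h1
    rw [pderiv, show φ = ρ ∘ fun y => x - y from rfl, h2.fderiv]
    simp
  ext i
  rw [gradient_apply, pderiv, fderiv_mollify hρ hρc hul]
  have h1 : ∫ y, fderiv ℝ ρ (x - y) (EuclideanSpace.single i 1) • U.indicator u y =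
      -∫ y in U, u y * pderiv φ i y := by
    rw [← integral_indicator hU.measurableSet, ← integral_neg]
    congr 1; ext y
    by_cases hy : y ∈ U
    · simp [hy, hφd, mul_comm]
    · simp [hy]
  have h2 : mollify ρ (U.indicator G) x i = ∫ y in U, G y i * φ y := by
    rw [← integral_indicator hU.measurableSet, mollify]
    have := (EuclideanSpace.proj i : E n →L[ℝ] ℝ).integral_comp_comm
      (integrable_mollify hρ.continuous hρc hGl x)
    refine this.symm.trans ?_
    congr 1; ext y
    by_cases hy : y ∈ U
    · simp [hy, φ, mul_comm]
    · simp [hy]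
  rw [h1, h2, hu.weak_grad φ hφ i, neg_neg]

lemma tendsto_of_sq_tendsto_zero {a : ℕ → ℝ≥0∞} (h : Tendsto (fun j => a j ^ 2) atTop (𝓝 0)) :
    Tendsto a atTop (𝓝 0) := by
  have h2 : ∀ c : ℝ≥0∞, (c ^ 2) ^ (1 / 2 : ℝ) = c := by
    intro c
    rw [← ENNReal.rpow_natCast, ← ENNReal.rpow_mul]; norm_num
  have := (ENNReal.continuous_rpow_const (y := (1 / 2 : ℝ))).tendsto 0 |>.comp h
  simp only [Function.comp_def, h2] at this
  simpa using this

lemma tendsto_eLpNorm_two_of_dominated {α : Type*} [MeasurableSpace α] {μ : Measure α}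
    {G : Type*} [NormedAddCommGroup G] {f : ℕ → α → G} {b : α → ℝ}
    (hf : ∀ j, AEStronglyMeasurable (f j) μ) (hb : MemLp b 2 μ)
    (hfb : ∀ j, ∀ᵐ x ∂μ, ‖f j x‖ ≤ b x) (hlim : ∀ᵐ x ∂μ, Tendsto (fun j => f j x) atTop (𝓝 0)) :
    Tendsto (fun j => eLpNorm (f j) 2 μ) atTop (𝓝 0) := by
  apply tendsto_of_sq_tendsto_zero
  simp_rw [eLpNorm_two_sq]
  have h0 : ∫⁻ _ : α, (0 : ℝ≥0∞) ∂μ = 0 := by simp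
  rw [← h0]
  refine tendsto_lintegral_of_dominated_convergence' (fun x => ‖b x‖ₑ ^ 2)
    (fun j => (hf j).enorm.pow_const 2) (fun j => ?_) ?_ ?_
  · filter_upwards [hfb j] with x hx
    gcongr
    exact enorm_le_iff_norm_le.2 (hx.trans (le_abs_self _))
  · rw [← eLpNorm_two_sq]
    exact ENNReal.pow_ne_top hb.2.ne
  · filter_upwards [hlim] with x hx
    have := (ENNReal.continuous_pow 2).tendsto 0 |>.comp
      ((continuous_enorm.tendsto (0 : G)).comp hx |>.trans (by simp))
    simpa [Function.comp_def] using this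

/-- `(w, g)` is a limit in `L²(U)` and almost everywhere of `(φ, ∇φ)`, `φ ∈ C_c^∞(B)`. -/
structure IsTestLimit (U B : Set (E n)) (w : E n → ℝ) (g : E n → E n) : Prop where
  memLp : MemLp w 2 (volume.restrict U)
  grad_memLp : MemLp g 2 (volume.restrict U)
  exists_seq : ∃ φ : ℕ → E n → ℝ, (∀ j, IsTest B (φ j)) ∧
    (∀ᵐ x ∂volume.restrict U, Tendsto (fun j => φ j x) atTop (𝓝 (w x))) ∧
    Tendsto (fun j => eLpNorm (fun x => φ j x - w x) 2 (volume.restrict U)) atTop (𝓝 0) ∧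
    Tendsto (fun j => eLpNorm (fun x => gradient (φ j) x - g x) 2 (volume.restrict U))
      atTop (𝓝 0)

lemma abs_sub_le_of_deriv_le {F : ℝ → ℝ} (hF : ContDiff ℝ ∞ F) {B : ℝ}
    (hB : ∀ t, |deriv F t| ≤ B) (s t : ℝ) : |F s - F t| ≤ B * |s - t| := by
  have := convex_univ.norm_image_sub_le_of_norm_deriv_le (f := F) (C := B) (x := t) (y := s)
    (fun x _ => hF.differentiable (by simp) x) (fun x _ => hB x) (mem_univ _) (mem_univ _)
  simpa using this

/-- Smooth functions with bounded derivative operate on Sobolev functions, and after localization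
the result is a limit of test functions that need not vanish on the graph. -/
theorem IsSobolev.isTestLimit {M : ℝ≥0} {Ψ : EuclideanSpace ℝ (Fin n) → ℝ}
    (hΨ : LipschitzWith M Ψ) {x₀ : E n} {r : ℝ} {u : E n → ℝ} {G : E n → E n}
    (hu : IsSobolev (bdryBall (graphDomain Ψ) x₀ r) u G) {ζ : E n → ℝ}
    (hζ : IsTest (ball x₀ r) ζ) {F : ℝ → ℝ} (hF : ContDiff ℝ ∞ F) (hF0 : F 0 = 0) {B : ℝ}
    (hB : ∀ t, |deriv F t| ≤ B) :
    IsTestLimit (bdryBall (graphDomain Ψ) x₀ r) (ball x₀ r) (fun x => ζ x * F (u x))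
      (fun x => (ζ x * deriv F (u x)) • G x + F (u x) • gradient ζ x) := by
  set D := bdryBall (graphDomain Ψ) x₀ r with hD
  have hDo : IsOpen D := isOpen_bdryBall hΨ x₀ r
  set μ := volume.restrict D with hμ
  have hF1 : Continuous (deriv F) := hF.continuous_deriv (by simp)
  have hζ1 : ContDiff ℝ 1 ζ := hζ.1.of_le (by exact_mod_cast le_top)
  have hgc : Continuous (gradient ζ) := continuous_gradient hζ1
  have hB0 : 0 ≤ B := (abs_nonneg _).trans (hB 0)
  obtain ⟨Z, hZ⟩ : ∃ Z, ∀ x, ‖ζ x‖ ≤ Z := hζ.2.1.exists_bound_of_continuous hζ.1.continuous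
  obtain ⟨Z', hZ'⟩ : ∃ Z, ∀ x, ‖gradient ζ x‖ ≤ Z := by
    obtain ⟨Z, h⟩ := (hζ.2.1.fderiv ℝ).exists_bound_of_continuous
      (hζ1.continuous_fderiv one_ne_zero)
    exact ⟨Z, fun x => (norm_gradient ζ x).trans_le (h x)⟩
  have hZ0 : 0 ≤ Z := (norm_nonneg _).trans (hZ 0)
  have hZ'0 : 0 ≤ Z' := (norm_nonneg _).trans (hZ' 0)
  have hFu : ∀ t, |F t| ≤ B * |t| := fun t => by simpa [hF0] using abs_sub_le_of_deriv_le hF hB t 0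
  have hum : AEStronglyMeasurable u μ := hu.memLp.1
  have hFum : AEStronglyMeasurable (fun x => F (u x)) μ :=
    hF.continuous.comp_aestronglyMeasurable hum
  have hF1um : AEStronglyMeasurable (fun x => deriv F (u x)) μ :=
    hF1.comp_aestronglyMeasurable hum
  have hζm : AEStronglyMeasurable ζ μ := hζ.1.continuous.aestronglyMeasurable
  have hgm : AEStronglyMeasurable (gradient ζ) μ := hgc.aestronglyMeasurable
  have hGm : AEStronglyMeasurable G μ := hu.grad_memLp.1
  -- the mollifications
  obtain ⟨δ, hδ, hδS⟩ := hζ.2.1.isCompact.exists_cthickening_subset_open isOpen_ball hζ.2.2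
  -- A kernel with parameter `ε` displaces points by at most `(M + 2) ε`. Hence these parameters
  -- keep the sampled points within `δ` of the support of `ζ`, so inside the ball.
  have hε' : ∀ j : ℕ, 0 < δ / (M + 2) * (1 / ((j : ℝ) + 1)) := fun j => by positivity
  have hε0' : Tendsto (fun j : ℕ => δ / (M + 2) * (1 / ((j : ℝ) + 1))) atTop (𝓝 0) := by
    simpa using (tendsto_one_div_add_atTop_nhds_zero_nat (𝕜 := ℝ)).const_mul (δ / (M + 2 : ℝ))
  have huL : MemLp (D.indicator u) 2 volume :=
    (memLp_indicator_iff_restrict hDo.measurableSet).2 hu.memLp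
  have hGL : MemLp (D.indicator G) 2 volume :=
    (memLp_indicator_iff_restrict hDo.measurableSet).2 hu.grad_memLp
  have hc1 := tendsto_mollify_downKernel M hε' hε0' huL
  have hc2 := tendsto_mollify_downKernel M hε' hε0' hGL
  have hsm : ∀ j, ContDiff ℝ ∞ (mollify (downKernel n M _ (hε' j)) (D.indicator u)) := fun j =>
    contDiff_mollify (ContDiffBump.contDiff_normed _) (ContDiffBump.hasCompactSupport_normed _)
      (huL.locallyIntegrable (by norm_num))
  have hsm' : ∀ j, ContDiff ℝ ∞ (mollify (downKernel n M _ (hε' j)) (D.indicator G)) := fun j =>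
    contDiff_mollify (ContDiffBump.contDiff_normed _) (ContDiffBump.hasCompactSupport_normed _)
      (hGL.locallyIntegrable (by norm_num))
  have hgr : ∀ j, ∀ x ∈ D, x ∈ tsupport ζ →
      gradient (mollify (downKernel n M _ (hε' j)) (D.indicator u)) x =
        mollify (downKernel n M _ (hε' j)) (D.indicator G) x := by
    intro j x hx hxS
    refine hu.gradient_mollify hDo (hε' j) fun y hy => ⟨hδS ?_, ?_⟩
    · refine mem_cthickening_of_dist_le y x δ _ hxS ?_
      rw [dist_eq_norm]
      refine (norm_le_of_mem_closedBall (hε' j).le hy).trans ?_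
      have : 1 / ((j : ℝ) + 1) ≤ 1 := by
        rw [div_le_one (by positivity)]; linarith [(Nat.cast_nonneg j : (0 : ℝ) ≤ j)]
      calc ((M : ℝ) + 2) * (δ / (M + 2) * (1 / ((j : ℝ) + 1)))
          = δ * (1 / ((j : ℝ) + 1)) := by field_simp
        _ ≤ δ * 1 := by gcongr
        _ = δ := mul_one δ
    · have := add_mem_graphDomain hΨ hx.2 (cone_of_mem_closedBall hy)
      simpa using this
  -- A subsequence converging almost everywhere is needed because `F'` is only continuous and
  -- bounded: `F'(U_j) G → F'(u) G` is obtained by dominated convergence.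
  obtain ⟨ns, hns, hae⟩ := (tendstoInMeasure_of_tendsto_eLpNorm two_ne_zero
    (fun j => (hsm j).continuous.aestronglyMeasurable) huL.1 hc1).exists_seq_tendsto_ae
  set U : ℕ → E n → ℝ := fun j => mollify (downKernel n M _ (hε' (ns j))) (D.indicator u) with hU
  set V : ℕ → E n → E n :=
    fun j => mollify (downKernel n M _ (hε' (ns j))) (D.indicator G) with hV
  have hUs : ∀ j, ContDiff ℝ ∞ (U j) := fun j => hsm _
  have hVs : ∀ j, Continuous (V j) := fun j => (hsm' _).continuous
  have hUV : ∀ j, ∀ x ∈ D, x ∈ tsupport ζ → gradient (U j) x = V j x := fun j => hgr _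
  have hUu : Tendsto (fun j => eLpNorm (fun x => U j x - u x) 2 μ) atTop (𝓝 0) := by
    refine tendsto_of_tendsto_of_tendsto_of_le_of_le tendsto_const_nhds
      (hc1.comp hns.tendsto_atTop) (fun _ => zero_le) fun j => ?_
    calc eLpNorm (fun x => U j x - u x) 2 μ = eLpNorm (fun x => U j x - D.indicator u x) 2 μ := by
          refine eLpNorm_congr_ae ?_
          filter_upwards [ae_restrict_mem hDo.measurableSet] with x hx
          simp [hx]
      _ ≤ _ := eLpNorm_mono_measure _ Measure.restrict_le_self
  have hVG : Tendsto (fun j => eLpNorm (fun x => V j x - G x) 2 μ) atTop (𝓝 0) := by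
    refine tendsto_of_tendsto_of_tendsto_of_le_of_le tendsto_const_nhds
      (hc2.comp hns.tendsto_atTop) (fun _ => zero_le) fun j => ?_
    calc eLpNorm (fun x => V j x - G x) 2 μ = eLpNorm (fun x => V j x - D.indicator G x) 2 μ := by
          refine eLpNorm_congr_ae ?_
          filter_upwards [ae_restrict_mem hDo.measurableSet] with x hx
          simp [hx]
      _ ≤ _ := eLpNorm_mono_measure _ Measure.restrict_le_self
  have hUae : ∀ᵐ x ∂μ, Tendsto (fun j => U j x) atTop (𝓝 (u x)) := by
    filter_upwards [ae_restrict_mem hDo.measurableSet, ae_restrict_of_ae hae] with x hx h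
    simpa [hx] using h
  clear_value U V
  refine ⟨?_, ?_, fun j x => ζ x * F (U j x), fun j => ⟨?_, ?_, ?_⟩, ?_, ?_, ?_⟩
  · refine (hu.memLp.const_mul (Z * B)).mono (hζm.mul hFum) (ae_of_all _ fun x => ?_)
    simp only [norm_mul, Real.norm_eq_abs, abs_of_nonneg hZ0, abs_of_nonneg hB0]
    have := hZ x
    rw [mul_assoc]
    exact mul_le_mul this (hFu _) (abs_nonneg _) hZ0
  · refine MemLp.add ?_ ?_
    · refine (hu.grad_memLp.const_smul (Z * B)).mono ((hζm.mul hF1um).smul hGm)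
        (ae_of_all _ fun x => ?_)
      simp only [norm_smul, norm_mul, Pi.smul_apply, Real.norm_eq_abs, abs_of_nonneg hZ0,
        abs_of_nonneg hB0]
      gcongr
      · exact hZ x
      · exact hB _
    · refine (hu.memLp.const_mul (Z' * B)).mono (hFum.smul hgm) (ae_of_all _ fun x => ?_)
      simp only [norm_smul, norm_mul, Real.norm_eq_abs, abs_of_nonneg hZ'0, abs_of_nonneg hB0]
      calc |F (u x)| * ‖gradient ζ x‖ ≤ (B * |u x|) * Z' := by
            gcongr
            · exact hFu _
            · exact hZ' x
        _ = _ := by ring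
  · exact hζ.1.mul (hF.comp (hUs j))
  · exact hζ.2.1.mul_right
  · exact (tsupport_mul_subset_left).trans hζ.2.2
  · filter_upwards [hUae] with x hx
    exact ((hF.continuous.tendsto _).comp hx).const_mul _
  · have hle : ∀ j, eLpNorm (fun x => ζ x * F (U j x) - ζ x * F (u x)) 2 μ ≤
        ENNReal.ofReal (Z * B) * eLpNorm (fun x => U j x - u x) 2 μ := by
      intro j
      refine eLpNorm_le_mul_eLpNorm_of_ae_le_mul (ae_of_all _ fun x => ?_) 2
      rw [← mul_sub, norm_mul, mul_assoc]
      exact mul_le_mul (hZ x) (abs_sub_le_of_deriv_le hF hB _ _) (norm_nonneg _) hZ0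
    refine tendsto_of_tendsto_of_tendsto_of_le_of_le tendsto_const_nhds ?_
      (fun _ => zero_le) hle
    simpa using ENNReal.Tendsto.const_mul hUu (Or.inr ENNReal.ofReal_ne_top)
  · have hUm : ∀ j, AEStronglyMeasurable (U j) μ := fun j =>
      (hUs j).continuous.aestronglyMeasurable
    have hVm : ∀ j, AEStronglyMeasurable (V j) μ := fun j => (hVs j).aestronglyMeasurable
    -- The error in the gradient is split by the product rule into three parts: `a` is controlled by
    -- convergence of the gradients, `b` by dominated convergence, and `c` by the Lipschitz bound on
    -- `F`.
    let a : ℕ → E n → E n := fun j x => (ζ x * deriv F (U j x)) • (V j x - G x)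
    let b : ℕ → E n → E n := fun j x => (ζ x * (deriv F (U j x) - deriv F (u x))) • G x
    let c : ℕ → E n → E n := fun j x => (F (U j x) - F (u x)) • gradient ζ x
    have ham : ∀ j, AEStronglyMeasurable (a j) μ := fun j =>
      (hζm.mul (hF1.comp_aestronglyMeasurable (hUm j))).smul ((hVm j).sub hGm)
    have hbm : ∀ j, AEStronglyMeasurable (b j) μ := fun j =>
      (hζm.mul ((hF1.comp_aestronglyMeasurable (hUm j)).sub hF1um)).smul hGm
    have hcm : ∀ j, AEStronglyMeasurable (c j) μ := fun j =>
      ((hF.continuous.comp_aestronglyMeasurable (hUm j)).sub hFum).smul hgm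
    have ha : Tendsto (fun j => eLpNorm (a j) 2 μ) atTop (𝓝 0) := by
      have hle : ∀ j, eLpNorm (a j) 2 μ ≤
          ENNReal.ofReal (Z * B) * eLpNorm (fun x => V j x - G x) 2 μ := by
        intro j
        refine eLpNorm_le_mul_eLpNorm_of_ae_le_mul (ae_of_all _ fun x => ?_) 2
        simp only [a, norm_smul, norm_mul]
        gcongr
        · exact hZ x
        · exact hB _
      refine tendsto_of_tendsto_of_tendsto_of_le_of_le tendsto_const_nhds ?_
        (fun _ => zero_le) hle
      simpa using ENNReal.Tendsto.const_mul hVG (Or.inr ENNReal.ofReal_ne_top)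
    have hb : Tendsto (fun j => eLpNorm (b j) 2 μ) atTop (𝓝 0) := by
      refine tendsto_eLpNorm_two_of_dominated (b := fun x => Z * (2 * B) * ‖G x‖) hbm
        (hu.grad_memLp.norm.const_mul _) (fun j => ae_of_all _ fun x => ?_) ?_
      · simp only [b, norm_smul, norm_mul]
        gcongr
        · exact hZ x
        · refine (norm_sub_le _ _).trans ?_
          have h1 := hB (U j x)
          have h2 := hB (u x)
          simp only [Real.norm_eq_abs]; linarith
      · filter_upwards [hUae] with x hx
        have h1 : Tendsto (fun j => deriv F (U j x) - deriv F (u x)) atTop (𝓝 0) := by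
          simpa using (((hF1.tendsto _).comp hx).sub_const (deriv F (u x)))
        simpa using (h1.const_mul (ζ x)).smul_const (G x)
    have hc : Tendsto (fun j => eLpNorm (c j) 2 μ) atTop (𝓝 0) := by
      have hle : ∀ j, eLpNorm (c j) 2 μ ≤
          ENNReal.ofReal (B * Z') * eLpNorm (fun x => U j x - u x) 2 μ := by
        intro j
        refine eLpNorm_le_mul_eLpNorm_of_ae_le_mul (ae_of_all _ fun x => ?_) 2
        simp only [c, norm_smul]
        calc ‖F (U j x) - F (u x)‖ * ‖gradient ζ x‖ ≤ (B * |U j x - u x|) * Z' := by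
              gcongr
              · exact abs_sub_le_of_deriv_le hF hB _ _
              · exact hZ' x
          _ = _ := by rw [Real.norm_eq_abs]; ring
      refine tendsto_of_tendsto_of_tendsto_of_le_of_le tendsto_const_nhds ?_
        (fun _ => zero_le) hle
      simpa using ENNReal.Tendsto.const_mul hUu (Or.inr ENNReal.ofReal_ne_top)
    have hsum : ∀ j, eLpNorm (fun x => gradient (fun x => ζ x * F (U j x)) x -
        ((ζ x * deriv F (u x)) • G x + F (u x) • gradient ζ x)) 2 μ ≤
        eLpNorm (a j) 2 μ + eLpNorm (b j) 2 μ + eLpNorm (c j) 2 μ := by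
      intro j
      calc _ = eLpNorm (a j + b j + c j) 2 μ := by
            refine eLpNorm_congr_ae ?_
            filter_upwards [ae_restrict_mem hDo.measurableSet] with x hx
            rw [gradient_mul_comp (hζ.1.differentiable (by simp) x)
              ((hUs j).differentiable (by simp) x) (hF.differentiable (by simp) _)]
            have h1 : (ζ x * deriv F (U j x)) • gradient (U j) x =
                (ζ x * deriv F (U j x)) • V j x := by
              by_cases hxS : x ∈ tsupport ζ
              · rw [hUV j x hx hxS]
              · simp [image_eq_zero_of_notMem_tsupport hxS]
            rw [h1]
            simp only [Pi.add_apply, a, b, c]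
            module
        _ ≤ eLpNorm (a j + b j) 2 μ + eLpNorm (c j) 2 μ :=
            eLpNorm_add_le ((ham j).add (hbm j)) (hcm j) (by norm_num)
        _ ≤ _ := by
            gcongr
            exact eLpNorm_add_le (ham j) (hbm j) (by norm_num)
    refine tendsto_of_tendsto_of_tendsto_of_le_of_le tendsto_const_nhds ?_
      (fun _ => zero_le) hsum
    simpa using (ha.add hb).add hc

/-! ### Energy estimates -/

lemma integrable_inner_of_memLp {α : Type*} [MeasurableSpace α] {μ : Measure α}
    {H : Type*} [NormedAddCommGroup H] [InnerProductSpace ℝ H] {f g : α → H}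
    (hf : MemLp f 2 μ) (hg : MemLp g 2 μ) : Integrable (fun x => inner ℝ (f x) (g x)) μ :=
  (hf.norm.integrable_mul hg.norm).mono (hf.1.inner hg.1) (ae_of_all _ fun _ =>
    (abs_real_inner_le_norm _ _).trans (le_abs_self _))

lemma ofReal_sq_eq_enorm_sq (a : ℝ) : ENNReal.ofReal (a ^ 2) = ‖a‖ₑ ^ 2 := by
  rw [← sq_abs, ENNReal.ofReal_pow (abs_nonneg a), Real.enorm_eq_ofReal_abs]

/-- Cauchy-Schwarz bounds the difference by the `L²` norm of `f` times that of `φ j - g`. This is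
what passes the weak formulation to limits of test functions. -/
lemma tendsto_integral_inner {α : Type*} [MeasurableSpace α] {μ : Measure α}
    {H : Type*} [NormedAddCommGroup H] [InnerProductSpace ℝ H] {f g : α → H} {φ : ℕ → α → H}
    (hf : MemLp f 2 μ) (hg : MemLp g 2 μ) (hφ : ∀ j, MemLp (φ j) 2 μ)
    (h : Tendsto (fun j => eLpNorm (fun x => φ j x - g x) 2 μ) atTop (𝓝 0)) :
    Tendsto (fun j => ∫ x, inner ℝ (f x) (φ j x) ∂μ) atTop (𝓝 (∫ x, inner ℝ (f x) (g x) ∂μ)) := by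
  refine tendsto_integral_of_L1 _ (integrable_inner_of_memLp hf hg).1
    (Eventually.of_forall fun j => integrable_inner_of_memLp hf (hφ j)) ?_
  apply tendsto_of_sq_tendsto_zero
  have hlim : Tendsto (fun j => eLpNorm f 2 μ ^ 2 * eLpNorm (fun x => φ j x - g x) 2 μ ^ 2)
      atTop (𝓝 0) := by
    have h1 := ((ENNReal.continuous_pow 2).tendsto 0).comp h
    have := ENNReal.Tendsto.const_mul (a := eLpNorm f 2 μ ^ 2) h1
      (Or.inr (ENNReal.pow_ne_top hf.2.ne))
    simpa [Function.comp_def] using this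
  refine tendsto_of_tendsto_of_tendsto_of_le_of_le tendsto_const_nhds hlim
    (fun _ => zero_le) fun j => ?_
  dsimp only
  rw [eLpNorm_two_sq, eLpNorm_two_sq]
  refine le_trans ?_ (sq_lintegral_mul_le hf.1.enorm ((hφ j).1.sub hg.1).enorm)
  gcongr with x
  rw [← inner_sub_right]
  rw [← enorm_norm (f x), ← enorm_norm (φ j x - g x), ← enorm_mul]
  exact enorm_le_iff_norm_le.2 ((abs_real_inner_le_norm _ _).trans (le_abs_self _))

lemma IsTest.memLp {B : Set (E n)} {φ : E n → ℝ} (hφ : IsTest B φ) (μ : Measure (E n))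
    [IsFiniteMeasureOnCompacts μ] : MemLp φ 2 μ :=
  hφ.1.continuous.memLp_of_hasCompactSupport hφ.2.1

lemma hasCompactSupport_gradient {φ : E n → ℝ} (hφ : HasCompactSupport φ) :
    HasCompactSupport (gradient φ) :=
  (hφ.fderiv ℝ).comp_left (g := (InnerProductSpace.toDual ℝ (E n)).symm) (map_zero _)

lemma IsTest.contDiff_one {B : Set (E n)} {φ : E n → ℝ} (hφ : IsTest B φ) : ContDiff ℝ 1 φ :=
  hφ.1.of_le (by exact_mod_cast le_top)

lemma IsTest.gradient_memLp {B : Set (E n)} {φ : E n → ℝ} (hφ : IsTest B φ) (μ : Measure (E n))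
    [IsFiniteMeasureOnCompacts μ] : MemLp (gradient φ) 2 μ :=
  (continuous_gradient hφ.contDiff_one).memLp_of_hasCompactSupport
    (hasCompactSupport_gradient hφ.2.1)

/-- The flux `A G`. -/
def flux (A : E n → Matrix (Fin (n + 1)) (Fin (n + 1)) ℝ) (G : E n → E n) (x : E n) : E n :=
  WithLp.toLp 2 fun i => ∑ j, A x i j * G x j

lemma inner_flux (A : E n → Matrix (Fin (n + 1)) (Fin (n + 1)) ℝ) (G : E n → E n) (x v : E n) :
    inner ℝ (flux A G x) v = ∑ i, ∑ j, A x i j * G x j * v i := by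
  simp only [PiLp.inner_apply, flux]
  refine Finset.sum_congr rfl fun i _ => ?_
  simp [Finset.mul_sum, mul_comm]

lemma norm_le_sum_abs (x : E n) : ‖x‖ ≤ ∑ i, |x i| := by
  have h := (EuclideanSpace.basisFun (Fin (n + 1)) ℝ).sum_repr x
  calc ‖x‖ = ‖∑ i, (EuclideanSpace.basisFun (Fin (n + 1)) ℝ).repr x i •
        EuclideanSpace.basisFun (Fin (n + 1)) ℝ i‖ := by rw [h]
    _ ≤ ∑ i, ‖(EuclideanSpace.basisFun (Fin (n + 1)) ℝ).repr x i •
        EuclideanSpace.basisFun (Fin (n + 1)) ℝ i‖ := norm_sum_le _ _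
    _ = _ := by simp [norm_smul]

lemma norm_flux_le {A : E n → Matrix (Fin (n + 1)) (Fin (n + 1)) ℝ} {G : E n → E n} {x : E n}
    {c : ℝ} (hA : ∀ i j, |A x i j| ≤ c) : ‖flux A G x‖ ≤ (n + 1) ^ 2 * c * ‖G x‖ := by
  have hc : 0 ≤ c := (abs_nonneg _).trans (hA 0 0)
  refine (norm_le_sum_abs _).trans ?_
  calc ∑ i, |flux A G x i| ≤ ∑ _i : Fin (n + 1), ∑ _j : Fin (n + 1), c * ‖G x‖ := by
        refine Finset.sum_le_sum fun i _ => ?_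
        refine (Finset.abs_sum_le_sum_abs (fun j => A x i j * G x j) Finset.univ).trans
          (Finset.sum_le_sum fun j _ => ?_)
        rw [abs_mul]
        exact mul_le_mul (hA i j) (PiLp.norm_apply_le (G x) j) (abs_nonneg _) hc
    _ = _ := by simp; ring

lemma memLp_flux {Ω U : Set (E n)} (hU : U ⊆ Ω) {μ : ℝ}
    {A : E n → Matrix (Fin (n + 1)) (Fin (n + 1)) ℝ} (hA : IsEllipticSymm Ω μ A)
    {G : E n → E n} (hG : MemLp G 2 (volume.restrict U)) :
    MemLp (flux A G) 2 (volume.restrict U) := by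
  have hm : AEStronglyMeasurable (flux A G) (volume.restrict U) := by
    have h1 : ∀ i j, AEMeasurable (fun x => A x i j) (volume.restrict U) := fun i j =>
      (hA.aemeasurable i j).mono_measure (Measure.restrict_mono hU le_rfl)
    have h2 : ∀ j, AEMeasurable (fun x => G x j) (volume.restrict U) := fun j =>
      ((EuclideanSpace.proj j : E n →L[ℝ] ℝ).continuous.measurable).comp_aemeasurable
        hG.1.aemeasurable
    have h3 : AEMeasurable (fun x i => ∑ j, A x i j * G x j) (volume.restrict U) :=
      aemeasurable_pi_lambda _ fun i =>
        Finset.aemeasurable_fun_sum _ fun j _ => (h1 i j).mul (h2 j)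
    exact ((PiLp.continuous_toLp 2 (fun _ : Fin (n + 1) => ℝ)).measurable.comp_aemeasurable
      h3).aestronglyMeasurable
  refine (hG.norm.const_mul ((n + 1) ^ 2 * μ⁻¹)).mono hm ?_
  filter_upwards [ae_restrict_of_ae_restrict_of_subset hU hA.bounded] with x hx
  refine (norm_flux_le hx).trans (le_abs_self _)

lemma memLp_mul_of_memLp_top {α : Type*} [MeasurableSpace α] {ν : Measure α} {V u : α → ℝ}
    (hV : MemLp V ⊤ ν) (hu : MemLp u 2 ν) : MemLp (fun x => V x * u x) 2 ν :=
  hu.mul hV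

/-- The weak formulation extends to limits of test functions. -/
lemma weak_form_of_isTestLimit {Ω : Set (E n)} {μ : ℝ}
    {A : E n → Matrix (Fin (n + 1)) (Fin (n + 1)) ℝ} (hA : IsEllipticSymm Ω μ A) {V : E n → ℝ}
    {x₀ : E n} {r : ℝ} (hV : MemLp V ⊤ (volume.restrict (ball x₀ r))) {u : E n → ℝ}
    {G : E n → E n} (hu : IsSobolev (bdryBall Ω x₀ r) u G)
    (heq : ∀ φ, IsTest (ball x₀ r) φ → ∫ x in bdryBall Ω x₀ r,
        ((∑ i, ∑ j, A x i j * G x j * pderiv φ i x) + V x * u x * φ x) = 0)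
    {w : E n → ℝ} {g : E n → E n} (hw : IsTestLimit (bdryBall Ω x₀ r) (ball x₀ r) w g) :
    Integrable (fun x => inner ℝ (flux A G x) (g x) + V x * u x * w x)
        (volume.restrict (bdryBall Ω x₀ r)) ∧
      ∫ x in bdryBall Ω x₀ r, (inner ℝ (flux A G x) (g x) + V x * u x * w x) = 0 := by
  have hVD : MemLp V ⊤ (volume.restrict (bdryBall Ω x₀ r)) :=
    hV.mono_measure (Measure.restrict_mono inter_subset_left le_rfl)
  have hfl : MemLp (flux A G) 2 (volume.restrict (bdryBall Ω x₀ r)) :=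
    memLp_flux inter_subset_right hA hu.grad_memLp
  have hmul : ∀ a b : ℝ, inner ℝ a b = a * b := fun a b => by simp [mul_comm]
  -- Since `V` is bounded on the ball, the zeroth-order term is also an `L²` pairing, so both terms
  -- pass to the limit in the same way.
  have hVu := memLp_mul_of_memLp_top hVD hu.memLp
  have hint : ∀ {w : E n → ℝ} {g : E n → E n}, MemLp w 2 (volume.restrict (bdryBall Ω x₀ r)) →
      MemLp g 2 (volume.restrict (bdryBall Ω x₀ r)) →
      Integrable (fun x => inner ℝ (flux A G x) (g x)) (volume.restrict (bdryBall Ω x₀ r)) ∧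
      Integrable (fun x => V x * u x * w x) (volume.restrict (bdryBall Ω x₀ r)) :=
    fun hw hg => ⟨integrable_inner_of_memLp hfl hg, hVu.integrable_mul hw⟩
  have hi := hint hw.memLp hw.grad_memLp
  refine ⟨hi.1.add hi.2, ?_⟩
  obtain ⟨φ, hφ, -, h1, h2⟩ := hw.exists_seq
  have hφi := fun j => hint ((hφ j).memLp (volume.restrict (bdryBall Ω x₀ r)))
    ((hφ j).gradient_memLp (volume.restrict (bdryBall Ω x₀ r)))
  have l1 := tendsto_integral_inner hfl hw.grad_memLp (fun j => (hφ j).gradient_memLp _) h2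
  have l2 := tendsto_integral_inner hVu hw.memLp (fun j => (hφ j).memLp _) h1
  simp only [hmul] at l2
  have l3 := l1.add l2
  rw [integral_add hi.1 hi.2]
  have e1 : ∀ j, (∫ x in bdryBall Ω x₀ r, inner ℝ (flux A G x) (gradient (φ j) x)) +
      ∫ x in bdryBall Ω x₀ r, V x * u x * φ j x = 0 := by
    intro j
    refine Eq.trans ?_ (heq (φ j) (hφ j))
    have h3 := integral_add (hφi j).1 (hφi j).2
    simp only [inner_flux, gradient_apply] at h3
    simp only [h3, inner_flux, gradient_apply]
  simp only [e1] at l3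
  exact tendsto_nhds_unique l3 tendsto_const_nhds

/-- With `a = |e h'| ‖g‖` and `b = |h| ‖γ‖`, ellipticity gives at least `μ a²`, while the cross term
is at most `2 Λ a b` and is absorbed by Young's inequality, leaving `(μ/2) a² - (2Λ²/μ) b²`. The
left side is at most `2 a² + 2 b² + q`; the factor `4/μ` turns `(μ/2) a²` into `2 a²`, and the extra
`1` makes the coefficient of `q` at least one. -/
lemma caccioppoli_pointwise {H : Type*} [NormedAddCommGroup H] [InnerProductSpace ℝ H]
    {μ Λ : ℝ} (hμ : 0 < μ) {f g γ : H} {e h h' F F' q : ℝ}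
    (hell : μ * ‖g‖ ^ 2 ≤ inner ℝ f g) (hf : ‖f‖ ≤ Λ * ‖g‖) (hF' : h' ^ 2 ≤ F')
    (hF : |F| ≤ |h| * |h'|) (hq : 0 ≤ q) :
    ‖(e * h') • g + h • γ‖ ^ 2 + q ≤
      (1 + 4 / μ) * (inner ℝ f ((e * e * F') • g + F • ((2 * e) • γ)) + q) +
        ((1 + 4 / μ) * (2 * Λ ^ 2 / μ) + 2) * (h * ‖γ‖) ^ 2 := by
  have e2 : |inner ℝ f γ| ≤ Λ * ‖g‖ * ‖γ‖ :=
    (abs_real_inner_le_norm _ _).trans (mul_le_mul_of_nonneg_right hf (norm_nonneg _))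
  rw [inner_add_right, inner_smul_right, inner_smul_right, inner_smul_right]
  set a := |e| * |h'| * ‖g‖ with ha
  set b := |h| * ‖γ‖ with hb
  have ha2 : a ^ 2 = e ^ 2 * h' ^ 2 * ‖g‖ ^ 2 := by
    rw [ha]; simp only [mul_pow, sq_abs]
  have hb2 : (h * ‖γ‖) ^ 2 = b ^ 2 := by
    rw [hb]; simp only [mul_pow, sq_abs]
  have s1 : ‖(e * h') • g + h • γ‖ ^ 2 ≤ 2 * a ^ 2 + 2 * b ^ 2 := by
    have h1 : ‖(e * h') • g + h • γ‖ ≤ a + b := by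
      refine (norm_add_le _ _).trans_eq ?_
      simp [norm_smul, ha, hb]
    have h2 := pow_le_pow_left₀ (norm_nonneg _) h1 2
    nlinarith [sq_nonneg (a - b)]
  have s2 : μ * a ^ 2 ≤ e * e * F' * inner ℝ f g := by
    calc μ * a ^ 2 = (e ^ 2 * h' ^ 2) * (μ * ‖g‖ ^ 2) := by rw [ha2]; ring
      _ ≤ (e ^ 2 * F') * inner ℝ f g := by
          gcongr
          exact mul_nonneg (sq_nonneg _) ((sq_nonneg _).trans hF')
      _ = _ := by ring
  have s3 : -(2 * Λ * a * b) ≤ F * (2 * e * inner ℝ f γ) := by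
    refine neg_le_of_abs_le ?_
    calc |F * (2 * e * inner ℝ f γ)| = |F| * (2 * |e| * |inner ℝ f γ|) := by
          simp only [abs_mul, abs_two]
      _ ≤ (|h| * |h'|) * (2 * |e| * (Λ * ‖g‖ * ‖γ‖)) := by gcongr
      _ = _ := by rw [ha, hb]; ring
  have s4 : 2 * Λ * a * b ≤ μ / 2 * a ^ 2 + 2 * Λ ^ 2 / μ * b ^ 2 := by
    have h1 : 0 ≤ (μ * a - 2 * Λ * b) ^ 2 / (2 * μ) := by positivity
    have h2 : (μ * a - 2 * Λ * b) ^ 2 / (2 * μ) =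
        μ / 2 * a ^ 2 + 2 * Λ ^ 2 / μ * b ^ 2 - 2 * Λ * a * b := by
      field_simp; ring
    linarith
  rw [hb2]
  have hd : 0 < 4 / μ := by positivity
  have s5 : μ / 2 * a ^ 2 + q - 2 * Λ ^ 2 / μ * b ^ 2 ≤
      e * e * F' * inner ℝ f g + F * (2 * e * inner ℝ f γ) + q := by linarith
  have s6 := mul_le_mul_of_nonneg_left s5 (by linarith : 0 ≤ 1 + 4 / μ)
  have s7 : (1 + 4 / μ) * (μ / 2 * a ^ 2) = 2 * a ^ 2 + μ / 2 * a ^ 2 := by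
    field_simp; ring
  have s8 : q ≤ (1 + 4 / μ) * q := by nlinarith
  have s9 : 0 ≤ μ / 2 * a ^ 2 := by positivity
  linarith

/-- **Caccioppoli's inequality** for a smooth nonlinearity `F` and a function `h` with
`h'² ≤ F'` and `|F| ≤ |h h'|`. -/
theorem caccioppoli (n : ℕ) {μ : ℝ} (hμ : 0 < μ) : ∃ C : ℝ, 0 < C ∧
    ∀ {M : ℝ≥0} {Ψ : EuclideanSpace ℝ (Fin n) → ℝ}, LipschitzWith M Ψ →
    ∀ {A : E n → Matrix (Fin (n + 1)) (Fin (n + 1)) ℝ}, IsEllipticSymm (graphDomain Ψ) μ A →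
    ∀ {V : E n → ℝ}, (∀ᵐ x, 0 < V x) → ∀ {x₀ : E n} {r : ℝ},
    MemLp V ⊤ (volume.restrict (ball x₀ r)) →
    ∀ {u : E n → ℝ} {G : E n → E n}, IsSobolev (bdryBall (graphDomain Ψ) x₀ r) u G →
    (∀ φ, IsTest (ball x₀ r) φ → ∫ x in bdryBall (graphDomain Ψ) x₀ r,
        ((∑ i, ∑ j, A x i j * G x j * pderiv φ i x) + V x * u x * φ x) = 0) →
    ∀ {η : E n → ℝ}, IsTest (ball x₀ r) η →
    ∀ {F h : ℝ → ℝ} {B B' : ℝ}, ContDiff ℝ ∞ F → ContDiff ℝ ∞ h → F 0 = 0 → h 0 = 0 →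
    (∀ t, |deriv F t| ≤ B) → (∀ t, |deriv h t| ≤ B') → (∀ t, deriv h t ^ 2 ≤ deriv F t) →
    (∀ t, |F t| ≤ |h t| * |deriv h t|) → (∀ t, 0 ≤ t * F t) →
    ∫⁻ x in bdryBall (graphDomain Ψ) x₀ r,
        (‖(η x * deriv h (u x)) • G x + h (u x) • gradient η x‖ₑ ^ 2 +
          ENNReal.ofReal (V x * (η x ^ 2 * (u x * F (u x))))) ≤
      ENNReal.ofReal C * ∫⁻ x in bdryBall (graphDomain Ψ) x₀ r,
        ‖h (u x)‖ₑ ^ 2 * ‖gradient η x‖ₑ ^ 2 := by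
  set Λ : ℝ := (n + 1) ^ 2 * μ⁻¹ with hΛ
  have hΛ0 : 0 < Λ := by positivity
  set c : ℝ := 1 + 4 / μ with hc
  have hc0 : 0 < c := by positivity
  refine ⟨c * (2 * Λ ^ 2 / μ) + 2, by positivity, ?_⟩
  intro M Ψ hΨ A hA V hVpos x₀ r hV u G hu heq η hη F h B B' hF hh hF0 hh0 hFB hhB hhF hFh htF
  set D := bdryBall (graphDomain Ψ) x₀ r with hD
  set ν := volume.restrict D with hν
  -- The equation is tested with `η² F(u)`; its energy integral vanishes, so integrating the
  -- pointwise inequality leaves only the term with `∇η`.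
  have hη2 : IsTest (ball x₀ r) (fun x => η x * η x) :=
    ⟨hη.1.mul hη.1, hη.2.1.mul_right, tsupport_mul_subset_left.trans hη.2.2⟩
  have hgη2 : ∀ x, gradient (fun x => η x * η x) x = (2 * η x) • gradient η x := by
    intro x
    have h1 := hη.1.differentiable (by simp) x
    have h2 := (h1.hasFDerivAt.mul h1.hasFDerivAt).fderiv
    have h3 : fderiv ℝ (fun x => η x * η x) x = η x • fderiv ℝ η x + η x • fderiv ℝ η x := h2
    simp only [gradient, h3, map_add, map_smul]
    module
  have hlim1 := hu.isTestLimit hΨ hη2 hF hF0 hFB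
  have hlim2 := hu.isTestLimit hΨ hη hh hh0 hhB
  obtain ⟨hint, hzero⟩ := weak_form_of_isTestLimit hA hV hu heq hlim1
  have hBη : MemLp (fun x => h (u x) * ‖gradient η x‖) 2 ν := by
    obtain ⟨Z, hZ⟩ := (hasCompactSupport_gradient hη.2.1).exists_bound_of_continuous
      (continuous_gradient hη.contDiff_one)
    have hB0 : 0 ≤ B' := (abs_nonneg _).trans (hhB 0)
    have hZ0 : 0 ≤ Z := (norm_nonneg _).trans (hZ 0)
    refine (hu.memLp.const_mul (B' * Z)).mono
      ((hh.continuous.comp_aestronglyMeasurable hu.memLp.1).mul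
        (continuous_gradient hη.contDiff_one).norm.aestronglyMeasurable) (ae_of_all _ fun x => ?_)
    have h1 : |h (u x)| ≤ B' * |u x| := by
      simpa [hh0] using abs_sub_le_of_deriv_le hh hhB (u x) 0
    simp only [norm_mul, Real.norm_eq_abs, abs_norm, abs_of_nonneg hB0, abs_of_nonneg hZ0]
    calc |h (u x)| * ‖gradient η x‖ ≤ (B' * |u x|) * Z := by gcongr; exact hZ x
      _ = _ := by ring
  have hpt : ∀ᵐ x ∂ν, 0 ≤ V x * (η x ^ 2 * (u x * F (u x))) ∧
      ‖(η x * deriv h (u x)) • G x + h (u x) • gradient η x‖ ^ 2 +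
        V x * (η x ^ 2 * (u x * F (u x))) ≤
      c * (inner ℝ (flux A G x) ((η x * η x * deriv F (u x)) • G x +
          F (u x) • gradient (fun x => η x * η x) x) + V x * u x * (η x * η x * F (u x))) +
        (c * (2 * Λ ^ 2 / μ) + 2) * (h (u x) * ‖gradient η x‖) ^ 2 := by
    filter_upwards [ae_restrict_of_ae hVpos,
      ae_restrict_of_ae_restrict_of_subset inter_subset_right hA.bounded,
      ae_restrict_of_ae_restrict_of_subset inter_subset_right hA.elliptic] with x hVx hbx hex
    have hq : 0 ≤ V x * (η x ^ 2 * (u x * F (u x))) :=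
      mul_nonneg hVx.le (mul_nonneg (sq_nonneg _) (htF _))
    refine ⟨hq, ?_⟩
    have e1 : μ * ‖G x‖ ^ 2 ≤ inner ℝ (flux A G x) (G x) := by
      rw [inner_flux]
      refine (hex (G x)).trans_eq ?_
      refine Finset.sum_congr rfl fun i _ => Finset.sum_congr rfl fun j _ => by ring
    have hqe : V x * u x * (η x * η x * F (u x)) = V x * (η x ^ 2 * (u x * F (u x))) := by ring
    rw [hgη2, hqe]
    exact caccioppoli_pointwise hμ e1 (norm_flux_le hbx) (hhF _) (hFh _) hq
  have hZi : Integrable (fun x => (h (u x) * ‖gradient η x‖) ^ 2) ν := hBη.integrable_sq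
  have hgi : Integrable (fun x => ‖(η x * deriv h (u x)) • G x + h (u x) • gradient η x‖ ^ 2) ν :=
    hlim2.grad_memLp.norm.integrable_sq
  have hVi : Integrable (fun x => V x * (η x ^ 2 * (u x * F (u x)))) ν := by
    have hVD : MemLp V ⊤ ν := hV.mono_measure (Measure.restrict_mono inter_subset_left le_rfl)
    refine ((memLp_mul_of_memLp_top hVD hu.memLp).integrable_mul hlim1.memLp).congr
      (ae_of_all _ fun x => ?_)
    simp only [Pi.mul_apply]; ring
  have hreal := integral_mono_ae (hgi.add hVi) ((hint.const_mul c).add (hZi.const_mul _))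
    (hpt.mono fun x hx => hx.2)
  simp only [Pi.add_apply] at hreal
  rw [integral_add (hint.const_mul c) (hZi.const_mul _), integral_const_mul, hzero, mul_zero,
    zero_add, integral_const_mul] at hreal
  calc ∫⁻ x, (‖(η x * deriv h (u x)) • G x + h (u x) • gradient η x‖ₑ ^ 2 +
          ENNReal.ofReal (V x * (η x ^ 2 * (u x * F (u x))))) ∂ν
      = ∫⁻ x, ENNReal.ofReal (‖(η x * deriv h (u x)) • G x + h (u x) • gradient η x‖ ^ 2 +
          V x * (η x ^ 2 * (u x * F (u x)))) ∂ν := by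
        refine lintegral_congr_ae (hpt.mono fun x hx => ?_)
        dsimp only
        rw [ENNReal.ofReal_add (by positivity) hx.1, ENNReal.ofReal_pow (norm_nonneg _),
          ofReal_norm]
    _ = ENNReal.ofReal (∫ x, (‖(η x * deriv h (u x)) • G x + h (u x) • gradient η x‖ ^ 2 +
          V x * (η x ^ 2 * (u x * F (u x)))) ∂ν) := by
        refine (ofReal_integral_eq_lintegral_ofReal (hgi.add hVi) ?_).symm
        filter_upwards [hpt] with x hx
        exact add_nonneg (by positivity) hx.1
    _ ≤ ENNReal.ofReal ((c * (2 * Λ ^ 2 / μ) + 2) * ∫ x, (h (u x) * ‖gradient η x‖) ^ 2 ∂ν) :=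
        ENNReal.ofReal_le_ofReal hreal
    _ = _ := by
        rw [ENNReal.ofReal_mul (by positivity), ofReal_integral_eq_lintegral_ofReal hZi
          (ae_of_all _ fun x => sq_nonneg _)]
        simp_rw [ofReal_sq_eq_enorm_sq, enorm_mul, enorm_norm, mul_pow]

/-! ### Cutoff functions and smooth truncations -/

/-- Outside the open unit interval the function attains its global minimum or maximum. -/
lemma deriv_smoothTransition_eq_zero {x : ℝ} (hx : x ∉ Ioo (0 : ℝ) 1) :
    deriv Real.smoothTransition x = 0 := by
  rcases le_or_gt x 0 with h | h
  · refine IsLocalMin.deriv_eq_zero (Eventually.of_forall fun y => ?_)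
    rw [Real.smoothTransition.zero_of_nonpos h]
    exact Real.smoothTransition.nonneg y
  · have h1 : 1 ≤ x := by
      by_contra hc
      exact hx ⟨h, not_le.1 hc⟩
    refine IsLocalMax.deriv_eq_zero (Eventually.of_forall fun y => ?_)
    rw [Real.smoothTransition.one_of_one_le h1]
    exact Real.smoothTransition.le_one y

lemma exists_deriv_smoothTransition_le : ∃ C : ℝ, 0 < C ∧ ∀ x,
    |deriv Real.smoothTransition x| ≤ C := by
  have hc : Continuous (deriv Real.smoothTransition) :=
    (Real.smoothTransition.contDiff (n := 1)).continuous_deriv le_rfl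
  obtain ⟨C, hC⟩ := (isCompact_Icc (a := (0 : ℝ)) (b := 1)).exists_bound_of_continuousOn
    hc.continuousOn
  refine ⟨max C 1, by positivity, fun x => ?_⟩
  by_cases hx : x ∈ Ioo (0 : ℝ) 1
  · exact (hC x (Ioo_subset_Icc_self hx)).trans (le_max_left _ _)
  · rw [deriv_smoothTransition_eq_zero hx, abs_zero]; positivity

/-- The transition is composed with a quadratic in `‖x - x₀‖`, which is smooth at the centre. The
gradient bound is of order `(t + s)/(t² - s²) = 1/(t - s)`, with a constant independent of the
radii. -/
lemma exists_cutoff (n : ℕ) : ∃ C : ℝ, 0 < C ∧ ∀ (x₀ : E n) (s t r : ℝ), 0 < s → s < t → t < r →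
    ∃ η : E n → ℝ, IsTest (ball x₀ r) η ∧ (∀ x, 0 ≤ η x ∧ η x ≤ 1) ∧
      (∀ x ∈ ball x₀ s, η x = 1) ∧ (∀ x ∉ ball x₀ t, η x = 0 ∧ gradient η x = 0) ∧
      ∀ x, ‖gradient η x‖ ≤ C / (t - s) := by
  obtain ⟨C, hC0, hC⟩ := exists_deriv_smoothTransition_le
  refine ⟨2 * C, by positivity, fun x₀ s t r hs hst htr => ?_⟩
  have hd : 0 < t ^ 2 - s ^ 2 := by nlinarith
  let q : E n → ℝ := fun x => (t ^ 2 - ‖x - x₀‖ ^ 2) / (t ^ 2 - s ^ 2)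
  let η : E n → ℝ := fun x => Real.smoothTransition (q x)
  have hq : ContDiff ℝ ∞ q :=
    (contDiff_const.sub ((contDiff_id.sub contDiff_const).norm_sq ℝ)).div_const _
  have hη : ContDiff ℝ ∞ η := Real.smoothTransition.contDiff.comp hq
  have hout : ∀ x ∉ ball x₀ t, q x ≤ 0 := by
    intro x hx
    rw [mem_ball, dist_eq_norm, not_lt] at hx
    refine div_nonpos_of_nonpos_of_nonneg ?_ hd.le
    have := pow_le_pow_left₀ (hs.le.trans hst.le) hx 2
    linarith
  have hgrad : ∀ x, ‖gradient η x‖ = |deriv Real.smoothTransition (q x)| *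
      (2 * ‖x - x₀‖ / (t ^ 2 - s ^ 2)) := by
    intro x
    have h1 : HasFDerivAt (fun x : E n => ‖x - x₀‖ ^ 2) ((2 : ℝ) • innerSL ℝ (x - x₀)) x := by
      have h0 : HasFDerivAt (fun x : E n => x - x₀) (ContinuousLinearMap.id ℝ (E n)) x :=
        (hasFDerivAt_id x).sub_const x₀
      have := h0.norm_sq
      rwa [ContinuousLinearMap.comp_id, two_nsmul, ← two_smul ℝ] at this
    have h2 : HasFDerivAt q ((t ^ 2 - s ^ 2)⁻¹ • (-((2 : ℝ) • innerSL ℝ (x - x₀)))) x := by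
      have := (h1.const_sub (t ^ 2)).const_mul (t ^ 2 - s ^ 2)⁻¹
      refine this.congr_of_eventuallyEq (Eventually.of_forall fun y => ?_)
      simp only [q]; rw [div_eq_inv_mul]
    have h3 := ((Real.smoothTransition.contDiff (n := 1)).differentiable one_ne_zero
      (q x)).hasDerivAt.comp_hasFDerivAt x h2
    have h4 : fderiv ℝ η x = _ := h3.fderiv
    rw [norm_gradient, h4, norm_smul, norm_smul, norm_neg, norm_smul,
      innerSL_apply_norm, norm_inv, Real.norm_of_nonneg hd.le, Real.norm_eq_abs]
    simp only [Real.norm_ofNat]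
    ring
  have hz : ∀ x ∉ ball x₀ t, η x = 0 ∧ gradient η x = 0 := by
    intro x hx
    refine ⟨Real.smoothTransition.zero_of_nonpos (hout x hx), ?_⟩
    rw [← norm_eq_zero, hgrad, deriv_smoothTransition_eq_zero
      (fun h => (hout x hx).not_gt h.1), abs_zero, zero_mul]
  have hts : tsupport η ⊆ closedBall x₀ t := by
    refine closure_minimal (fun x hx => ?_) isClosed_closedBall
    by_contra hc
    exact hx (hz x fun h => hc (ball_subset_closedBall h)).1
  refine ⟨η, ⟨hη, ?_, hts.trans (closedBall_subset_ball htr)⟩, fun x =>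
    ⟨Real.smoothTransition.nonneg _, Real.smoothTransition.le_one _⟩, fun x hx => ?_, hz,
    fun x => ?_⟩
  · exact HasCompactSupport.of_support_subset_isCompact (isCompact_closedBall x₀ t)
      ((subset_tsupport η).trans hts)
  · refine Real.smoothTransition.one_of_one_le ?_
    rw [mem_ball, dist_eq_norm] at hx
    rw [one_le_div hd]
    have := pow_le_pow_left₀ (norm_nonneg _) hx.le 2
    linarith
  · by_cases hx : x ∈ ball x₀ t
    · rw [hgrad]
      rw [mem_ball, dist_eq_norm] at hx
      calc |deriv Real.smoothTransition (q x)| * (2 * ‖x - x₀‖ / (t ^ 2 - s ^ 2))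
          ≤ C * (2 * (t + s) / (t ^ 2 - s ^ 2)) := by
            gcongr
            · exact hC _
            · linarith
        _ = 2 * C / (t - s) := by
            have h1 : t - s ≠ 0 := by linarith
            have h2 : t + s ≠ 0 := by linarith
            rw [show t ^ 2 - s ^ 2 = (t - s) * (t + s) by ring]
            field_simp
    · rw [(hz x hx).2, norm_zero]
      have : 0 < t - s := by linarith
      positivity

/-- A smooth convex function between `(t - l)₊` and `(t - k)₊`. -/
lemma exists_smooth_truncation {k l : ℝ} (hk : 0 ≤ k) (hkl : k < l) : ∃ (h : ℝ → ℝ) (B : ℝ),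
    ContDiff ℝ ∞ h ∧ h 0 = 0 ∧ (∀ t, 0 ≤ h t) ∧ (∀ t, t - l ≤ h t) ∧ (∀ t, h t ≤ max (t - k) 0) ∧
    (∀ t, |deriv h t| ≤ 1) ∧ ContDiff ℝ ∞ (fun t => h t * deriv h t) ∧
    (∀ t, |deriv (fun t => h t * deriv h t) t| ≤ B) ∧
    (∀ t, deriv h t ^ 2 ≤ deriv (fun t => h t * deriv h t) t) ∧
    ∀ t, 0 ≤ t * (h t * deriv h t) := by
  obtain ⟨C, hC0, hC⟩ := exists_deriv_smoothTransition_le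
  have hlk : 0 < l - k := sub_pos.2 hkl
  -- The truncation is the primitive of a nondecreasing step from `0` to `1` on `[k, l]`. It is thus
  -- convex, and `(h h')' = h'² + h h'' ≥ h'²`, as Caccioppoli's inequality requires of `F = h h'`.
  let σ : ℝ → ℝ := fun t => Real.smoothTransition ((t - k) / (l - k))
  let h : ℝ → ℝ := fun t => ∫ τ in (0 : ℝ)..t, σ τ
  have hσ : ContDiff ℝ ∞ σ :=
    Real.smoothTransition.contDiff.comp ((contDiff_id.sub contDiff_const).div_const _)
  have hσc := hσ.continuous
  have hσ0 : ∀ t, 0 ≤ σ t := fun t => Real.smoothTransition.nonneg _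
  have hσ1 : ∀ t, σ t ≤ 1 := fun t => Real.smoothTransition.le_one _
  have hσk : ∀ t ≤ k, σ t = 0 := fun t ht => Real.smoothTransition.zero_of_nonpos
    (div_nonpos_of_nonpos_of_nonneg (by linarith) hlk.le)
  have hσl : ∀ t, l ≤ t → σ t = 1 := fun t ht => Real.smoothTransition.one_of_one_le
    ((one_le_div hlk).2 (by linarith))
  have hder : ∀ t, HasDerivAt h (σ t) t := fun t =>
    intervalIntegral.integral_hasDerivAt_right (hσc.intervalIntegrable _ _)
      (hσc.stronglyMeasurableAtFilter _ _) hσc.continuousAt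
  have hdh : deriv h = σ := funext fun t => (hder t).deriv
  have hh : ContDiff ℝ ∞ h := by
    rw [contDiff_infty_iff_deriv, hdh]
    exact ⟨fun t => (hder t).differentiableAt, hσ⟩
  have hmono : Monotone h := monotone_of_deriv_nonneg (hh.differentiable (by simp))
    (fun t => by rw [hdh]; exact hσ0 t)
  have hhk : ∀ t ≤ k, h t = 0 := by
    intro t ht
    refine intervalIntegral.integral_zero_ae (ae_of_all _ fun τ hτ => hσk τ ?_)
    rcases mem_uIoc.1 hτ with h | h
    · exact h.2.trans ht
    · exact h.2.trans hk
  have hh0 : ∀ t, 0 ≤ h t := by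
    intro t
    rcases le_total t k with ht | ht
    · exact (hhk t ht).ge
    · exact (hhk k le_rfl).ge.trans (hmono ht)
  have hd1 : ∀ t, |deriv h t| ≤ 1 := fun t => by
    rw [hdh, abs_of_nonneg (hσ0 t)]; exact hσ1 t
  have hub : ∀ t, h t ≤ max (t - k) 0 := by
    intro t
    rcases le_total t k with ht | ht
    · rw [hhk t ht]; exact le_max_right _ _
    · have := abs_sub_le_of_deriv_le hh hd1 t k
      rw [hhk k le_rfl, sub_zero, one_mul, abs_of_nonneg (hh0 t),
        abs_of_nonneg (sub_nonneg.2 ht)] at this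
      exact this.trans (le_max_left _ _)
  have hlb : ∀ t, t - l ≤ h t := by
    intro t
    rcases le_total t l with ht | ht
    · exact (sub_nonpos.2 ht).trans (hh0 t)
    · have h1 : h t - h l = ∫ τ in l..t, σ τ :=
        intervalIntegral.integral_interval_sub_left (hσc.intervalIntegrable _ _)
          (hσc.intervalIntegrable _ _)
      have h2 : ∫ τ in l..t, σ τ = ∫ _ in l..t, (1 : ℝ) := by
        refine intervalIntegral.integral_congr fun τ hτ => hσl τ ?_
        rw [uIcc_of_le ht] at hτ
        exact hτ.1
      rw [h2, intervalIntegral.integral_const, smul_eq_mul, mul_one] at h1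
      linarith [hh0 l]
  have hσd : ∀ t, HasDerivAt σ (deriv Real.smoothTransition ((t - k) / (l - k)) / (l - k)) t := by
    intro t
    have h1 : HasDerivAt (fun t => (t - k) / (l - k)) (1 / (l - k)) t :=
      ((hasDerivAt_id t).sub_const k).div_const _
    have := ((Real.smoothTransition.contDiff (n := 1)).differentiable one_ne_zero
      ((t - k) / (l - k))).hasDerivAt.comp t h1
    rw [mul_one_div] at this
    exact this
  have hFd : ∀ t, deriv (fun t => h t * deriv h t) t = σ t * σ t +
      h t * (deriv Real.smoothTransition ((t - k) / (l - k)) / (l - k)) := by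
    intro t
    rw [hdh]
    exact ((hder t).mul (hσd t)).deriv
  have hσ'0 : ∀ t, 0 ≤ deriv Real.smoothTransition t := fun t =>
    Real.smoothTransition.monotone.deriv_nonneg
  -- Although `h` is unbounded, `h h''` is not: `h''` is of size `1/(l - k)` and lives where `h ≤ l
  -- - k`.
  have hterm : ∀ t, 0 ≤ h t * (deriv Real.smoothTransition ((t - k) / (l - k)) / (l - k)) ∧
      h t * (deriv Real.smoothTransition ((t - k) / (l - k)) / (l - k)) ≤ C := by
    intro t
    refine ⟨mul_nonneg (hh0 t) (div_nonneg (hσ'0 _) hlk.le), ?_⟩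
    by_cases ht : (t - k) / (l - k) ∈ Ioo (0 : ℝ) 1
    · have h1 : t - k ≤ l - k := by
        have := (div_lt_one hlk).1 ht.2; linarith
      have h2 : h t ≤ l - k := (hub t).trans (max_le h1 hlk.le)
      calc h t * (deriv Real.smoothTransition ((t - k) / (l - k)) / (l - k))
          ≤ (l - k) * (C / (l - k)) := by
            gcongr
            · exact div_nonneg (hσ'0 _) hlk.le
            · exact (le_abs_self _).trans (hC _)
        _ = C := by field_simp
    · rw [deriv_smoothTransition_eq_zero ht]; simp [hC0.le]
  refine ⟨h, 1 + C, hh, hhk 0 hk, hh0, hlb, hub, hd1, ?_, ?_, ?_, ?_⟩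
  · rw [hdh]; exact hh.mul hσ
  · intro t
    rw [hFd, abs_of_nonneg (add_nonneg (mul_self_nonneg _) (hterm t).1)]
    have : σ t * σ t ≤ 1 := mul_le_one₀ (hσ1 t) (hσ0 t) (hσ1 t)
    linarith [(hterm t).2]
  · intro t
    rw [hFd, hdh, sq]
    linarith [(hterm t).1]
  · intro t
    rcases le_total t k with ht | ht
    · simp [hhk t ht]
    · rw [hdh]; exact mul_nonneg (hk.trans ht) (mul_nonneg (hh0 t) (hσ0 t))

/-! ### Local boundedness -/

lemma lintegral_mul_le_eLpNorm {α : Type*} [MeasurableSpace α] {μ : Measure α} {G H : Type*}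
    [NormedAddCommGroup G] [NormedAddCommGroup H] {f : α → G} {g : α → H}
    (hf : AEStronglyMeasurable f μ) (hg : AEStronglyMeasurable g μ) :
    ∫⁻ x, ‖f x‖ₑ * ‖g x‖ₑ ∂μ ≤ eLpNorm f 2 μ * eLpNorm g 2 μ := by
  rw [← ENNReal.pow_le_pow_left_iff two_ne_zero, mul_pow, eLpNorm_two_sq, eLpNorm_two_sq]
  exact sq_lintegral_mul_le hf.enorm hg.enorm

lemma setLIntegral_eq_of_subset_of_eq_zero {α : Type*} [MeasurableSpace α] {μ : Measure α}
    {S T : Set α} (hS : MeasurableSet S) (hT : MeasurableSet T) (hST : S ⊆ T) {f : α → ℝ≥0∞}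
    (hf : ∀ x ∈ T, x ∉ S → f x = 0) : ∫⁻ x in T, f x ∂μ = ∫⁻ x in S, f x ∂μ := by
  rw [← lintegral_indicator hT, ← lintegral_indicator hS]
  congr 1; ext x
  by_cases hx : x ∈ S
  · rw [indicator_of_mem hx, indicator_of_mem (hST hx)]
  · rw [indicator_of_notMem hx]
    by_cases hx' : x ∈ T
    · rw [indicator_of_mem hx', hf x hx' hx]
    · rw [indicator_of_notMem hx']

lemma setLIntegral_graphDomain_eq {Ω : Set (E n)} (hΩ : MeasurableSet Ω) {x₀ : E n} {r : ℝ}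
    {f : E n → ℝ≥0∞} (hf : ∀ x ∉ ball x₀ r, f x = 0) :
    ∫⁻ x in Ω, f x = ∫⁻ x in bdryBall Ω x₀ r, f x :=
  setLIntegral_eq_of_subset_of_eq_zero (measurableSet_ball.inter hΩ) hΩ inter_subset_right
    fun x hx hx' => hf x fun h => hx' ⟨h, hx⟩

lemma IsTest.eq_zero {B : Set (E n)} {φ : E n → ℝ} (hφ : IsTest B φ) {x : E n} (hx : x ∉ B) :
    φ x = 0 ∧ gradient φ x = 0 :=
  have : x ∉ tsupport φ := fun h => hx (hφ.2.2 h)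
  ⟨image_eq_zero_of_notMem_tsupport this, gradient_eq_zero_of_notMem_tsupport this⟩

/-- A gain of integrability for functions vanishing near the sphere, but not on the graph. -/
theorem sobolev_test (hn : 1 ≤ n) (M : ℝ≥0) :
    ∃ C : ℝ≥0, ∀ Ψ : EuclideanSpace ℝ (Fin n) → ℝ, LipschitzWith M Ψ →
      ∀ (x₀ : E n) (r : ℝ) (φ : E n → ℝ), IsTest (ball x₀ r) φ →
        ∫⁻ x in bdryBall (graphDomain Ψ) x₀ r, (‖φ x‖ₑ ^ 2) ^ ((n + 1 : ℝ) / n) ≤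
          C * (eLpNorm φ 2 (volume.restrict (bdryBall (graphDomain Ψ) x₀ r)) *
            eLpNorm (gradient φ) 2 (volume.restrict (bdryBall (graphDomain Ψ) x₀ r)))
              ^ ((n + 1 : ℝ) / n) := by
  obtain ⟨C, hC⟩ := sobolev_one_graphDomain hn M
  set p : ℝ := (n + 1 : ℝ) / n with hp
  have hp0 : 0 < p := by
    have : (0 : ℝ) < n := by exact_mod_cast hn
    positivity
  refine ⟨C * 2 ^ p, fun Ψ hΨ x₀ r φ hφ => ?_⟩
  have hΩ := (isOpen_graphDomain hΨ).measurableSet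
  -- The `L¹` Sobolev inequality applied to `φ²`, followed by Cauchy-Schwarz on `∇(φ²) = 2 φ ∇φ`,
  -- gives the product of `L²` norms; this form also covers dimension two.
  have h1 := hC Ψ hΨ (fun x => φ x * φ x) (hφ.contDiff_one.mul hφ.contDiff_one)
    hφ.2.1.mul_right
  have hfd : ∀ x, ‖fderiv ℝ (fun x => φ x * φ x) x‖ₑ = 2 * (‖φ x‖ₑ * ‖gradient φ x‖ₑ) := by
    intro x
    have h := (hφ.1.differentiable (by simp) x).hasFDerivAt
    have h2 : fderiv ℝ (fun x => φ x * φ x) x = φ x • fderiv ℝ φ x + φ x • fderiv ℝ φ x :=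
      (h.mul h).fderiv
    rw [h2, ← two_smul ℝ, enorm_smul, enorm_smul, ← enorm_norm (gradient φ x), norm_gradient,
      enorm_norm, Real.enorm_of_nonneg zero_le_two]
    simp
  have hl : ∀ x, ‖φ x * φ x‖ₑ ^ p = (‖φ x‖ₑ ^ 2) ^ p := fun x => by rw [enorm_mul, sq]
  simp_rw [hl, hfd] at h1
  rw [setLIntegral_graphDomain_eq hΩ (x₀ := x₀) (r := r)
      (fun x hx => by simp [(hφ.eq_zero hx).1, hp0]),
    setLIntegral_graphDomain_eq hΩ (x₀ := x₀) (r := r)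
      (fun x hx => by simp [(hφ.eq_zero hx).1]), lintegral_const_mul' _ _ (by simp)] at h1
  refine h1.trans ?_
  rw [ENNReal.coe_mul, mul_assoc, ENNReal.coe_rpow_of_nonneg _ hp0.le,
    ← ENNReal.mul_rpow_of_nonneg _ _ hp0.le]
  gcongr
  · simp
  · exact lintegral_mul_le_eLpNorm hφ.1.continuous.aestronglyMeasurable
      (continuous_gradient hφ.contDiff_one).aestronglyMeasurable

lemma eLpNorm_le_add_sub {α : Type*} [MeasurableSpace α] {μ : Measure α} {G : Type*}
    [NormedAddCommGroup G] {f g : α → G} (hf : AEStronglyMeasurable f μ)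
    (hg : AEStronglyMeasurable g μ) :
    eLpNorm f 2 μ ≤ eLpNorm g 2 μ + eLpNorm (fun x => f x - g x) 2 μ := by
  have := eLpNorm_add_le hg (hf.sub hg) (p := 2) (by norm_num)
  rwa [add_sub_cancel] at this

/-- The left side is lower semicontinuous under almost everywhere convergence (Fatou), and the right
side is continuous in the two `L²` norms. -/
theorem sobolev_testLimit (hn : 1 ≤ n) (M : ℝ≥0) :
    ∃ C : ℝ≥0, ∀ Ψ : EuclideanSpace ℝ (Fin n) → ℝ, LipschitzWith M Ψ →
      ∀ (x₀ : E n) (r : ℝ) (w : E n → ℝ) (g : E n → E n),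
        IsTestLimit (bdryBall (graphDomain Ψ) x₀ r) (ball x₀ r) w g →
        ∫⁻ x in bdryBall (graphDomain Ψ) x₀ r, (‖w x‖ₑ ^ 2) ^ ((n + 1 : ℝ) / n) ≤
          C * (eLpNorm w 2 (volume.restrict (bdryBall (graphDomain Ψ) x₀ r)) *
            eLpNorm g 2 (volume.restrict (bdryBall (graphDomain Ψ) x₀ r)))
              ^ ((n + 1 : ℝ) / n) := by
  obtain ⟨C, hC⟩ := sobolev_test hn M
  refine ⟨C, fun Ψ hΨ x₀ r w g hw => ?_⟩
  set μ := volume.restrict (bdryBall (graphDomain Ψ) x₀ r)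
  set p : ℝ := (n + 1 : ℝ) / n with hp
  have hp0 : 0 ≤ p := by positivity
  obtain ⟨φ, hφ, hae, h1, h2⟩ := hw.exists_seq
  set a : ℕ → ℝ≥0∞ := fun j => eLpNorm (fun x => φ j x - w x) 2 μ
  set b : ℕ → ℝ≥0∞ := fun j => eLpNorm (fun x => gradient (φ j) x - g x) 2 μ
  have hle : ∀ j, ∫⁻ x, (‖φ j x‖ₑ ^ 2) ^ p ∂μ ≤
      C * ((eLpNorm w 2 μ + a j) * (eLpNorm g 2 μ + b j)) ^ p := by
    intro j
    refine (hC Ψ hΨ x₀ r _ (hφ j)).trans ?_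
    gcongr
    · exact eLpNorm_le_add_sub (hφ j).1.continuous.aestronglyMeasurable hw.memLp.1
    · exact eLpNorm_le_add_sub (continuous_gradient (hφ j).contDiff_one).aestronglyMeasurable
        hw.grad_memLp.1
  have hlim : Tendsto (fun j => C * ((eLpNorm w 2 μ + a j) * (eLpNorm g 2 μ + b j)) ^ p) atTop
      (𝓝 (C * ((eLpNorm w 2 μ) * (eLpNorm g 2 μ)) ^ p)) := by
    refine ENNReal.Tendsto.const_mul ?_ (Or.inr ENNReal.coe_ne_top)
    refine ((ENNReal.continuous_rpow_const (y := p)).tendsto _).comp ?_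
    have ha : Tendsto (fun j => eLpNorm w 2 μ + a j) atTop (𝓝 (eLpNorm w 2 μ)) := by
      simpa using h1.const_add (eLpNorm w 2 μ)
    have hb : Tendsto (fun j => eLpNorm g 2 μ + b j) atTop (𝓝 (eLpNorm g 2 μ)) := by
      simpa using h2.const_add (eLpNorm g 2 μ)
    exact ENNReal.Tendsto.mul ha (Or.inr hw.grad_memLp.2.ne) hb (Or.inr hw.memLp.2.ne)
  calc ∫⁻ x, (‖w x‖ₑ ^ 2) ^ p ∂μ = ∫⁻ x, liminf (fun j => (‖φ j x‖ₑ ^ 2) ^ p) atTop ∂μ := by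
        refine lintegral_congr_ae (hae.mono fun x hx => ?_)
        have h3 : Tendsto (fun j => (‖φ j x‖ₑ ^ 2) ^ p) atTop (𝓝 ((‖w x‖ₑ ^ 2) ^ p)) :=
          ((ENNReal.continuous_rpow_const (y := p)).tendsto _).comp
            (((ENNReal.continuous_pow 2).tendsto _).comp ((continuous_enorm.tendsto _).comp hx))
        exact h3.liminf_eq.symm
    _ ≤ liminf (fun j => ∫⁻ x, (‖φ j x‖ₑ ^ 2) ^ p ∂μ) atTop :=
        lintegral_liminf_le fun j =>
          ((hφ j).1.continuous.enorm.measurable.pow_const 2).pow_const p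
    _ ≤ liminf (fun j => C * ((eLpNorm w 2 μ + a j) * (eLpNorm g 2 μ + b j)) ^ p) atTop :=
        liminf_le_liminf (Eventually.of_forall hle)
    _ = _ := hlim.liminf_eq

/-- Fast geometric convergence. -/
lemma fast_convergence {y : ℕ → ℝ} {d : ℕ} (hd : d ≠ 0) {Λ b : ℝ} (hb : 1 ≤ b) (hy : ∀ j, 0 ≤ y j)
    (hΛ : 0 ≤ Λ) (hstep : ∀ j, y (j + 1) ^ d ≤ Λ * b ^ j * y j ^ (d + 1))
    (h0 : Λ * y 0 * b ^ d ≤ 1) : ∀ j, y j ≤ y 0 * b⁻¹ ^ j := by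
  have hb0 : 0 < b := by linarith
  intro j
  induction j with
  | zero => simp
  | succ j ih =>
    -- The growth `b ^ j` cancels against the surplus power of `y j`; the smallness condition says
    -- `Λ y 0 ≤ b⁻¹ ^ d`, which is the one additional factor needed.
    have h1 : y (j + 1) ^ d ≤ (y 0 * b⁻¹ ^ (j + 1)) ^ d := by
      calc y (j + 1) ^ d ≤ Λ * b ^ j * y j ^ (d + 1) := hstep j
        _ ≤ Λ * b ^ j * (y 0 * b⁻¹ ^ j) ^ (d + 1) := by
            gcongr
            exact hy j
        _ = (y 0 * b⁻¹ ^ j) ^ d * (Λ * y 0) * (b * b⁻¹) ^ j := by ring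
        _ = (y 0 * b⁻¹ ^ j) ^ d * (Λ * y 0) := by rw [mul_inv_cancel₀ hb0.ne']; simp
        _ ≤ (y 0 * b⁻¹ ^ j) ^ d * b⁻¹ ^ d := by
            refine mul_le_mul_of_nonneg_left ?_ (pow_nonneg (mul_nonneg (hy 0) (by positivity)) _)
            rw [inv_pow, ← one_div, le_div_iff₀ (by positivity)]
            exact h0
        _ = _ := by rw [← mul_pow]; ring
    exact le_of_pow_le_pow_left₀ hd (mul_nonneg (hy 0) (by positivity)) h1

/-- `u` with weak gradient `G` solves the Neumann problem in `D(x₀, r)`, for an elliptic matrix and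
a positive bounded potential. -/
structure NeumannSolution (M : ℝ≥0) (μ : ℝ) (Ψ : EuclideanSpace ℝ (Fin n) → ℝ)
    (A : E n → Matrix (Fin (n + 1)) (Fin (n + 1)) ℝ) (V : E n → ℝ) (x₀ : E n) (r : ℝ)
    (u : E n → ℝ) (G : E n → E n) : Prop where
  lip : LipschitzWith M Ψ
  elliptic : IsEllipticSymm (graphDomain Ψ) μ A
  pos : ∀ᵐ x, 0 < V x
  bounded : MemLp V ⊤ (volume.restrict (ball x₀ r))
  sobolev : IsSobolev (bdryBall (graphDomain Ψ) x₀ r) u G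
  eqn : ∀ φ, IsTest (ball x₀ r) φ → ∫ x in bdryBall (graphDomain Ψ) x₀ r,
    ((∑ i, ∑ j, A x i j * G x j * pderiv φ i x) + V x * u x * φ x) = 0

/-- Reduces the lower bound for solutions to the upper one. -/
lemma NeumannSolution.neg {M : ℝ≥0} {μ : ℝ} {Ψ : EuclideanSpace ℝ (Fin n) → ℝ}
    {A : E n → Matrix (Fin (n + 1)) (Fin (n + 1)) ℝ} {V : E n → ℝ} {x₀ : E n} {r : ℝ}
    {u : E n → ℝ} {G : E n → E n} (h : NeumannSolution M μ Ψ A V x₀ r u G) :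
    NeumannSolution M μ Ψ A V x₀ r (fun x => -u x) (fun x => -G x) where
  lip := h.lip
  elliptic := h.elliptic
  pos := h.pos
  bounded := h.bounded
  sobolev :=
    { memLp := h.sobolev.memLp.neg
      grad_memLp := h.sobolev.grad_memLp.neg
      weak_grad := fun φ hφ i => by
        have := h.sobolev.weak_grad φ hφ i
        simp only [PiLp.neg_apply, neg_mul, integral_neg, this] }
  eqn := fun φ hφ => by
    rw [← neg_eq_zero, ← integral_neg, ← h.eqn φ hφ]
    congr 1; ext x
    simp [Finset.sum_neg_distrib]
    ring

lemma measurableSet_bdryBall {M : ℝ≥0} {Ψ : EuclideanSpace ℝ (Fin n) → ℝ}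
    (hΨ : LipschitzWith M Ψ) (x₀ : E n) (r : ℝ) :
    MeasurableSet (bdryBall (graphDomain Ψ) x₀ r) := (isOpen_bdryBall hΨ x₀ r).measurableSet

lemma bdryBall_mono (Ω : Set (E n)) (x₀ : E n) {s r : ℝ} (h : s ≤ r) :
    bdryBall Ω x₀ s ⊆ bdryBall Ω x₀ r := inter_subset_inter_left _ (ball_subset_ball h)

lemma setLIntegral_bdryBall_eq {M : ℝ≥0} {Ψ : EuclideanSpace ℝ (Fin n) → ℝ}
    (hΨ : LipschitzWith M Ψ) {x₀ : E n} {s r : ℝ} (h : s ≤ r) {f : E n → ℝ≥0∞}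
    (hf : ∀ x ∉ ball x₀ s, f x = 0) :
    ∫⁻ x in bdryBall (graphDomain Ψ) x₀ r, f x = ∫⁻ x in bdryBall (graphDomain Ψ) x₀ s, f x :=
  setLIntegral_eq_of_subset_of_eq_zero (measurableSet_bdryBall hΨ _ _)
    (measurableSet_bdryBall hΨ _ _) (bdryBall_mono _ _ h) fun x hx hx' =>
      hf x fun hb => hx' ⟨hb, hx.2⟩

/-- One step of De Giorgi's iteration. -/
theorem deGiorgi_step (hn : 1 ≤ n) (M : ℝ≥0) {μ : ℝ} (hμ : 0 < μ) : ∃ C : ℝ, 0 < C ∧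
    ∀ {Ψ : EuclideanSpace ℝ (Fin n) → ℝ} {A : E n → Matrix (Fin (n + 1)) (Fin (n + 1)) ℝ}
      {V : E n → ℝ} {x₀ : E n} {r : ℝ} {u : E n → ℝ} {G : E n → E n},
      NeumannSolution M μ Ψ A V x₀ r u G → ∀ {s' s k l : ℝ}, 0 < s' → s' < s → s < r → 0 ≤ k →
      k < l →
      (∫⁻ x in bdryBall (graphDomain Ψ) x₀ s', ‖max (u x - l) 0‖ₑ ^ 2) ^ (n + 1) ≤
        ENNReal.ofReal (C / ((s - s') ^ (n + 1) * (l - k) ^ 2)) *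
          (∫⁻ x in bdryBall (graphDomain Ψ) x₀ s, ‖max (u x - k) 0‖ₑ ^ 2) ^ (n + 2) := by
  obtain ⟨CS, hCS⟩ := sobolev_testLimit hn M
  obtain ⟨C₁, hC₁0, hC₁⟩ := caccioppoli n hμ
  obtain ⟨C₀, hC₀0, hC₀⟩ := exists_cutoff n
  set c : ℝ := √C₁ * C₀ with hc
  have hc0 : 0 < c := mul_pos (Real.sqrt_pos.2 hC₁0) hC₀0
  have hn0 : (0 : ℝ) < n := by exact_mod_cast hn
  set p : ℝ := (n + 1 : ℝ) / n with hp
  have hp0 : 0 < p := by positivity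
  refine ⟨(CS + 1) ^ n * c ^ (n + 1), by positivity, ?_⟩
  intro Ψ A V x₀ r u G hsol s' s k l hs' hss hsr hk hkl
  have hlk : 0 < l - k := sub_pos.2 hkl
  have hds : 0 < s - s' := sub_pos.2 hss
  obtain ⟨h, B, hh, hh0, hpos, hlb, hub, hd1, hF, hFB, hhF, htF⟩ := exists_smooth_truncation hk hkl
  obtain ⟨η, hη, hη01, hη1, hη0, hηg⟩ := hC₀ x₀ s' s r hs' hss hsr
  set D := bdryBall (graphDomain Ψ) x₀ r with hD
  set Ds := bdryBall (graphDomain Ψ) x₀ s with hDs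
  set Y := ∫⁻ x in Ds, ‖max (u x - k) 0‖ₑ ^ 2 with hY
  have hhY : ∫⁻ x in Ds, ‖h (u x)‖ₑ ^ 2 ≤ Y := by
    refine lintegral_mono fun x => ?_
    gcongr
    refine enorm_le_iff_norm_le.2 ?_
    rw [Real.norm_of_nonneg (hpos _), Real.norm_of_nonneg (le_max_right _ _)]
    exact hub _
  have hlim := hsol.sobolev.isTestLimit hsol.lip hη hh hh0 hd1
  set w : E n → ℝ := fun x => η x * h (u x) with hw
  set g : E n → E n := fun x => (η x * deriv h (u x)) • G x + h (u x) • gradient η x with hg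
  have hw2 : eLpNorm w 2 (volume.restrict D) ^ 2 ≤ Y := by
    rw [eLpNorm_two_sq, hD, setLIntegral_bdryBall_eq hsol.lip hsr.le
      (fun x hx => by simp [hw, (hη0 x hx).1])]
    refine le_trans (lintegral_mono fun x => ?_) hhY
    dsimp only [hw]
    gcongr
    refine enorm_le_iff_norm_le.2 ?_
    rw [norm_mul, Real.norm_of_nonneg (hη01 x).1]
    exact mul_le_of_le_one_left (norm_nonneg _) (hη01 x).2
  have hg2 : eLpNorm g 2 (volume.restrict D) ^ 2 ≤ ENNReal.ofReal ((c / (s - s')) ^ 2) * Y := by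
    rw [eLpNorm_two_sq]
    calc ∫⁻ x in D, ‖g x‖ₑ ^ 2 ≤ _ := lintegral_mono fun x => le_self_add
      _ ≤ ENNReal.ofReal C₁ * ∫⁻ x in D, ‖h (u x)‖ₑ ^ 2 * ‖gradient η x‖ₑ ^ 2 :=
          hC₁ hsol.lip hsol.elliptic hsol.pos hsol.bounded hsol.sobolev hsol.eqn hη hF hh
            (by simp [hh0]) hh0 hFB hd1 hhF (fun t => (abs_mul _ _).le) htF
      _ ≤ ENNReal.ofReal C₁ * ∫⁻ x in Ds, ENNReal.ofReal ((C₀ / (s - s')) ^ 2) *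
            ‖h (u x)‖ₑ ^ 2 := by
          rw [hD, setLIntegral_bdryBall_eq hsol.lip hsr.le
            (fun x hx => by simp [(hη0 x hx).2])]
          refine mul_le_mul_right (lintegral_mono fun x => ?_) _
          dsimp only
          rw [mul_comm]
          gcongr
          rw [ENNReal.ofReal_pow (by positivity), ← ofReal_norm]
          gcongr
          exact hηg x
      _ ≤ ENNReal.ofReal C₁ * (ENNReal.ofReal ((C₀ / (s - s')) ^ 2) * Y) := by
          rw [lintegral_const_mul' _ _ ENNReal.ofReal_ne_top]
          gcongr
      _ = _ := by
          rw [← mul_assoc, ← ENNReal.ofReal_mul hC₁0.le]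
          congr 2
          rw [hc, div_pow, div_pow, mul_pow, Real.sq_sqrt hC₁0.le]
          ring
  have hwg : eLpNorm w 2 (volume.restrict D) * eLpNorm g 2 (volume.restrict D) ≤
      ENNReal.ofReal (c / (s - s')) * Y := by
    rw [← ENNReal.pow_le_pow_left_iff two_ne_zero, mul_pow, mul_pow,
      ← ENNReal.ofReal_pow (by positivity)]
    calc _ ≤ Y * (ENNReal.ofReal ((c / (s - s')) ^ 2) * Y) := mul_le_mul' hw2 hg2
      _ = _ := by ring
  have hum : AEStronglyMeasurable u (volume.restrict Ds) :=
    hsol.sobolev.memLp.1.mono_measure (Measure.restrict_mono (bdryBall_mono _ _ hsr.le) le_rfl)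
  -- A Chebyshev weight: it is at least `1` where `u > l`. Hölder with exponents `p` and `n + 1`
  -- then produces the extra factor `Y^(1/(n+1))` that makes the iteration superlinear.
  set b : E n → ℝ≥0∞ := fun x =>
    ENNReal.ofReal (((l - k) ^ 2)⁻¹) * ‖max (u x - k) 0‖ₑ ^ 2 with hb
  have hbm : AEMeasurable b (volume.restrict Ds) := by
    have h1 : AEStronglyMeasurable (fun x => max (u x - k) 0) (volume.restrict Ds) :=
      (by fun_prop : Continuous fun t : ℝ => max (t - k) 0).comp_aestronglyMeasurable hum
    exact (h1.enorm.pow_const 2).const_mul _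
  have hwm : AEMeasurable (fun x => ‖w x‖ₑ ^ 2) (volume.restrict Ds) :=
    ((hη.1.continuous.aestronglyMeasurable.mul
      (hh.continuous.comp_aestronglyMeasurable hum)).enorm).pow_const 2
  have hbY : ∫⁻ x in Ds, b x = ENNReal.ofReal (((l - k) ^ 2)⁻¹) * Y :=
    lintegral_const_mul' _ _ ENNReal.ofReal_ne_top
  have hconj : p.HolderConjugate (n + 1 : ℝ) := by
    rw [Real.holderConjugate_iff]
    refine ⟨?_, ?_⟩
    · rw [hp, one_lt_div hn0]; linarith
    · rw [hp]; field_simp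
  have hpt : ∀ x ∈ bdryBall (graphDomain Ψ) x₀ s',
      ‖max (u x - l) 0‖ₑ ^ 2 ≤ ‖w x‖ₑ ^ 2 * b x ^ (1 / (n + 1 : ℝ)) := by
    intro x hx
    rcases le_or_gt (u x) l with hul | hul
    · rw [max_eq_right (by linarith)]; simp
    · have h1 : 1 ≤ b x := by
        rw [hb]
        dsimp only
        rw [← ofReal_sq_eq_enorm_sq, ← ENNReal.ofReal_mul (by positivity), ENNReal.one_le_ofReal,
          max_eq_left (by linarith), inv_mul_eq_div, one_le_div (by positivity)]
        gcongr
      calc ‖max (u x - l) 0‖ₑ ^ 2 ≤ ‖w x‖ₑ ^ 2 * 1 := by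
            rw [mul_one]
            gcongr
            refine enorm_le_iff_norm_le.2 ?_
            simp only [hw, hη1 x hx.1, one_mul]
            rw [Real.norm_of_nonneg (hpos _), max_eq_left (by linarith),
              Real.norm_of_nonneg (by linarith)]
            exact hlb _
        _ ≤ _ := by
            gcongr
            exact ENNReal.one_le_rpow h1 (by positivity)
  have hfin : ∫⁻ x in bdryBall (graphDomain Ψ) x₀ s', ‖max (u x - l) 0‖ₑ ^ 2 ≤
      (CS * (ENNReal.ofReal (c / (s - s')) * Y) ^ p) ^ (1 / p) *
        (ENNReal.ofReal (((l - k) ^ 2)⁻¹) * Y) ^ (1 / (n + 1 : ℝ)) := by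
    calc _ ≤ ∫⁻ x in bdryBall (graphDomain Ψ) x₀ s', ‖w x‖ₑ ^ 2 * b x ^ (1 / (n + 1 : ℝ)) :=
          setLIntegral_mono' (measurableSet_bdryBall hsol.lip _ _) hpt
      _ ≤ ∫⁻ x in Ds, ‖w x‖ₑ ^ 2 * b x ^ (1 / (n + 1 : ℝ)) :=
          lintegral_mono_set (bdryBall_mono _ _ hss.le)
      _ ≤ (∫⁻ x in Ds, (‖w x‖ₑ ^ 2) ^ p) ^ (1 / p) *
            (∫⁻ x in Ds, (b x ^ (1 / (n + 1 : ℝ))) ^ (n + 1 : ℝ)) ^ (1 / (n + 1 : ℝ)) :=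
          ENNReal.lintegral_mul_le_Lp_mul_Lq _ hconj hwm (hbm.pow_const _)
      _ ≤ _ := by
          gcongr ?_ ^ (1 / p) * ?_ ^ (1 / (n + 1 : ℝ))
          · calc _ ≤ ∫⁻ x in D, (‖w x‖ₑ ^ 2) ^ p := lintegral_mono_set (bdryBall_mono _ _ hsr.le)
              _ ≤ _ := hCS Ψ hsol.lip x₀ r w g hlim
              _ ≤ _ := by gcongr
          · rw [← hbY]
            refine le_of_eq (lintegral_congr fun x => ?_)
            rw [← ENNReal.rpow_mul, one_div, inv_mul_cancel₀ (by positivity), ENNReal.rpow_one]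
  have hnp : 1 / p * (n + 1 : ℝ) = n := by rw [hp]; field_simp
  calc _ ≤ _ := pow_le_pow_left' hfin (n + 1)
    _ = (CS : ℝ≥0∞) ^ n * (ENNReal.ofReal (c / (s - s')) * Y) ^ (n + 1) *
          (ENNReal.ofReal (((l - k) ^ 2)⁻¹) * Y) := by
        rw [mul_pow]
        congr 1
        · rw [← ENNReal.rpow_natCast, ← ENNReal.rpow_mul]
          push_cast
          rw [hnp, ENNReal.mul_rpow_of_nonneg _ _ hn0.le, ← ENNReal.rpow_mul,
            show p * n = ((n + 1 : ℕ) : ℝ) by rw [hp]; push_cast; field_simp,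
            ENNReal.rpow_natCast, ENNReal.rpow_natCast]
        · rw [← ENNReal.rpow_natCast, ← ENNReal.rpow_mul]
          push_cast
          rw [one_div, inv_mul_cancel₀ (by positivity), ENNReal.rpow_one]
    _ ≤ ENNReal.ofReal ((CS + 1) ^ n) * (ENNReal.ofReal (c / (s - s')) * Y) ^ (n + 1) *
          (ENNReal.ofReal (((l - k) ^ 2)⁻¹) * Y) := by
        gcongr
        rw [ENNReal.ofReal_pow (by positivity)]
        gcongr
        rw [ENNReal.ofReal_add (by positivity) zero_le_one, ENNReal.ofReal_coe_nnreal]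
        exact le_self_add
    _ = ENNReal.ofReal ((CS + 1) ^ n * (c / (s - s')) ^ (n + 1) * ((l - k) ^ 2)⁻¹) *
          Y ^ (n + 2) := by
        rw [ENNReal.ofReal_mul (by positivity), ENNReal.ofReal_mul (by positivity),
          ENNReal.ofReal_pow (p := c / (s - s')) (by positivity)]
        ring
    _ = _ := by
        congr 2
        rw [div_pow]
        field_simp

/-- Local boundedness from above of solutions, by De Giorgi's iteration. -/
theorem local_upper_bound (hn : 1 ≤ n) (M : ℝ≥0) {μ : ℝ} (hμ : 0 < μ) : ∃ C : ℝ, 0 < C ∧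
    ∀ {Ψ : EuclideanSpace ℝ (Fin n) → ℝ} {A : E n → Matrix (Fin (n + 1)) (Fin (n + 1)) ℝ}
      {V : E n → ℝ} {x₀ : E n} {r : ℝ} {u : E n → ℝ} {G : E n → E n},
      NeumannSolution M μ Ψ A V x₀ r u G → ∀ {a κ : ℝ}, 0 < a → a < r → 0 < κ →
      ENNReal.ofReal C * ∫⁻ x in bdryBall (graphDomain Ψ) x₀ r, ‖u x‖ₑ ^ 2 ≤
        ENNReal.ofReal (κ ^ 2 * (r - a) ^ (n + 1)) →
      ∀ᵐ x ∂volume.restrict (bdryBall (graphDomain Ψ) x₀ a), u x ≤ κ := by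
  obtain ⟨C, hC0, hC⟩ := deGiorgi_step hn M hμ
  -- The loss ratio per step: halving the radius gap costs `2 ^ (n + 1)` and halving the level gap
  -- costs `4`.
  set b : ℝ := 2 ^ (n + 1) * 4 with hb
  have hb1 : 1 < b := by
    have : (1 : ℝ) ≤ 2 ^ (n + 1) := one_le_pow₀ one_le_two
    linarith
  refine ⟨C * 4 ^ (n + 1) * 4 * b ^ (n + 1), by positivity, ?_⟩
  intro Ψ A V x₀ r u G hsol a κ ha har hκ hI
  set Ω := graphDomain Ψ
  set δ := r - a with hδ
  have hδ0 : 0 < δ := sub_pos.2 har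
  -- Radii start at the midpoint of `a` and `r`, because a step needs `s < r` strictly, and decrease
  -- to `a`; levels increase from `0` to `κ`.
  set s : ℕ → ℝ := fun j => a + δ / 2 ^ (j + 1) with hs
  set k : ℕ → ℝ := fun j => κ * (1 - 1 / 2 ^ j) with hk
  have hk0 : ∀ j, 0 ≤ k j := fun j => mul_nonneg hκ.le (by
    rw [sub_nonneg, div_le_one (by positivity)]; exact one_le_pow₀ one_le_two)
  have hkd : ∀ j, k (j + 1) - k j = κ / 2 ^ (j + 1) := fun j => by
    simp only [hk]; rw [pow_succ]; field_simp; ring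
  have hsd : ∀ j, s j - s (j + 1) = δ / 2 ^ (j + 2) := fun j => by
    simp only [hs]; rw [pow_succ _ (j + 1)]; field_simp; ring
  have hsr : ∀ j, s j < r := fun j => by
    have : δ / 2 ^ (j + 1) < δ := div_lt_self hδ0 (one_lt_pow₀ one_lt_two (by omega))
    simp only [hs]; linarith
  have hsa : ∀ j, a < s j := fun j => by
    have : 0 < δ / 2 ^ (j + 1) := by positivity
    simp only [hs]; linarith
  set Y : ℕ → ℝ≥0∞ := fun j => ∫⁻ x in bdryBall Ω x₀ (s j), ‖max (u x - k j) 0‖ₑ ^ 2 with hY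
  have hYle : ∀ j, Y j ≤ ∫⁻ x in bdryBall Ω x₀ r, ‖u x‖ₑ ^ 2 := fun j => by
    refine (lintegral_mono_set (bdryBall_mono _ _ (hsr j).le)).trans
      (lintegral_mono fun x => ?_)
    dsimp only
    gcongr
    refine enorm_le_iff_norm_le.2 ?_
    rw [Real.norm_of_nonneg (le_max_right _ _), Real.norm_eq_abs]
    exact max_le (by linarith [hk0 j, le_abs_self (u x)]) (abs_nonneg _)
  have hIfin : ∫⁻ x in bdryBall Ω x₀ r, ‖u x‖ₑ ^ 2 ≠ ⊤ := by
    rw [← eLpNorm_two_sq]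
    exact ENNReal.pow_ne_top hsol.sobolev.memLp.2.ne
  have hYfin : ∀ j, Y j ≠ ⊤ := fun j => ne_top_of_le_ne_top hIfin (hYle j)
  set Λ : ℝ := C * 4 ^ (n + 1) * 4 / (δ ^ (n + 1) * κ ^ 2) with hΛ
  have hstep : ∀ j, (Y (j + 1)).toReal ^ (n + 1) ≤ Λ * b ^ j * (Y j).toReal ^ (n + 1 + 1) := by
    intro j
    have hsj : s (j + 1) < s j := by
      rw [← sub_pos, hsd]; positivity
    have hkj : k j < k (j + 1) := by
      rw [← sub_pos, hkd]; positivity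
    have h1 := hC hsol (ha.trans (hsa (j + 1))) hsj (hsr j) (hk0 j) hkj
    have h2 := ENNReal.toReal_mono (ENNReal.mul_ne_top ENNReal.ofReal_ne_top
      (ENNReal.pow_ne_top (hYfin j))) h1
    rw [ENNReal.toReal_pow, ENNReal.toReal_mul, ENNReal.toReal_pow, hsd, hkd,
      ENNReal.toReal_ofReal (by positivity)] at h2
    refine h2.trans_eq ?_
    congr 1
    rw [hΛ, hb]
    simp only [div_pow, mul_pow, ← pow_mul]
    rw [show (4 : ℝ) = 2 ^ 2 by norm_num]
    simp only [← pow_mul]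
    field_simp
    ring
  have h0 : Λ * (Y 0).toReal * b ^ (n + 1) ≤ 1 := by
    have h1 := ENNReal.toReal_mono ENNReal.ofReal_ne_top
      ((mul_le_mul_right (hYle 0) _).trans hI)
    rw [ENNReal.toReal_mul, ENNReal.toReal_ofReal (by positivity),
      ENNReal.toReal_ofReal (by positivity)] at h1
    rw [hΛ, div_mul_eq_mul_div, div_mul_eq_mul_div, div_le_one (by positivity)]
    calc _ = _ := by ring
      _ ≤ _ := h1
      _ = _ := by ring
  have hconv := fast_convergence (y := fun j => (Y j).toReal) (Nat.succ_ne_zero n) hb1.le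
    (fun j => ENNReal.toReal_nonneg) (by positivity) hstep h0
  have hzero : ∫⁻ x in bdryBall Ω x₀ a, ‖max (u x - κ) 0‖ₑ ^ 2 = 0 := by
    set Z := ∫⁻ x in bdryBall Ω x₀ a, ‖max (u x - κ) 0‖ₑ ^ 2
    have hZ : ∀ j, Z ≤ Y j := fun j => by
      refine (lintegral_mono_set (bdryBall_mono _ _ (hsa j).le)).trans
        (lintegral_mono fun x => ?_)
      dsimp only
      gcongr
      refine enorm_le_iff_norm_le.2 ?_
      rw [Real.norm_of_nonneg (le_max_right _ _), Real.norm_of_nonneg (le_max_right _ _)]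
      refine max_le_max ?_ le_rfl
      have : k j ≤ κ := by
        simp only [hk]
        exact mul_le_of_le_one_right hκ.le (by
          have : (0 : ℝ) ≤ 1 / 2 ^ j := by positivity
          linarith)
      linarith
    have hZfin : Z ≠ ⊤ := ne_top_of_le_ne_top (hYfin 0) (hZ 0)
    have hlim : Tendsto (fun j => (Y 0).toReal * b⁻¹ ^ j) atTop (𝓝 0) := by
      simpa using (tendsto_pow_atTop_nhds_zero_of_lt_one (inv_nonneg.2 (by linarith))
        (inv_lt_one_of_one_lt₀ hb1)).const_mul (Y 0).toReal
    have h2 : Z.toReal ≤ 0 := ge_of_tendsto' hlim fun j =>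
      (ENNReal.toReal_mono (hYfin j) (hZ j)).trans (hconv j)
    exact ((ENNReal.toReal_eq_zero_iff _).1 (le_antisymm h2 ENNReal.toReal_nonneg)).resolve_right
      hZfin
  have hum : AEStronglyMeasurable u (volume.restrict (bdryBall Ω x₀ a)) :=
    hsol.sobolev.memLp.1.mono_measure (Measure.restrict_mono (bdryBall_mono _ _ har.le) le_rfl)
  have hm : AEStronglyMeasurable (fun x => max (u x - κ) 0)
      (volume.restrict (bdryBall Ω x₀ a)) :=
    (by fun_prop : Continuous fun t : ℝ => max (t - κ) 0).comp_aestronglyMeasurable hum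
  rw [lintegral_eq_zero_iff' (hm.enorm.pow_const 2)] at hzero
  filter_upwards [hzero] with x hx
  simp only [Pi.zero_apply, pow_eq_zero_iff two_ne_zero, enorm_eq_zero, max_eq_right_iff] at hx
  linarith

/-- Solutions of the Neumann problem are locally bounded up to the graph. -/
theorem local_bound (hn : 1 ≤ n) (M : ℝ≥0) {μ : ℝ} (hμ : 0 < μ) : ∃ C : ℝ, 0 < C ∧
    ∀ {Ψ : EuclideanSpace ℝ (Fin n) → ℝ} {A : E n → Matrix (Fin (n + 1)) (Fin (n + 1)) ℝ}
      {V : E n → ℝ} {x₀ : E n} {r : ℝ} {u : E n → ℝ} {G : E n → E n},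
      NeumannSolution M μ Ψ A V x₀ r u G → ∀ {a κ : ℝ}, 0 < a → a < r → 0 ≤ κ →
      ENNReal.ofReal C * ∫⁻ x in bdryBall (graphDomain Ψ) x₀ r, ‖u x‖ₑ ^ 2 ≤
        ENNReal.ofReal (κ ^ 2 * (r - a) ^ (n + 1)) →
      ∀ᵐ x ∂volume.restrict (bdryBall (graphDomain Ψ) x₀ a), |u x| ≤ κ := by
  obtain ⟨C, hC0, hC⟩ := local_upper_bound hn M hμ
  refine ⟨C, hC0, ?_⟩
  intro Ψ A V x₀ r u G hsol a κ ha har hκ hI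
  have hδ : 0 < r - a := sub_pos.2 har
  -- The iteration divides by `κ`, so `κ = 0` is reached as a limit of positive levels.
  have h : ∀ j : ℕ, ∀ᵐ x ∂volume.restrict (bdryBall (graphDomain Ψ) x₀ a),
      |u x| ≤ κ + 1 / ((j : ℝ) + 1) := by
    intro j
    have hj : 0 < 1 / ((j : ℝ) + 1) := by positivity
    have hI' : ENNReal.ofReal C * ∫⁻ x in bdryBall (graphDomain Ψ) x₀ r, ‖u x‖ₑ ^ 2 ≤
        ENNReal.ofReal ((κ + 1 / ((j : ℝ) + 1)) ^ 2 * (r - a) ^ (n + 1)) := by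
      refine hI.trans ?_
      gcongr
      linarith
    have hpos : 0 < κ + 1 / ((j : ℝ) + 1) := by linarith
    have h1 := hC hsol ha har hpos hI'
    have h2 := hC hsol.neg ha har hpos (by simp_rw [enorm_neg]; exact hI')
    filter_upwards [h1, h2] with x hx1 hx2
    exact abs_le.2 ⟨by linarith, hx1⟩
  filter_upwards [ae_all_iff.2 h] with x hx
  have hlim : Tendsto (fun j : ℕ => κ + 1 / ((j : ℝ) + 1)) atTop (𝓝 κ) := by
    simpa using (tendsto_one_div_add_atTop_nhds_zero_nat (𝕜 := ℝ)).const_add κ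
  exact ge_of_tendsto' hlim hx

/-! ### A Fefferman-Phong inequality -/

/-- Translation by a cone vector maps the region into itself and preserves volume. This monotonicity
replaces an extension operator. -/
lemma setLIntegral_graphDomain_add_le {M : ℝ≥0} {Ψ : EuclideanSpace ℝ (Fin n) → ℝ}
    (hΨ : LipschitzWith M Ψ) {h : E n} (hh : M * ‖horiz h‖ ≤ h (Fin.last n)) (f : E n → ℝ≥0∞) :
    ∫⁻ x in graphDomain Ψ, f (x + h) ≤ ∫⁻ x in graphDomain Ψ, f x := by
  have hΩ := (isOpen_graphDomain hΨ).measurableSet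
  calc ∫⁻ x in graphDomain Ψ, f (x + h)
      = ∫⁻ x in graphDomain Ψ, (graphDomain Ψ).indicator f (x + h) := by
        refine setLIntegral_congr_fun hΩ fun x hx => ?_
        rw [indicator_of_mem (add_mem_graphDomain hΨ hx hh)]
    _ ≤ ∫⁻ x, (graphDomain Ψ).indicator f (x + h) := setLIntegral_le_lintegral _ _
    _ = ∫⁻ x, (graphDomain Ψ).indicator f x := lintegral_add_right_eq_self _ h
    _ = _ := lintegral_indicator hΩ _

/-- The fundamental theorem of calculus along the segment, then Jensen on the unit interval. -/
lemma enorm_sub_sq_le_lintegral {w : E n → ℝ} (hw : ContDiff ℝ 1 w) (x h : E n) :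
    ‖w (x + h) - w x‖ₑ ^ 2 ≤
      ∫⁻ t in Ioc (0 : ℝ) 1, ‖h‖ₑ ^ 2 * ‖fderiv ℝ w (x + t • h)‖ₑ ^ 2 := by
  have hc : Continuous (fun t : ℝ => fderiv ℝ w (x + t • h)) :=
    (hw.continuous_fderiv one_ne_zero).comp (by fun_prop)
  have hd : ∀ t : ℝ, HasDerivAt (fun t : ℝ => w (x + t • h)) (fderiv ℝ w (x + t • h) h) t := by
    intro t
    have h1 : HasDerivAt (fun t : ℝ => x + t • h) h t := by
      simpa using ((hasDerivAt_id t).smul_const h).const_add x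
    exact (hw.differentiable one_ne_zero _).hasFDerivAt.comp_hasDerivAt t h1
  have hc2 : Continuous (fun t : ℝ => fderiv ℝ w (x + t • h) h) := hc.clm_apply continuous_const
  have hint : ∫ t in (0 : ℝ)..1, fderiv ℝ w (x + t • h) h = w (x + h) - w x := by
    rw [intervalIntegral.integral_eq_sub_of_hasDerivAt (fun t _ => hd t)
      (hc2.intervalIntegrable _ _)]
    simp
  rw [← hint, intervalIntegral.integral_of_le zero_le_one]
  calc _ ≤ (∫⁻ t in Ioc (0 : ℝ) 1, 1 * (‖h‖ₑ * ‖fderiv ℝ w (x + t • h)‖ₑ)) ^ 2 := by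
        gcongr
        refine (enorm_integral_le_lintegral_enorm _).trans (lintegral_mono fun t => ?_)
        dsimp only
        rw [one_mul, mul_comm]
        exact ContinuousLinearMap.le_opENorm _ _
    _ ≤ ∫⁻ t in Ioc (0 : ℝ) 1, 1 * (‖h‖ₑ * ‖fderiv ℝ w (x + t • h)‖ₑ) ^ 2 :=
        sq_lintegral_le_of_weight aemeasurable_const
          ((hc.enorm.measurable.const_mul _).aemeasurable) (by simp)
    _ = _ := by simp_rw [one_mul, mul_pow]

/-- The difference quotient estimate for translations by vectors of the upward cone. -/
lemma lintegral_translate_sub_sq_le {M : ℝ≥0} {Ψ : EuclideanSpace ℝ (Fin n) → ℝ}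
    (hΨ : LipschitzWith M Ψ) {h : E n} (hh : M * ‖horiz h‖ ≤ h (Fin.last n)) {w : E n → ℝ}
    (hw : ContDiff ℝ 1 w) :
    ∫⁻ x in graphDomain Ψ, ‖w (x + h) - w x‖ₑ ^ 2 ≤
      ‖h‖ₑ ^ 2 * ∫⁻ x in graphDomain Ψ, ‖fderiv ℝ w x‖ₑ ^ 2 := by
  have hm : Measurable fun p : E n × ℝ => ‖h‖ₑ ^ 2 * ‖fderiv ℝ w (p.1 + p.2 • h)‖ₑ ^ 2 := by
    have hc : Continuous fun p : E n × ℝ => fderiv ℝ w (p.1 + p.2 • h) :=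
      (hw.continuous_fderiv one_ne_zero).comp (by fun_prop)
    exact (hc.enorm.measurable.pow_const 2).const_mul _
  calc _ ≤ ∫⁻ x in graphDomain Ψ, ∫⁻ t in Ioc (0 : ℝ) 1,
            ‖h‖ₑ ^ 2 * ‖fderiv ℝ w (x + t • h)‖ₑ ^ 2 :=
        lintegral_mono fun x => enorm_sub_sq_le_lintegral hw x h
    _ = ∫⁻ t in Ioc (0 : ℝ) 1, ∫⁻ x in graphDomain Ψ,
            ‖h‖ₑ ^ 2 * ‖fderiv ℝ w (x + t • h)‖ₑ ^ 2 :=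
        lintegral_lintegral_swap hm.aemeasurable
    _ ≤ ∫⁻ t in Ioc (0 : ℝ) 1, ‖h‖ₑ ^ 2 * ∫⁻ x in graphDomain Ψ, ‖fderiv ℝ w x‖ₑ ^ 2 := by
        refine setLIntegral_mono' measurableSet_Ioc fun t ht => ?_
        rw [lintegral_const_mul' _ _ (by simp)]
        refine mul_le_mul_right ?_ _
        refine setLIntegral_graphDomain_add_le hΨ ?_ (fun x => ‖fderiv ℝ w x‖ₑ ^ 2)
        rw [horiz_smul, norm_smul, Real.norm_of_nonneg ht.1.le, PiLp.smul_apply, smul_eq_mul,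
          mul_left_comm]
        exact mul_le_mul_of_nonneg_left hh ht.1.le
    _ = _ := by simp

lemma sq_enorm_le_two_mul (a b : ℝ) : ‖a‖ₑ ^ 2 ≤ 2 * ‖b‖ₑ ^ 2 + 2 * ‖b - a‖ₑ ^ 2 := by
  rw [← ofReal_sq_eq_enorm_sq, ← ofReal_sq_eq_enorm_sq, ← ofReal_sq_eq_enorm_sq,
    show (2 : ℝ≥0∞) = ENNReal.ofReal 2 by simp, ← ENNReal.ofReal_mul zero_le_two,
    ← ENNReal.ofReal_mul zero_le_two, ← ENNReal.ofReal_add (by positivity) (by positivity)]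
  apply ENNReal.ofReal_le_ofReal
  nlinarith [sq_nonneg (2 * b - a)]

/-- Multiply the bound on `c` by `v`, integrate and divide by `P = ∫ v`. The `f` term keeps the
weight and only needs `P ≥ P₀`; in the `g` term `v ≤ K P` removes the weight, and `P` cancels. In
use `c`, `f`, `g` are `|w(x)|²`, `|w(x+h)|²` and `|w(x+h) - w(x)|²`. -/
lemma le_of_weighted_average {α : Type*} [MeasurableSpace α] {ν : Measure α}
    {v f g : α → ℝ≥0∞} (hv : Measurable v) (hf : Measurable f) (hg : Measurable g)
    {c K P₀ : ℝ≥0∞} (hP₀ : P₀ ≠ 0) (hlow : P₀ ≤ ∫⁻ h, v h ∂ν) (hfin : ∫⁻ h, v h ∂ν ≠ ⊤)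
    (hrev : ∀ᵐ h ∂ν, v h ≤ K * ∫⁻ h, v h ∂ν) (hc : ∀ h, c ≤ 2 * f h + 2 * g h) :
    c ≤ 2 * P₀⁻¹ * (∫⁻ h, v h * f h ∂ν) + 2 * K * ∫⁻ h, g h ∂ν := by
  set P := ∫⁻ h, v h ∂ν with hP
  have hvf : Measurable fun h => v h * f h := hv.mul hf
  have hP0 : P ≠ 0 := fun h => hP₀ (le_antisymm (hlow.trans_eq h) zero_le)
  have e1 : P * c ≤ 2 * (∫⁻ h, v h * f h ∂ν) + P * (2 * K * ∫⁻ h, g h ∂ν) := by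
    calc P * c = ∫⁻ h, v h * c ∂ν := (lintegral_mul_const _ hv).symm
      _ ≤ ∫⁻ h, (2 * (v h * f h) + 2 * (K * P) * g h) ∂ν := by
          refine lintegral_mono_ae (hrev.mono fun h hh => ?_)
          calc v h * c ≤ v h * (2 * f h + 2 * g h) := by
                gcongr; exact hc h
            _ = 2 * (v h * f h) + 2 * v h * g h := by ring
            _ ≤ _ := by gcongr
      _ = 2 * (∫⁻ h, v h * f h ∂ν) + 2 * (K * P) * ∫⁻ h, g h ∂ν := by
          rw [lintegral_add_left (hvf.const_mul 2), lintegral_const_mul _ hvf,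
            lintegral_const_mul _ hg]
      _ = _ := by ring
  calc c = P⁻¹ * (P * c) := by
        rw [← mul_assoc, ENNReal.inv_mul_cancel hP0 hfin, one_mul]
    _ ≤ P⁻¹ * (2 * (∫⁻ h, v h * f h ∂ν) + P * (2 * K * ∫⁻ h, g h ∂ν)) := by gcongr
    _ = 2 * P⁻¹ * (∫⁻ h, v h * f h ∂ν) + (P⁻¹ * P) * (2 * K * ∫⁻ h, g h ∂ν) := by ring
    _ ≤ _ := by
        rw [ENNReal.inv_mul_cancel hP0 hfin, one_mul]
        gcongr

/-- A Fefferman-Phong inequality at scale `ℓ`: the weight `v` is averaged over balls of radius `ℓ`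
shifted into the region above the graph. -/
theorem feffermanPhong_test {M : ℝ≥0} {Ψ : EuclideanSpace ℝ (Fin n) → ℝ}
    (hΨ : LipschitzWith M Ψ) {ℓ : ℝ} (hℓ : 0 < ℓ) {v : E n → ℝ≥0∞} (hv : Measurable v) {x₀ : E n}
    {r : ℝ} {P₀ K : ℝ≥0∞} (hP₀ : P₀ ≠ 0)
    (hlow : ∀ x ∈ ball x₀ r, P₀ ≤ ∫⁻ h in ball (((M + 1 : ℝ) * ℓ) • vert n) ℓ, v (x + h))
    (hfin : ∀ x ∈ ball x₀ r, ∫⁻ h in ball (((M + 1 : ℝ) * ℓ) • vert n) ℓ, v (x + h) ≠ ⊤)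
    (hrev : ∀ x ∈ ball x₀ r, ∀ᵐ h ∂volume.restrict (ball (((M + 1 : ℝ) * ℓ) • vert n) ℓ),
      v (x + h) ≤ K * ∫⁻ h in ball (((M + 1 : ℝ) * ℓ) • vert n) ℓ, v (x + h))
    {w : E n → ℝ} (hw : IsTest (ball x₀ r) w) :
    ∫⁻ x in graphDomain Ψ, ‖w x‖ₑ ^ 2 ≤
      2 * P₀⁻¹ * volume (ball (((M + 1 : ℝ) * ℓ) • vert n) ℓ) *
          (∫⁻ x in graphDomain Ψ, v x * ‖w x‖ₑ ^ 2) +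
        2 * K * volume (ball (((M + 1 : ℝ) * ℓ) • vert n) ℓ) * ENNReal.ofReal (((M + 2) * ℓ) ^ 2) *
          ∫⁻ x in graphDomain Ψ, ‖fderiv ℝ w x‖ₑ ^ 2 := by
  set S := ball (((M + 1 : ℝ) * ℓ) • vert n) ℓ with hS
  have hcone : ∀ h ∈ S, M * ‖horiz h‖ ≤ h (Fin.last n) := fun h hh =>
    cone_of_mem_closedBall (ball_subset_closedBall hh)
  have hwc := hw.1.continuous
  have hm1 : Measurable fun p : E n × E n => v (p.1 + p.2) * ‖w (p.1 + p.2)‖ₑ ^ 2 :=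
    (hv.mul (hwc.enorm.measurable.pow_const 2)).comp (measurable_fst.add measurable_snd)
  have hm2 : Measurable fun p : E n × E n => ‖w (p.1 + p.2) - w p.1‖ₑ ^ 2 := by
    have : Continuous fun p : E n × E n => w (p.1 + p.2) - w p.1 := by fun_prop
    exact this.enorm.measurable.pow_const 2
  have hpt : ∀ x, ‖w x‖ₑ ^ 2 ≤ 2 * P₀⁻¹ * (∫⁻ h in S, v (x + h) * ‖w (x + h)‖ₑ ^ 2) +
      2 * K * ∫⁻ h in S, ‖w (x + h) - w x‖ₑ ^ 2 := by
    intro x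
    by_cases hx : x ∈ ball x₀ r
    swap
    · rw [(hw.eq_zero hx).1]; simp
    have hxa : Continuous fun h : E n => x + h := by fun_prop
    exact le_of_weighted_average (hv.comp (measurable_const_add x))
      ((hwc.comp hxa).enorm.measurable.pow_const 2)
      (((hwc.comp hxa).sub continuous_const).enorm.measurable.pow_const 2) hP₀ (hlow x hx)
      (hfin x hx) (hrev x hx) fun h => sq_enorm_le_two_mul _ _
  -- After exchanging the integrals, each fixed `h` in the shifted ball is a cone vector, so the
  -- translated integral is dominated by the untranslated one.
  have i1 : ∫⁻ x in graphDomain Ψ, ∫⁻ h in S, v (x + h) * ‖w (x + h)‖ₑ ^ 2 ≤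
      volume S * ∫⁻ x in graphDomain Ψ, v x * ‖w x‖ₑ ^ 2 := by
    rw [lintegral_lintegral_swap hm1.aemeasurable]
    calc _ ≤ ∫⁻ _ in S, ∫⁻ x in graphDomain Ψ, v x * ‖w x‖ₑ ^ 2 :=
          setLIntegral_mono' measurableSet_ball fun h hh =>
            setLIntegral_graphDomain_add_le hΨ (hcone h hh) fun x => v x * ‖w x‖ₑ ^ 2
      _ = _ := by rw [setLIntegral_const, mul_comm]
  have i2 : ∫⁻ x in graphDomain Ψ, ∫⁻ h in S, ‖w (x + h) - w x‖ₑ ^ 2 ≤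
      volume S * (ENNReal.ofReal (((M + 2) * ℓ) ^ 2) *
        ∫⁻ x in graphDomain Ψ, ‖fderiv ℝ w x‖ₑ ^ 2) := by
    rw [lintegral_lintegral_swap hm2.aemeasurable]
    calc _ ≤ ∫⁻ _ in S, ENNReal.ofReal (((M + 2) * ℓ) ^ 2) *
            ∫⁻ x in graphDomain Ψ, ‖fderiv ℝ w x‖ₑ ^ 2 := by
          refine setLIntegral_mono' measurableSet_ball fun h hh => ?_
          refine (lintegral_translate_sub_sq_le hΨ (hcone h hh) hw.contDiff_one).trans ?_
          gcongr
          rw [ofReal_sq_eq_enorm_sq]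
          gcongr
          refine enorm_le_iff_norm_le.2 ?_
          rw [Real.norm_of_nonneg (by positivity)]
          exact norm_le_of_mem_closedBall hℓ.le (ball_subset_closedBall hh)
      _ = _ := by rw [setLIntegral_const, mul_comm]
  have hmm1 : Measurable fun x => ∫⁻ h in S, v (x + h) * ‖w (x + h)‖ₑ ^ 2 :=
    hm1.lintegral_prod_right'
  have hmm2 : Measurable fun x => ∫⁻ h in S, ‖w (x + h) - w x‖ₑ ^ 2 :=
    hm2.lintegral_prod_right'
  calc _ ≤ ∫⁻ x in graphDomain Ψ, (2 * P₀⁻¹ * (∫⁻ h in S, v (x + h) * ‖w (x + h)‖ₑ ^ 2) +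
          2 * K * ∫⁻ h in S, ‖w (x + h) - w x‖ₑ ^ 2) := lintegral_mono hpt
    _ = 2 * P₀⁻¹ * (∫⁻ x in graphDomain Ψ, ∫⁻ h in S, v (x + h) * ‖w (x + h)‖ₑ ^ 2) +
          2 * K * ∫⁻ x in graphDomain Ψ, ∫⁻ h in S, ‖w (x + h) - w x‖ₑ ^ 2 := by
        rw [lintegral_add_left (hmm1.const_mul _), lintegral_const_mul _ hmm1,
          lintegral_const_mul _ hmm2]
    _ ≤ 2 * P₀⁻¹ * (volume S * ∫⁻ x in graphDomain Ψ, v x * ‖w x‖ₑ ^ 2) +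
          2 * K * (volume S * (ENNReal.ofReal (((M + 2) * ℓ) ^ 2) *
            ∫⁻ x in graphDomain Ψ, ‖fderiv ℝ w x‖ₑ ^ 2)) := by gcongr
    _ = _ := by ring

/-- Quadratic inequalities for test functions pass to limits of test functions. -/
lemma IsTestLimit.lintegral_sq_le {U B : Set (E n)} {w : E n → ℝ} {g : E n → E n}
    (hw : IsTestLimit U B w g) {s : E n → ℝ} (hs : Measurable s) {b : ℝ}
    (hsb : ∀ᵐ x ∂volume.restrict U, |s x| ≤ b) {α β : ℝ≥0∞} (hα : α ≠ ⊤) (hβ : β ≠ ⊤)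
    (h : ∀ φ, IsTest B φ → ∫⁻ x in U, ‖φ x‖ₑ ^ 2 ≤
      α * (∫⁻ x in U, ‖s x * φ x‖ₑ ^ 2) + β * ∫⁻ x in U, ‖gradient φ x‖ₑ ^ 2) :
    ∫⁻ x in U, ‖w x‖ₑ ^ 2 ≤ α * (∫⁻ x in U, ‖s x * w x‖ₑ ^ 2) + β * ∫⁻ x in U, ‖g x‖ₑ ^ 2 := by
  set μ := volume.restrict U
  obtain ⟨φ, hφ, hae, h1, h2⟩ := hw.exists_seq
  have hsm : AEStronglyMeasurable s μ := hs.aestronglyMeasurable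
  have hφm : ∀ j, AEStronglyMeasurable (φ j) μ := fun j =>
    (hφ j).1.continuous.aestronglyMeasurable
  have h3 : Tendsto (fun j => eLpNorm (fun x => s x * φ j x - s x * w x) 2 μ) atTop (𝓝 0) := by
    have hle : ∀ j, eLpNorm (fun x => s x * φ j x - s x * w x) 2 μ ≤
        ENNReal.ofReal b * eLpNorm (fun x => φ j x - w x) 2 μ := by
      intro j
      refine eLpNorm_le_mul_eLpNorm_of_ae_le_mul (hsb.mono fun x hx => ?_) 2
      rw [← mul_sub, norm_mul]
      exact mul_le_mul_of_nonneg_right hx (norm_nonneg _)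
    refine tendsto_of_tendsto_of_tendsto_of_le_of_le tendsto_const_nhds ?_ (fun _ => zero_le) hle
    simpa using ENNReal.Tendsto.const_mul h1 (Or.inr ENNReal.ofReal_ne_top)
  simp_rw [← eLpNorm_two_sq] at h ⊢
  have hle : ∀ j, eLpNorm (φ j) 2 μ ^ 2 ≤
      α * (eLpNorm (fun x => s x * w x) 2 μ +
        eLpNorm (fun x => s x * φ j x - s x * w x) 2 μ) ^ 2 +
      β * (eLpNorm g 2 μ + eLpNorm (fun x => gradient (φ j) x - g x) 2 μ) ^ 2 := by
    intro j
    refine (h _ (hφ j)).trans ?_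
    gcongr
    · exact eLpNorm_le_add_sub (hsm.mul (hφm j)) (hsm.mul hw.memLp.1)
    · exact eLpNorm_le_add_sub (continuous_gradient (hφ j).contDiff_one).aestronglyMeasurable
        hw.grad_memLp.1
  have hlim : Tendsto (fun j => α * (eLpNorm (fun x => s x * w x) 2 μ +
        eLpNorm (fun x => s x * φ j x - s x * w x) 2 μ) ^ 2 +
      β * (eLpNorm g 2 μ + eLpNorm (fun x => gradient (φ j) x - g x) 2 μ) ^ 2) atTop
      (𝓝 (α * eLpNorm (fun x => s x * w x) 2 μ ^ 2 + β * eLpNorm g 2 μ ^ 2)) := by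
    refine Tendsto.add ?_ ?_
    · refine ENNReal.Tendsto.const_mul (((ENNReal.continuous_pow 2).tendsto _).comp ?_)
        (Or.inr hα)
      simpa using h3.const_add (eLpNorm (fun x => s x * w x) 2 μ)
    · refine ENNReal.Tendsto.const_mul (((ENNReal.continuous_pow 2).tendsto _).comp ?_)
        (Or.inr hβ)
      simpa using h2.const_add (eLpNorm g 2 μ)
  calc eLpNorm w 2 μ ^ 2 = ∫⁻ x, liminf (fun j => ‖φ j x‖ₑ ^ 2) atTop ∂μ := by
        rw [eLpNorm_two_sq]
        refine lintegral_congr_ae (hae.mono fun x hx => ?_)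
        exact (((ENNReal.continuous_pow 2).tendsto _).comp
          ((continuous_enorm.tendsto _).comp hx)).liminf_eq.symm
    _ ≤ liminf (fun j => ∫⁻ x, ‖φ j x‖ₑ ^ 2 ∂μ) atTop :=
        lintegral_liminf_le fun j => (hφ j).1.continuous.enorm.measurable.pow_const 2
    _ ≤ _ := liminf_le_liminf (Eventually.of_forall fun j => by
        rw [← eLpNorm_two_sq]; exact hle j)
    _ = _ := hlim.liminf_eq

/-! ### Potentials of class `B_∞` -/

lemma volume_real_ball (x : E n) {R : ℝ} (hR : 0 ≤ R) :
    volume.real (ball x R) = R ^ (n + 1) * volume.real (ball (0 : E n) 1) := by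
  rw [measureReal_def, Measure.addHaar_ball volume x hR, ENNReal.toReal_mul,
    ENNReal.toReal_ofReal (by positivity), measureReal_def]
  simp

lemma volume_real_unit_ball_pos : 0 < volume.real (ball (0 : E n) 1) :=
  ENNReal.toReal_pos (measure_ball_pos _ _ one_pos).ne' measure_ball_lt_top.ne

namespace IsBInfty

variable {K : ℝ} {V : E n → ℝ}

lemma integrableOn (h : IsBInfty K V) (x : E n) (R : ℝ) : IntegrableOn V (ball x R) := by
  have : IsFiniteMeasure (volume.restrict (ball x R)) :=
    ⟨by rw [Measure.restrict_apply_univ]; exact measure_ball_lt_top⟩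
  exact (h.locBounded x R).integrable le_top

lemma setIntegral_mono (h : IsBInfty K V) {S : Set (E n)} {x : E n} {R : ℝ} (hS : S ⊆ ball x R) :
    ∫ y in S, V y ≤ ∫ y in ball x R, V y :=
  setIntegral_mono_set (h.integrableOn x R) (ae_restrict_of_ae (h.pos.mono fun _ h => h.le))
    hS.eventuallyLE

lemma integral_nonneg (h : IsBInfty K V) (S : Set (E n)) : 0 ≤ ∫ y in S, V y :=
  integral_nonneg_of_ae (ae_restrict_of_ae (h.pos.mono fun _ h => h.le))

lemma weaken (h : IsBInfty K V) {K' : ℝ} (hK : K ≤ K') : IsBInfty K' V where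
  pos := h.pos
  locBounded := h.locBounded
  reverse x r hr := by
    filter_upwards [h.reverse x r hr] with y hy
    refine hy.trans (mul_le_mul_of_nonneg_right hK ?_)
    rw [setAverage_eq, smul_eq_mul]
    exact mul_nonneg (by positivity) (h.integral_nonneg _)

lemma le_mul_integral (h : IsBInfty K V) (x : E n) {R : ℝ} (hR : 0 < R) :
    ∀ᵐ y ∂volume.restrict (ball x R),
      V y ≤ K / volume.real (ball x R) * ∫ z in ball x R, V z := by
  filter_upwards [h.reverse x R hR] with y hy
  refine (le_abs_self _).trans (hy.trans_eq ?_)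
  rw [setAverage_eq, smul_eq_mul]; ring

lemma setIntegral_le (h : IsBInfty K V) {S : Set (E n)} {x : E n} {R : ℝ}
    (hR : 0 < R) (hS : S ⊆ ball x R) :
    ∫ y in S, V y ≤ volume.real S * (K / volume.real (ball x R) * ∫ z in ball x R, V z) := by
  have hfin : volume S ≠ ⊤ := ne_top_of_le_ne_top measure_ball_lt_top.ne (measure_mono hS)
  calc ∫ y in S, V y ≤ ∫ _ in S, (K / volume.real (ball x R) * ∫ z in ball x R, V z) := by
        refine setIntegral_mono_ae_restrict ((h.integrableOn x R).mono_set hS)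
          (integrableOn_const hfin) ?_
        exact ae_restrict_of_ae_restrict_of_subset hS (h.le_mul_integral x hR)
    _ = _ := by rw [setIntegral_const, smul_eq_mul]

lemma integral_ball_le (h : IsBInfty K V) (x : E n) {ρ r : ℝ} (hρ : 0 < ρ) (hr : ρ ≤ r) :
    ∫ y in ball x ρ, V y ≤ K * (ρ / r) ^ (n + 1) * ∫ y in ball x r, V y := by
  have hr0 := hρ.trans_le hr
  refine (h.setIntegral_le hr0 (ball_subset_ball hr)).trans_eq ?_
  rw [volume_real_ball x hρ.le, volume_real_ball x hr0.le]
  have := volume_real_unit_ball_pos (n := n)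
  rw [div_pow]
  field_simp

/-- By Bernoulli the removed annulus is at most a fraction `1/(2K)` of the ball's volume, and `V` is
at most `K` times its mean there, so the annulus carries at most half of the mass. -/
lemma half_integral_le (h : IsBInfty K V) (hK : 1 ≤ K) (x : E n) {R : ℝ} (hR : 0 < R) :
    1 / 2 * ∫ y in ball x R, V y ≤
      ∫ y in ball x ((1 - 1 / (2 * K * (n + 1))) * R), V y := by
  set θ : ℝ := 1 - 1 / (2 * K * (n + 1)) with hθ
  have hd : 1 / (2 * K * (n + 1)) ≤ 1 / 2 := by
    apply one_div_le_one_div_of_le two_pos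
    nlinarith [(Nat.cast_nonneg n : (0 : ℝ) ≤ n)]
  have hd0 : 0 < 1 / (2 * K * (n + 1)) := by positivity
  have hθ0 : 0 < θ := by linarith
  have hθ1 : θ ≤ 1 := by linarith
  have hsub : ball x (θ * R) ⊆ ball x R := ball_subset_ball (by nlinarith)
  have hbern : 1 - 1 / (2 * K) ≤ θ ^ (n + 1) := by
    have := one_add_mul_le_pow (a := -(1 / (2 * K * (n + 1)))) (by linarith) (n + 1)
    push_cast at this
    calc 1 - 1 / (2 * K) = 1 + (n + 1 : ℝ) * -(1 / (2 * K * (n + 1))) := by field_simp; ring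
      _ ≤ _ := this
      _ = θ ^ (n + 1) := by rw [hθ]; ring
  have hsplit : ∫ y in ball x R, V y =
      (∫ y in ball x (θ * R), V y) + ∫ y in ball x R \ ball x (θ * R), V y := by
    have := setIntegral_sdiff (μ := volume) (f := V) measurableSet_ball (h.integrableOn x R) hsub
    linarith
  have hann := h.setIntegral_le (S := ball x R \ ball x (θ * R)) (x := x) hR sdiff_subset
  rw [measureReal_sdiff hsub measurableSet_ball,
    volume_real_ball x hR.le, volume_real_ball x (by positivity)] at hann
  have hb₁ := volume_real_unit_ball_pos (n := n)
  set b₁ := volume.real (ball (0 : E n) 1)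
  set W := ∫ y in ball x R, V y
  have hW : 0 ≤ W := h.integral_nonneg _
  have e : (R ^ (n + 1) * b₁ - (θ * R) ^ (n + 1) * b₁) * (K / (R ^ (n + 1) * b₁) * W) =
      K * (1 - θ ^ (n + 1)) * W := by
    rw [mul_pow]; field_simp
  rw [e] at hann
  have h1 : K * (1 - θ ^ (n + 1)) ≤ 1 / 2 := by
    calc K * (1 - θ ^ (n + 1)) ≤ K * (1 / (2 * K)) := by gcongr; linarith
      _ = 1 / 2 := by field_simp
  have h2 : K * (1 - θ ^ (n + 1)) * W ≤ 1 / 2 * W := by gcongr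
  linarith

lemma half_pow_integral_le (h : IsBInfty K V) (hK : 1 ≤ K) (x : E n) {R : ℝ} (hR : 0 < R) (m : ℕ) :
    (1 / 2) ^ m * ∫ y in ball x R, V y ≤
      ∫ y in ball x ((1 - 1 / (2 * K * (n + 1))) ^ m * R), V y := by
  have hd : 1 / (2 * K * (n + 1)) ≤ 1 / 2 := by
    apply one_div_le_one_div_of_le two_pos
    nlinarith [(Nat.cast_nonneg n : (0 : ℝ) ≤ n)]
  have hθ0 : 0 < 1 - 1 / (2 * K * (n + 1)) := by linarith
  induction m with
  | zero => simp
  | succ m ih =>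
    have h1 := h.half_integral_le hK x (mul_pos (pow_pos hθ0 m) hR)
    rw [← mul_assoc, ← pow_succ'] at h1
    refine le_trans ?_ h1
    rw [pow_succ', mul_assoc]
    gcongr

lemma psi_nonneg (h : IsBInfty K V) (x : E n) {r : ℝ} (hr : 0 < r) : 0 ≤ psi V x r :=
  mul_nonneg (by positivity) (h.integral_nonneg _)

/-- The mass scales at least like volume, `(ρ/r)^(n+1)`, and the normalization takes back `n - 1`
powers. -/
lemma psi_le (h : IsBInfty K V) (hn : 1 ≤ n) (x : E n) {ρ r : ℝ} (hρ : 0 < ρ) (hr : ρ ≤ r) :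
    psi V x ρ ≤ K * (ρ / r) ^ 2 * psi V x r := by
  have hr0 := hρ.trans_le hr
  obtain ⟨j, rfl⟩ : ∃ j, n = j + 1 := ⟨n - 1, by omega⟩
  simp only [psi, Nat.add_sub_cancel]
  calc 1 / ρ ^ j * ∫ y in ball x ρ, V y
      ≤ 1 / ρ ^ j * (K * (ρ / r) ^ (j + 1 + 1) * ∫ y in ball x r, V y) := by
        gcongr
        exact h.integral_ball_le x hρ hr
    _ = _ := by rw [div_pow, div_pow]; field_simp; ring_nf

lemma sq_mul_fpsMax_le (h : IsBInfty K V) (hK : 0 ≤ K) (hn : 1 ≤ n) (x : E n) {r : ℝ}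
    (hr : 0 < r) : (r * fpsMax x V) ^ 2 ≤ 1 + 4 * K * psi V x r := by
  have hψ := h.psi_nonneg x hr
  set S := {s : ℝ | ∃ r : ℝ, 0 < r ∧ psi V x r ≤ 1 ∧ s = 1 / r} with hS
  have hbdd : BddBelow S := ⟨0, by rintro s ⟨ρ, hρ, -, rfl⟩; positivity⟩
  have hm0 : 0 ≤ fpsMax x V := Real.sInf_nonneg (by rintro s ⟨ρ, hρ, -, rfl⟩; positivity)
  set m := fpsMax x V with hm
  rcases le_or_gt (r * m) 1 with hrm | hrm
  · have : (r * m) ^ 2 ≤ 1 := pow_le_one₀ (by positivity) hrm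
    have : 0 ≤ 4 * K * psi V x r := by positivity
    linarith
  · have hmpos : 0 < m := by
      rcases hm0.lt_or_eq with h | h
      · exact h
      · rw [← h] at hrm; norm_num at hrm
    -- Any radius above `1/m` has `ψ > 1` by definition of the infimum; `2/m` gives a strict margin,
    -- and the cap at `r` permits comparison with `ψ(x, r)`.
    set ρ := min (2 / m) r with hρ
    have hρ0 : 0 < ρ := lt_min (by positivity) hr
    have hρm : 1 / m < ρ := by
      refine lt_min ?_ ?_
      · gcongr; norm_num
      · rwa [div_lt_iff₀ hmpos]
    have hψρ : 1 < psi V x ρ := by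
      by_contra hc
      have h1 : m ≤ 1 / ρ := csInf_le hbdd ⟨ρ, hρ0, not_lt.1 hc, rfl⟩
      rw [le_div_iff₀ hρ0] at h1
      rw [div_lt_iff₀ hmpos] at hρm
      linarith
    have h1 : 1 < K * (ρ / r) ^ 2 * psi V x r :=
      hψρ.trans_le (h.psi_le hn x hρ0 (min_le_right _ _))
    have h2 : ρ * m ≤ 2 := by
      have := min_le_left (2 / m) r
      rwa [← hρ, le_div_iff₀ hmpos] at this
    calc (r * m) ^ 2 = (r * m) ^ 2 * 1 := (mul_one _).symm
      _ ≤ (r * m) ^ 2 * (K * (ρ / r) ^ 2 * psi V x r) := by gcongr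
      _ = K * psi V x r * (ρ * m) ^ 2 := by field_simp
      _ ≤ K * psi V x r * 2 ^ 2 := by gcongr
      _ ≤ _ := by linarith

lemma aemeasurable (h : IsBInfty K V) : AEMeasurable V volume := by
  have h1 : (⋃ k : ℕ, ball (0 : E n) k) = univ := iUnion_ball_nat 0
  rw [← Measure.restrict_univ (μ := volume), ← h1]
  exact aemeasurable_iUnion_iff.2 fun k => (h.locBounded 0 k).1.aemeasurable

end IsBInfty

lemma ofReal_eq_enorm_sqrt_sq (a : ℝ) : ENNReal.ofReal a = ‖√a‖ₑ ^ 2 := by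
  rw [← ofReal_sq_eq_enorm_sq]
  rcases le_total 0 a with h | h
  · rw [Real.sq_sqrt h]
  · rw [ENNReal.ofReal_of_nonpos h, Real.sqrt_eq_zero_of_nonpos h]; simp

lemma measurePreserving_add_left_ball (x c : E n) (ℓ : ℝ) :
    MeasurePreserving (fun h : E n => x + h) (volume.restrict (ball c ℓ))
      (volume.restrict (ball (x + c) ℓ)) := by
  have h1 : (fun h : E n => x + h) ⁻¹' ball (x + c) ℓ = ball c ℓ := by
    ext h; simp
  have := (measurePreserving_add_left volume x).restrict_preimage
    (measurableSet_ball (x := x + c) (ε := ℓ))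
  rwa [h1] at this

/-- The Fefferman-Phong inequality for a potential of class `B_∞`, in terms of
`ψ(x₀, r) = r^{-(d-2)} ∫_{B(x₀, r)} V`. -/
theorem feffermanPhong (hn : 1 ≤ n) (M : ℝ≥0) {K : ℝ} (hK : 1 ≤ K) : ∃ C y q : ℝ, 0 < C ∧ 1 < y ∧
    0 < q ∧ q < 1 ∧
    ∀ {Ψ : EuclideanSpace ℝ (Fin n) → ℝ}, LipschitzWith M Ψ → ∀ {V : E n → ℝ}, IsBInfty K V →
      ∀ {x₀ : E n} {r : ℝ}, 0 < r → 1 ≤ psi V x₀ r →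
      ∃ m : ℕ, psi V x₀ r < y ^ (m + 1) ∧
        ∀ {w : E n → ℝ} {g : E n → E n},
          IsTestLimit (bdryBall (graphDomain Ψ) x₀ r) (ball x₀ r) w g →
          ∫⁻ x in bdryBall (graphDomain Ψ) x₀ r, ‖w x‖ₑ ^ 2 ≤
            ENNReal.ofReal (C * r ^ 2 * q ^ m) *
              ((∫⁻ x in bdryBall (graphDomain Ψ) x₀ r, ENNReal.ofReal (V x * w x ^ 2)) +
                ∫⁻ x in bdryBall (graphDomain Ψ) x₀ r, ‖g x‖ₑ ^ 2) := by
  set θ : ℝ := 1 - 1 / (2 * K * (n + 1)) with hθ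
  have hd : 1 / (2 * K * (n + 1)) ≤ 1 / 2 := by
    apply one_div_le_one_div_of_le two_pos
    nlinarith [(Nat.cast_nonneg n : (0 : ℝ) ≤ n)]
  have hd0 : 0 < 1 / (2 * K * (n + 1)) := by positivity
  have hθ0 : 0 < θ := by linarith
  have hθ1 : θ < 1 := by linarith
  -- The shifted ball must be enlarged to radius `(M + 3) r` to contain `B(x₀, r)`; `m₀` further
  -- shrinkings undo this enlargement.
  obtain ⟨m₀, hm₀⟩ : ∃ m₀ : ℕ, θ ^ m₀ < 1 / (M + 3) :=
    exists_pow_lt_of_lt_one (by positivity) hθ1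
  set q : ℝ := θ ^ 2 with hq
  have hq0 : 0 < q := by positivity
  have hq1 : q < 1 := pow_lt_one₀ hθ0.le hθ1 two_ne_zero
  have hb₁ := volume_real_unit_ball_pos (n := n)
  set b₁ := volume.real (ball (0 : E n) 1) with hb₁def
  have hy1 : 1 < 2 / q := by rw [one_lt_div hq0]; linarith
  refine ⟨2 ^ (m₀ + 1) * b₁ + 2 * K * (M + 2) ^ 2, 2 / q, q, by positivity, hy1, hq0, hq1, ?_⟩
  intro Ψ hΨ V hV x₀ r hr hN
  set N := psi V x₀ r with hNdef
  -- The largest number of shrinkings for which `2^m / N ≤ q^m` still holds, so that the potential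
  -- term is no worse than the gradient term.
  obtain ⟨m, hmN, hNm⟩ := exists_nat_pow_near hN hy1
  refine ⟨m, hNm, ?_⟩
  intro w g hw
  set D := bdryBall (graphDomain Ψ) x₀ r with hD
  -- a measurable representative of the potential
  set V' := hV.aemeasurable.mk V with hV'
  have hV'm : Measurable V' := hV.aemeasurable.measurable_mk
  have hVV' : V =ᵐ[volume] V' := hV.aemeasurable.ae_eq_mk
  set v : E n → ℝ≥0∞ := fun x => ENNReal.ofReal (V' x) with hv
  have hvm : Measurable v := hV'm.ennreal_ofReal
  set ℓ : ℝ := θ ^ m * r with hℓ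
  have hℓ0 : 0 < ℓ := by positivity
  have hℓr : ℓ ≤ r := mul_le_of_le_one_left hr.le (pow_le_one₀ hθ0.le hθ1.le)
  set c : E n := ((M + 1 : ℝ) * ℓ) • vert n with hc
  have hcn : ‖c‖ = (M + 1) * ℓ := by
    rw [hc, norm_smul, norm_vert, mul_one, Real.norm_of_nonneg (by positivity)]
  have hvolS : volume.real (ball c ℓ) = ℓ ^ (n + 1) * b₁ := volume_real_ball c hℓ0.le
  have hvolS0 : 0 < volume.real (ball c ℓ) := by rw [hvolS]; positivity
  have hvol : ∀ z : E n, volume.real (ball z ℓ) = volume.real (ball c ℓ) := fun z => by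
    rw [volume_real_ball z hℓ0.le, volume_real_ball c hℓ0.le]
  have hP : ∀ x, ∫⁻ h in ball c ℓ, v (x + h) = ENNReal.ofReal (∫ y in ball (x + c) ℓ, V y) := by
    intro x
    rw [(measurePreserving_add_left_ball x c ℓ).lintegral_comp hvm,
      ofReal_integral_eq_lintegral_ofReal (hV.integrableOn _ _)
        (ae_restrict_of_ae (hV.pos.mono fun _ h => h.le))]
    exact lintegral_congr_ae (ae_restrict_of_ae (hVV'.mono fun y hy => by simp only [hv, hy]))
  -- The mass of `V` in `B(x₀, r)` after `m + m₀` halvings.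
  set P₀ : ℝ := (1 / 2) ^ (m + m₀) * (N * r ^ (n - 1)) with hP₀
  have hP₀0 : 0 < P₀ := by positivity
  have hNW : N * r ^ (n - 1) = ∫ y in ball x₀ r, V y := by
    rw [hNdef, psi]; field_simp
  have hlow : ∀ x ∈ ball x₀ r, P₀ ≤ ∫ y in ball (x + c) ℓ, V y := by
    intro x hx
    have hR0 : 0 < (M + 3 : ℝ) * r := by positivity
    have hsub : ball x₀ r ⊆ ball (x + c) ((M + 3) * r) := by
      intro y hy
      rw [mem_ball] at hx hy ⊢
      calc dist y (x + c) ≤ dist y x₀ + dist x₀ x + dist x (x + c) := dist_triangle4 _ _ _ _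
        _ < r + r + (M + 1) * r := by
            rw [dist_comm x₀ x, dist_self_add_right, hcn]
            have : ((M : ℝ) + 1) * ℓ ≤ (M + 1) * r := by gcongr
            linarith
        _ = _ := by ring
    calc P₀ ≤ (1 / 2) ^ (m + m₀) * ∫ y in ball (x + c) ((M + 3) * r), V y := by
          rw [hP₀, hNW]
          exact mul_le_mul_of_nonneg_left (hV.setIntegral_mono hsub) (by positivity)
      _ ≤ ∫ y in ball (x + c) (θ ^ (m + m₀) * ((M + 3) * r)), V y :=
          hV.half_pow_integral_le hK _ hR0 _
      _ ≤ _ := by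
          refine hV.setIntegral_mono (ball_subset_ball ?_)
          have h1 : θ ^ m₀ * (M + 3) ≤ 1 := by
            rw [lt_div_iff₀ (by positivity)] at hm₀; exact hm₀.le
          calc θ ^ (m + m₀) * ((M + 3) * r) = θ ^ m * r * (θ ^ m₀ * (M + 3)) := by ring
            _ ≤ θ ^ m * r * 1 := by gcongr
            _ = ℓ := mul_one _
  set K' : ℝ≥0∞ := ENNReal.ofReal (K / volume.real (ball c ℓ)) with hK'
  have hFP : ∀ φ, IsTest (ball x₀ r) φ → _ := fun φ hφ =>
    feffermanPhong_test hΨ hℓ0 hvm (x₀ := x₀) (r := r) (P₀ := ENNReal.ofReal P₀) (K := K')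
      (by simpa using hP₀0) (fun x hx => by
        rw [hP]; exact ENNReal.ofReal_le_ofReal (hlow x hx))
      (fun x hx => by rw [hP]; exact ENNReal.ofReal_ne_top)
      (fun x hx => by
        rw [hP, hK', ← ENNReal.ofReal_mul (by positivity)]
        have h1 : ∀ᵐ y ∂volume.restrict (ball (x + c) ℓ), v y ≤
            ENNReal.ofReal (K / volume.real (ball c ℓ) * ∫ z in ball (x + c) ℓ, V z) := by
          filter_upwards [hV.le_mul_integral (x + c) hℓ0, ae_restrict_of_ae hVV'] with y hy hy'
          simp only [hv, ← hy']
          rw [hvol] at hy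
          exact ENNReal.ofReal_le_ofReal hy
        exact (measurePreserving_add_left_ball x c ℓ).quasiMeasurePreserving.ae h1) hφ
  set α := 2 * (ENNReal.ofReal P₀)⁻¹ * volume (ball c ℓ) with hα
  set β := 2 * K' * volume (ball c ℓ) * ENNReal.ofReal (((M + 2) * ℓ) ^ 2) with hβ
  set Cr := ENNReal.ofReal ((2 ^ (m₀ + 1) * b₁ + 2 * K * (M + 2) ^ 2) * r ^ 2 * q ^ m) with hCr
  have hvolE : volume (ball c ℓ) = ENNReal.ofReal (volume.real (ball c ℓ)) :=
    (ofReal_measureReal measure_ball_lt_top.ne).symm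
  have hqm : q ^ m = θ ^ m * θ ^ m := by rw [hq, sq, mul_pow]
  have hαle : α ≤ Cr := by
    have e : α = ENNReal.ofReal (2 * P₀⁻¹ * volume.real (ball c ℓ)) := by
      rw [ENNReal.ofReal_mul (by positivity), ENNReal.ofReal_mul zero_le_two,
        ENNReal.ofReal_inv_of_pos hP₀0, ← hvolE, ENNReal.ofReal_ofNat]
    rw [e]
    apply ENNReal.ofReal_le_ofReal
    have h1 : 2 ^ m ≤ N * q ^ m := by
      rw [div_pow, div_le_iff₀ (by positivity)] at hmN; exact hmN
    -- This crude bound suffices: the required `q ^ m` already comes from `2 ^ m / N`.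
    have h2 : ℓ ^ (n + 1) ≤ r ^ (n + 1) := by gcongr
    obtain ⟨j, rfl⟩ : ∃ j, n = j + 1 := ⟨n - 1, by omega⟩
    calc 2 * P₀⁻¹ * volume.real (ball c ℓ) ≤ 2 * P₀⁻¹ * (r ^ (j + 1 + 1) * b₁) := by
          rw [hvolS]; gcongr
      _ = 2 ^ (m₀ + 1) * b₁ * r ^ 2 * (2 ^ m / N) := by
          rw [hP₀]
          simp only [Nat.add_sub_cancel]
          rw [one_div, inv_pow, mul_inv, inv_inv]
          field_simp
          ring_nf
      _ ≤ 2 ^ (m₀ + 1) * b₁ * r ^ 2 * q ^ m := by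
          gcongr
          rw [div_le_iff₀ (by linarith)]
          linarith
      _ ≤ _ := by
          gcongr
          have : 0 ≤ 2 * K * ((M : ℝ) + 2) ^ 2 := by positivity
          linarith
  have hβle : β ≤ Cr := by
    have e : β = ENNReal.ofReal (2 * (K / volume.real (ball c ℓ)) * volume.real (ball c ℓ) *
        ((M + 2) * ℓ) ^ 2) := by
      rw [ENNReal.ofReal_mul (by positivity), ENNReal.ofReal_mul (by positivity),
        ENNReal.ofReal_mul zero_le_two, ← hvolE, ENNReal.ofReal_ofNat]
    rw [e]
    apply ENNReal.ofReal_le_ofReal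
    calc 2 * (K / volume.real (ball c ℓ)) * volume.real (ball c ℓ) * ((M + 2) * ℓ) ^ 2
        = 2 * K * (M + 2) ^ 2 * r ^ 2 * q ^ m := by
          rw [hqm, mul_assoc 2, div_mul_cancel₀ _ hvolS0.ne', hℓ]; ring
      _ ≤ _ := by
          gcongr
          have : 0 ≤ 2 ^ (m₀ + 1) * b₁ := by positivity
          linarith
  -- the inequality for test functions on the bounded region
  have htest : ∀ φ, IsTest (ball x₀ r) φ → ∫⁻ x in D, ‖φ x‖ₑ ^ 2 ≤
      Cr * (∫⁻ x in D, ‖√(V' x) * φ x‖ₑ ^ 2) + Cr * ∫⁻ x in D, ‖gradient φ x‖ₑ ^ 2 := by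
    intro φ hφ
    have hΩ := (isOpen_graphDomain hΨ).measurableSet
    have h1 := hFP φ hφ
    have hg : ∀ x, ‖fderiv ℝ φ x‖ₑ = ‖gradient φ x‖ₑ := fun x => by
      rw [← enorm_norm (gradient φ x), norm_gradient, enorm_norm]
    have hs : ∀ x, v x * ‖φ x‖ₑ ^ 2 = ‖√(V' x) * φ x‖ₑ ^ 2 := fun x => by
      rw [enorm_mul, mul_pow, ← ofReal_eq_enorm_sqrt_sq]
    simp_rw [hg, hs] at h1
    rw [setLIntegral_graphDomain_eq hΩ (x₀ := x₀) (r := r)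
        (fun x hx => by simp [(hφ.eq_zero hx).1]),
      setLIntegral_graphDomain_eq hΩ (x₀ := x₀) (r := r)
        (fun x hx => by simp [(hφ.eq_zero hx).1]),
      setLIntegral_graphDomain_eq hΩ (x₀ := x₀) (r := r)
        (fun x hx => by simp [(hφ.eq_zero hx).2])] at h1
    refine h1.trans ?_
    gcongr
  -- Local boundedness of `V` makes `√V φ_j` converge in `L²` along with `φ_j`.
  have hsb : ∀ᵐ x ∂volume.restrict D,
      |√(V' x)| ≤ √(K / volume.real (ball x₀ r) * ∫ z in ball x₀ r, V z) := by
    filter_upwards [ae_restrict_of_ae_restrict_of_subset inter_subset_left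
      (hV.le_mul_integral x₀ hr), ae_restrict_of_ae hVV'] with x hx hx'
    rw [abs_of_nonneg (Real.sqrt_nonneg _), ← hx']
    exact Real.sqrt_le_sqrt hx
  have hfinal := hw.lintegral_sq_le hV'm.sqrt hsb ENNReal.ofReal_ne_top ENNReal.ofReal_ne_top htest
  refine hfinal.trans_eq ?_
  rw [← mul_add]
  congr 2
  refine lintegral_congr_ae ?_
  filter_upwards [ae_restrict_of_ae hVV'] with x hx
  rw [enorm_mul, mul_pow, ← ofReal_eq_enorm_sqrt_sq, hx, ENNReal.ofReal_mul' (sq_nonneg _),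
    ofReal_sq_eq_enorm_sq]

/-! ### Decay of solutions -/

/-- Test functions for the smaller set are test functions for the larger one and vanish, with their
derivatives, on the difference. -/
lemma NeumannSolution.mono {M : ℝ≥0} {μ : ℝ} {Ψ : EuclideanSpace ℝ (Fin n) → ℝ}
    {A : E n → Matrix (Fin (n + 1)) (Fin (n + 1)) ℝ} {V : E n → ℝ} {x₀ : E n} {r : ℝ}
    {u : E n → ℝ} {G : E n → E n} (h : NeumannSolution M μ Ψ A V x₀ r u G) {s : ℝ} (hs : s ≤ r) :
    NeumannSolution M μ Ψ A V x₀ s u G where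
  lip := h.lip
  elliptic := h.elliptic
  pos := h.pos
  bounded := h.bounded.mono_measure (Measure.restrict_mono (ball_subset_ball hs) le_rfl)
  sobolev :=
    { memLp := h.sobolev.memLp.mono_measure (Measure.restrict_mono (bdryBall_mono _ _ hs) le_rfl)
      grad_memLp := h.sobolev.grad_memLp.mono_measure
        (Measure.restrict_mono (bdryBall_mono _ _ hs) le_rfl)
      weak_grad := fun φ hφ i => by
        have hz : ∀ x ∉ bdryBall (graphDomain Ψ) x₀ s, φ x = 0 ∧ pderiv φ i x = 0 := fun x hx => by
          have hx' : x ∉ tsupport φ := fun h => hx (hφ.2.2 h)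
          refine ⟨image_eq_zero_of_notMem_tsupport hx', ?_⟩
          rw [pderiv, image_eq_zero_of_notMem_tsupport fun h => hx' (tsupport_fderiv_subset ℝ h)]
          rfl
        have := h.sobolev.weak_grad φ ⟨hφ.1, hφ.2.1, hφ.2.2.trans (bdryBall_mono _ _ hs)⟩ i
        rw [setIntegral_eq_of_subset_of_forall_sdiff_eq_zero (measurableSet_bdryBall h.lip _ _)
            (bdryBall_mono _ _ hs) fun x hx => by rw [(hz x hx.2).2, mul_zero],
          setIntegral_eq_of_subset_of_forall_sdiff_eq_zero (measurableSet_bdryBall h.lip _ _)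
            (bdryBall_mono _ _ hs) fun x hx => by rw [(hz x hx.2).1, mul_zero]] at this
        exact this }
  eqn := fun φ hφ => by
    have := h.eqn φ ⟨hφ.1, hφ.2.1, hφ.2.2.trans (ball_subset_ball hs)⟩
    rwa [setIntegral_eq_of_subset_of_forall_sdiff_eq_zero (measurableSet_bdryBall h.lip _ _)
      (bdryBall_mono _ _ hs)] at this
    intro x hx
    have hx' : x ∉ tsupport φ := fun h => hx.2 ⟨hφ.2.2 h, hx.1.2⟩
    have h1 : ∀ i, pderiv φ i x = 0 := fun i => by
      rw [pderiv, image_eq_zero_of_notMem_tsupport fun h => hx' (tsupport_fderiv_subset ℝ h)]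
      rfl
    simp [h1, image_eq_zero_of_notMem_tsupport hx']

/-- Shrinking the radius gains a power of the constant in the Fefferman-Phong inequality. -/
theorem decay_step (hn : 1 ≤ n) (M : ℝ≥0) {μ : ℝ} (hμ : 0 < μ) {K : ℝ} (hK : 1 ≤ K) :
    ∃ C y q : ℝ, 0 < C ∧ 1 < y ∧ 0 < q ∧ q < 1 ∧
    ∀ {Ψ : EuclideanSpace ℝ (Fin n) → ℝ} {A : E n → Matrix (Fin (n + 1)) (Fin (n + 1)) ℝ}
      {V : E n → ℝ} {x₀ : E n} {r : ℝ} {u : E n → ℝ} {G : E n → E n},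
      NeumannSolution M μ Ψ A V x₀ r u G → IsBInfty K V → 0 < r → 1 ≤ psi V x₀ r →
      ∃ m : ℕ, psi V x₀ r < y ^ (m + 1) ∧ ∀ {s' s : ℝ}, 0 < s' → s' < s → s < r →
        ∫⁻ x in bdryBall (graphDomain Ψ) x₀ s', ‖u x‖ₑ ^ 2 ≤
          ENNReal.ofReal (C * (r / (s - s')) ^ 2 * q ^ m) *
            ∫⁻ x in bdryBall (graphDomain Ψ) x₀ s, ‖u x‖ₑ ^ 2 := by
  obtain ⟨C, y, q, hC0, hy, hq0, hq1, hFP⟩ := feffermanPhong hn M hK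
  obtain ⟨C₁, hC₁0, hC₁⟩ := caccioppoli n hμ
  obtain ⟨C₀, hC₀0, hC₀⟩ := exists_cutoff n
  refine ⟨C * C₁ * C₀ ^ 2, y, q, by positivity, hy, hq0, hq1, ?_⟩
  intro Ψ A V x₀ r u G hsol hV hr hN
  obtain ⟨m, hm, hFP⟩ := hFP hsol.lip hV hr hN
  refine ⟨m, hm, fun {s' s} hs' hss hsr => ?_⟩
  have hds : 0 < s - s' := sub_pos.2 hss
  obtain ⟨η, hη, hη01, hη1, hη0, hηg⟩ := hC₀ x₀ s' s r hs' hss hsr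
  set D := bdryBall (graphDomain Ψ) x₀ r with hD
  have hlim := hsol.sobolev.isTestLimit hsol.lip hη (F := fun t => t) (B := 1) contDiff_id rfl
    (fun t => by simp)
  -- With `F` and `h` the identity this is the classical Caccioppoli inequality, whose left side is
  -- exactly the energy of `η u` in the Fefferman-Phong inequality.
  have hcac := hC₁ hsol.lip hsol.elliptic hsol.pos hsol.bounded hsol.sobolev hsol.eqn hη
    (F := fun t => t) (h := fun t => t) (B := 1) (B' := 1) contDiff_id contDiff_id rfl rfl
    (fun t => by simp) (fun t => by simp) (fun t => by simp) (fun t => by simp)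
    (fun t => mul_self_nonneg t)
  set g : E n → E n := fun x => (η x * deriv (fun t : ℝ => t) (u x)) • G x + u x • gradient η x
  have hgm : AEMeasurable (fun x => ‖g x‖ₑ ^ 2) (volume.restrict D) :=
    hlim.grad_memLp.1.enorm.pow_const 2
  calc ∫⁻ x in bdryBall (graphDomain Ψ) x₀ s', ‖u x‖ₑ ^ 2
      = ∫⁻ x in bdryBall (graphDomain Ψ) x₀ s', ‖η x * u x‖ₑ ^ 2 :=
        setLIntegral_congr_fun (measurableSet_bdryBall hsol.lip _ _)
          fun x hx => by simp only [hη1 x hx.1, one_mul]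
    _ ≤ ∫⁻ x in D, ‖η x * u x‖ₑ ^ 2 := lintegral_mono_set (bdryBall_mono _ _ (hss.trans hsr).le)
    _ ≤ ENNReal.ofReal (C * r ^ 2 * q ^ m) *
          ((∫⁻ x in D, ENNReal.ofReal (V x * (η x * u x) ^ 2)) + ∫⁻ x in D, ‖g x‖ₑ ^ 2) := hFP hlim
    _ = ENNReal.ofReal (C * r ^ 2 * q ^ m) *
          ∫⁻ x in D, (‖g x‖ₑ ^ 2 + ENNReal.ofReal (V x * (η x ^ 2 * (u x * u x)))) := by
        rw [lintegral_add_left' hgm, add_comm]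
        congr 3 with x
        congr 2
        ring
    _ ≤ ENNReal.ofReal (C * r ^ 2 * q ^ m) *
          (ENNReal.ofReal C₁ * ∫⁻ x in D, ‖u x‖ₑ ^ 2 * ‖gradient η x‖ₑ ^ 2) :=
        mul_le_mul_right hcac _
    _ ≤ ENNReal.ofReal (C * r ^ 2 * q ^ m) * (ENNReal.ofReal C₁ *
          ∫⁻ x in bdryBall (graphDomain Ψ) x₀ s,
            ENNReal.ofReal ((C₀ / (s - s')) ^ 2) * ‖u x‖ₑ ^ 2) := by
        rw [hD, setLIntegral_bdryBall_eq hsol.lip hsr.le (fun x hx => by simp [(hη0 x hx).2])]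
        refine mul_le_mul_right (mul_le_mul_right (lintegral_mono fun x => ?_) _) _
        dsimp only
        rw [mul_comm, ENNReal.ofReal_pow (by positivity), ← ofReal_norm (gradient η x)]
        gcongr
        exact hηg x
    _ = _ := by
        rw [lintegral_const_mul' _ _ ENNReal.ofReal_ne_top, ← mul_assoc, ← mul_assoc,
          ← ENNReal.ofReal_mul (by positivity), ← ENNReal.ofReal_mul (by positivity)]
        congr 2
        rw [div_pow, div_pow]
        ring

/-- Decay of the `L²` norm of a solution, of arbitrary polynomial order in `ψ(x₀, r)`. -/
theorem decay (hn : 1 ≤ n) (M : ℝ≥0) {μ : ℝ} (hμ : 0 < μ) {K : ℝ} (hK : 1 ≤ K) (k : ℕ) :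
    ∃ C : ℝ, 0 < C ∧
    ∀ {Ψ : EuclideanSpace ℝ (Fin n) → ℝ} {A : E n → Matrix (Fin (n + 1)) (Fin (n + 1)) ℝ}
      {V : E n → ℝ} {x₀ : E n} {r : ℝ} {u : E n → ℝ} {G : E n → E n},
      NeumannSolution M μ Ψ A V x₀ r u G → IsBInfty K V → 0 < r →
      ∫⁻ x in bdryBall (graphDomain Ψ) x₀ (3 * r / 4), ‖u x‖ₑ ^ 2 ≤
        ENNReal.ofReal (C / max 1 (psi V x₀ r) ^ k) *
          ∫⁻ x in bdryBall (graphDomain Ψ) x₀ r, ‖u x‖ₑ ^ 2 := by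
  obtain ⟨C, y, q, hC0, hy, hq0, hq1, hstep⟩ := decay_step hn M hμ hK
  have hy0 : 0 < y := one_pos.trans hy
  -- Enough steps for the gain `q ^ J` to beat `y ^ k`, the growth of `ψ ^ k` when `m` increases by
  -- one; `J` does not depend on the solution.
  obtain ⟨J, hJ⟩ : ∃ J : ℕ, q ^ J < 1 / y ^ k := exists_pow_lt_of_lt_one (by positivity) hq1
  have hJ0 : 0 < J := by
    rcases J.eq_zero_or_pos with rfl | h
    · rw [pow_zero, one_lt_div (by positivity)] at hJ
      exact absurd hJ (not_lt.2 (one_le_pow₀ hy.le))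
    · exact h
  have hJR : (0 : ℝ) < J := by exact_mod_cast hJ0
  rw [lt_div_iff₀ (by positivity)] at hJ
  set b : ℝ := C * (8 * J) ^ 2 with hb
  have hb0 : 0 < b := by positivity
  refine ⟨1 + b ^ J * y ^ k, by positivity, ?_⟩
  intro Ψ A V x₀ r u G hsol hV hr
  set I := ∫⁻ x in bdryBall (graphDomain Ψ) x₀ r, ‖u x‖ₑ ^ 2 with hI
  rcases lt_or_ge (psi V x₀ r) 1 with hN | hN
  · rw [max_eq_left hN.le, one_pow, div_one]
    refine (lintegral_mono_set (bdryBall_mono _ _ (by linarith : 3 * r / 4 ≤ r))).trans ?_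
    refine le_mul_of_one_le_left zero_le ?_
    rw [ENNReal.one_le_ofReal]
    have : 0 ≤ b ^ J * y ^ k := by positivity
    linarith
  rw [max_eq_right hN]
  set N := psi V x₀ r
  have hN0 : 0 < N := one_pos.trans_le hN
  obtain ⟨m, hm, hstep⟩ := hstep hsol hV hr hN
  have hδ : 0 < r / (8 * J) := by positivity
  -- The radii run from `7r/8`, strictly below `r`, to `3r/4` in `J` equal steps of length `r/(8J)`,
  -- which explains the factor `(8J)²` in `b`.
  have hit : ∀ i : ℕ, i ≤ J →
      ∫⁻ x in bdryBall (graphDomain Ψ) x₀ (7 * r / 8 - i * (r / (8 * J))), ‖u x‖ₑ ^ 2 ≤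
        ENNReal.ofReal ((b * q ^ m) ^ i) * I := by
    intro i
    induction i with
    | zero =>
      intro _
      simp only [Nat.cast_zero, zero_mul, sub_zero, pow_zero, ENNReal.ofReal_one, one_mul]
      exact lintegral_mono_set (bdryBall_mono _ _ (by linarith))
    | succ i ih =>
      intro hi
      have hiJ : ((i + 1 : ℕ) : ℝ) * (r / (8 * J)) ≤ r / 8 := by
        have : ((i + 1 : ℕ) : ℝ) ≤ J := by exact_mod_cast hi
        calc _ ≤ (J : ℝ) * (r / (8 * J)) := by gcongr
          _ = r / 8 := by field_simp
      have hi0 : 0 ≤ (i : ℝ) * (r / (8 * J)) := by positivity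
      have hi1 : ((i + 1 : ℕ) : ℝ) * (r / (8 * J)) = i * (r / (8 * J)) + r / (8 * J) := by
        push_cast; ring
      have he : (7 * r / 8 - i * (r / (8 * J))) - (7 * r / 8 - (i + 1 : ℕ) * (r / (8 * J))) =
          r / (8 * J) := by rw [hi1]; ring
      refine (hstep (s := 7 * r / 8 - i * (r / (8 * J))) (by linarith) (by linarith)
        (by linarith)).trans ?_
      rw [he, div_div_cancel₀ hr.ne', ← hb, pow_succ' (b * q ^ m),
        ENNReal.ofReal_mul (by positivity : 0 ≤ b * q ^ m), mul_assoc (ENNReal.ofReal _)]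
      exact mul_le_mul_right (ih (by omega)) _
  have hlast := hit J le_rfl
  have he : 7 * r / 8 - J * (r / (8 * J)) = 3 * r / 4 := by field_simp; ring
  rw [he] at hlast
  refine hlast.trans ?_
  gcongr
  rw [le_div_iff₀ (by positivity)]
  calc (b * q ^ m) ^ J * N ^ k ≤ (b * q ^ m) ^ J * (y ^ (m + 1)) ^ k := by gcongr
    _ = b ^ J * y ^ k * (q ^ J * y ^ k) ^ m := by ring
    _ ≤ b ^ J * y ^ k * 1 := by
        gcongr
        exact pow_le_one₀ (by positivity) hJ.le
    _ ≤ _ := by linarith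

end GraphSchrodinger

end

/-! ### Pointwise decay from `L²` decay and local boundedness -/

theorem lemma3p2 (n : ℕ) (hn : 3 ≤ n + 1) (μ : ℝ) (hμ : 0 < μ) (M : ℝ≥0) (K : ℝ)
    (k : ℕ) (hk : 0 < k) :
    ∃ C : ℝ, 0 < C ∧
      ∀ (Ψ : EuclideanSpace ℝ (Fin n) → ℝ), LipschitzWith M Ψ →
      ∀ (A : E n → Matrix (Fin (n + 1)) (Fin (n + 1)) ℝ),
        IsEllipticSymm (graphDomain Ψ) μ A →
      ∀ (V : E n → ℝ), IsBInfty K V →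
      ∀ (x₀ : E n), x₀ ∈ closure (graphDomain Ψ) →
      ∀ (r : ℝ), 0 < r →
      ∀ (u : E n → ℝ), IsWeakNeumannSolution (graphDomain Ψ) A V x₀ r u →
        ∀ᵐ x ∂volume.restrict (bdryBall (graphDomain Ψ) x₀ (r / 2)),
          |u x| ≤ C / (1 + r * fpsMax x₀ V) ^ k *
            (⨍ y in bdryBall (graphDomain Ψ) x₀ r, |u y| ^ 2) ^ (1 / 2 : ℝ) := by
  have hn1 : 1 ≤ n := by omega
  -- `K` is fixed before `V`, so `1 ≤ K`, needed for the choice of `θ`, is arranged by weakening the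
  -- constant.
  set K₁ := max K 1
  have hK₁ : 1 ≤ K₁ := le_max_right _ _
  obtain ⟨CL, hCL0, hCL⟩ := local_bound hn1 M hμ
  obtain ⟨CD, hCD0, hCD⟩ := decay hn1 M hμ hK₁ k
  have hb₁ := volume_real_unit_ball_pos (n := n)
  set b₁ := volume.real (ball (0 : E n) 1)
  -- Bound for the square of the constant: `(4 + 8 K₁) ^ k` converts `ψ` into `1 + r m`, and `b₁ 4 ^
  -- (n + 1)` compares the volume of the ball with the gap `r/4` between `3r/4` and `r/2`.
  set Q : ℝ := CL * CD * (4 + 8 * K₁) ^ k * b₁ * 4 ^ (n + 1) with hQ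
  have hQ0 : 0 < Q := by positivity
  refine ⟨√Q, Real.sqrt_pos.2 hQ0, ?_⟩
  intro Ψ hΨ A hA V hV x₀ _ r hr u ⟨G, hG, heqn⟩
  have hV₁ : IsBInfty K₁ V := hV.weaken (le_max_left _ _)
  have hsol : NeumannSolution M μ Ψ A V x₀ r u G :=
    ⟨hΨ, hA, hV.pos, hV.locBounded x₀ r, hG, heqn⟩
  set D := bdryBall (graphDomain Ψ) x₀ r with hD
  -- Only this upper bound on the volume is needed: the mean over `D` dominates the integral divided
  -- by the volume of the full ball.
  have hDle : volume.real D ≤ r ^ (n + 1) * b₁ := by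
    rw [← volume_real_ball x₀ hr.le]
    exact measureReal_mono inter_subset_left measure_ball_lt_top.ne
  -- For null `D` the almost everywhere claim is vacuous; otherwise division by the volume is
  -- legitimate.
  rcases (measureReal_nonneg (μ := volume) (s := D)).eq_or_lt with hvol | hvol
  · have h0 : volume D = 0 := by
      have hfin : volume D ≠ ⊤ :=
        ne_top_of_le_ne_top measure_ball_lt_top.ne (measure_mono inter_subset_left)
      exact (measureReal_eq_zero_iff hfin).1 hvol.symm
    have h1 : volume (bdryBall (graphDomain Ψ) x₀ (r / 2)) = 0 :=
      measure_mono_null (bdryBall_mono _ _ (half_le_self hr.le)) h0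
    rw [Measure.restrict_eq_zero.2 h1, ae_zero]
    exact Filter.eventually_bot
  set P : ℝ := max 1 (psi V x₀ r) with hP
  have hP1 : 1 ≤ P := le_max_left _ _
  set I : ℝ := ∫ y in D, |u y| ^ 2 with hI
  have hI0 : 0 ≤ I := integral_nonneg fun y => by positivity
  have hII : ∫⁻ y in D, ‖u y‖ₑ ^ 2 = ENNReal.ofReal I := by
    rw [hI, ofReal_integral_eq_lintegral_ofReal]
    · exact lintegral_congr fun y => by rw [sq_abs, ofReal_sq_eq_enorm_sq]
    · simpa using hG.memLp.integrable_sq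
    · exact ae_of_all _ fun y => by positivity
  have hm0 : 0 ≤ fpsMax x₀ V := Real.sInf_nonneg (by rintro s ⟨ρ, hρ, -, rfl⟩; positivity)
  set t := r * fpsMax x₀ V with ht
  have ht0 : 0 ≤ t := by positivity
  have htP : (1 + t) ^ 2 ≤ (4 + 8 * K₁) * P := by
    have h1 : t ^ 2 ≤ 1 + 4 * K₁ * P := by
      refine (hV₁.sq_mul_fpsMax_le (by linarith) hn1 x₀ hr).trans ?_
      gcongr
      exact le_max_right _ _
    nlinarith [sq_nonneg (1 - t)]
  rw [setAverage_eq, smul_eq_mul, ← hI, ← Real.sqrt_eq_rpow]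
  refine hCL (hsol.mono (s := 3 * r / 4) (by linarith)) (by linarith) (by linarith)
    (by positivity) ?_
  calc ENNReal.ofReal CL * ∫⁻ x in bdryBall (graphDomain Ψ) x₀ (3 * r / 4), ‖u x‖ₑ ^ 2
      ≤ ENNReal.ofReal CL * (ENNReal.ofReal (CD / P ^ k) * ENNReal.ofReal I) := by
        rw [← hII]
        exact mul_le_mul_right (hCD hsol hV₁ hr) _
    _ = ENNReal.ofReal (CL * (CD / P ^ k * I)) := by
        rw [← ENNReal.ofReal_mul (by positivity), ← ENNReal.ofReal_mul hCL0.le]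
    _ ≤ _ := by
        apply ENNReal.ofReal_le_ofReal
        have hP0 : 0 < P := by linarith
        have h1 : ((1 + t) ^ k) ^ 2 ≤ (4 + 8 * K₁) ^ k * P ^ k := by
          rw [← pow_mul, mul_comm k, pow_mul, ← mul_pow]
          gcongr
        rw [mul_pow, div_pow, Real.sq_sqrt hQ0.le, Real.sq_sqrt (by positivity)]
        calc CL * (CD / P ^ k * I)
            = Q / ((4 + 8 * K₁) ^ k * P ^ k) * ((r ^ (n + 1) * b₁)⁻¹ * I) *
                (3 * r / 4 - r / 2) ^ (n + 1) := by
              rw [hQ, show 3 * r / 4 - r / 2 = r / 4 by ring, div_pow]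
              field_simp
          _ ≤ _ := by
              have : 0 < 3 * r / 4 - r / 2 := by linarith
              gcongr
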